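/- **Setting.** An *LP-type problem* $(H,f)$ is a non-empty finite set $H$ with a function $f:2^H\to T$ into a totally ordered set such that $f(F)\le f(G)$ whenever $F\subseteq G\subseteq H$ (monotonicity), and such that $F\subseteq G\subseteq H$, $f(F)=f(G)$ and $f(G)<f(G\cup\{h\})$ imply $f(F)<f(F\cup\{h\})$ (locality). A set $B\subseteq H$ is a *basis* if $f(B')<f(B)$ for all $B'\subsetneq B$; an *optimal basis* of $R\subseteq H$ is a basis $B\subseteq R$ with $f(B)=f(R)$. The *combinatorial dimension* $d$ of $(H,f)$ is the maximum cardinality of a basis. In the *uniform gossip model* there are $n$ anonymous nodes working in synchronous rounds. A node communicates only by *push* operations (send a message to a uniformly random node) and *pull* operations (ask a uniformly random node for a message); its *work* in a round is the number of these operations. **The Low-Load Clarkson Algorithm.** Every node knows $f$, $d$, a constant-factor estimate $L$ of $\log n$, constants $c_s,c_t\in\mathbb N$, and a linear order of $H$ (for tie-breaking). Initially every element of $H$ is placed at an independent uniformly random node; $H_0(v)$ is the (multi)set of elements at $v$, and $H(v)\supseteq H_0(v)$ is the multiset of elements held by $v$, initially $H_0(v)$. In the *basic* version no node is ever in a pull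 phase; in the *extended* version the nodes with $H_0(v)=\emptyset$ start in the pull phase. Every node also keeps a set $S(v)$ of triples $(t,B,x)$, initially empty. A node that has stopped sends nothing, ignores what it receives, and answers pulls with "nothing". Iteration $t=0,1,2,\dots$ (three communication rounds) of a node $v$ that has not stopped: 1. Push every triple in $S(v)$. 2. If $v$ is in its pull phase: pull a uniformly random element of $H_0(w)$ from a uniformly random node $w$; if an element $h$ is returned, push $(h,0)$ and leave the pull phase. Otherwise: pull a uniformly random copy from $H(w)$ from each of $c_s(6d^2+L)$ independent uniformly random nodes $w$, and choose $6d^2$ of the distinct returned copies uniformly at random as the multiset $R$ (this fails if there are fewer). If it succeeds, let $W=\{h\in H(v): f(R)<f(R\cup\{h\})\}$ (a multiset) and push all elements of $W$; if $W=\emptyset$, choose an optimal basis $B$ of $R$, add $(t,B,1)$ to $S(v)$ and push it. 3. Add every received $(h,0)$ to $H_0(v)$ and every received $h$ to $H(v)$; then keep each element of $H(v)-H_0(v)$ independently with probability $1/(1+1/(2d))$. 4. Add the received triples to $S(v)$, and among triples with the same $t$ keep only the one with largest $f(B)$ (ties between different $B$ are broken by a fixed lexicographic order; for equal $B$ the smaller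 $x$ wins). In every triple with $f(B)<f(B\cup H(v))$ set $x:=0$. Remove every triple with $t<(\text{index of the next iteration})-c_tL$; if such a triple has $x=1$, output $B$ (with the value $f(B)$) and stop. **Theorem.** There is an absolute constant $\varepsilon>0$ such that for all $K,\gamma,\alpha,\beta>0$ there is $c_0$ such that for all integers $c_s,c_t\ge c_0$ there are $C$ and $n_0$ with the following property. Let $n\ge n_0$, let $(H,f)$ be an LP-type problem of combinatorial dimension $d$ with $1\le d\le n^{\varepsilon}$ (in particular, any constant $d\ge 1$ is allowed once $n$ is large) and $1\le |H|\le K\,n\log n$, and let $\alpha\log n\le L\le\beta\log n$. Then there is a number of communication rounds, at most $C\,d\log n$, such that with probability at least $1-n^{-\gamma}$, after these rounds all nodes have stopped, each having output an optimal basis of $H$; no node has ever had work more than $C(d^2+\log n)$ in a round; and every message had at most $C\log n$ bits if it carried a single element (or none), and at most $C\,d\log n$ bits (thus $O(\log n)$ for constant $d$) if it was a triple $(t,B,x)$, which carries up to $d$ elements. This holds for the basic version if $|H|\ge n$, and for the extended version for every $|H|\ge1$. -/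

import Mathlib

open scoped NNReal

universe u v w

namespace LowLoad

noncomputable section

/-! ### LP-type problems -/

/-- `(H, f)` is an LP-type problem: `f` is monotone and local. The ground set is the whole
finite type `H`. -/
structure IsLPType {H : Type u} {T : Type v} [DecidableEq H] [LinearOrder T]
    (f : Finset H → T) : Prop where
  monotone : ∀ F G : Finset H, F ⊆ G → f F ≤ f G
  locality : ∀ (F G : Finset H) (h : H), F ⊆ G → f F = f G →
    f G < f (insert h G) → f F < f (insert h F)

/-- A basis: every proper subset has a strictly smaller value. -/
def IsBasis {H : Type u} {T : Type v} [LinearOrder T] (f : Finset H → T) (B : Finset H) : Prop :=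
  ∀ B' : Finset H, B' ⊂ B → f B' < f B

/-- `B` is an optimal basis of the set `R`. -/
def IsOptimalBasis {H : Type u} {T : Type v} [LinearOrder T] (f : Finset H → T)
    (R B : Finset H) : Prop :=
  B ⊆ R ∧ IsBasis f B ∧ f B = f R

open Classical in
/-- The combinatorial dimension: the maximum cardinality of a basis. -/
def dim {H : Type u} {T : Type v} [Fintype H] [LinearOrder T] (f : Finset H → T) : ℕ :=
  (Finset.univ.filter (fun B : Finset H => IsBasis f B)).sup Finset.card

open Classical in
/-- An arbitrary optimal basis of `R` (one always exists for a monotone `f`). -/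
def basisOf {H : Type u} {T : Type v} [LinearOrder T] (f : Finset H → T)
    (R : Finset H) : Finset H :=
  if h : ∃ B, IsOptimalBasis f R B then h.choose else ∅

/-! ### Random choices -/

/-- Independent draws, the `i`-th one with law `p i`. -/
def indep {A : Type w} : (k : ℕ) → (Fin k → PMF A) → PMF (Fin k → A)
  | 0, _ => PMF.pure Fin.elim0
  | k + 1, p => (p 0).bind fun a => (indep k fun i => p i.succ).map fun g => Fin.cons a g

/-- The probability `1 / (1 + 1 / (2 d))` with which a copy survives the filtering step. -/
def keepProb (d : ℕ) : ℝ≥0 := 1 / (1 + 1 / (2 * (d : ℝ≥0)))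

theorem keepProb_le_one (d : ℕ) : keepProb d ≤ 1 := by
  unfold keepProb
  exact div_le_one_of_le₀ (le_add_of_nonneg_right (zero_le)) (zero_le)

/-- Each listed copy is kept independently with probability `keepProb d`. -/
def thin {H : Type u} (d : ℕ) : List H → PMF (Multiset H)
  | [] => PMF.pure 0
  | h :: l => (thin d l).bind fun s =>
      (PMF.bernoulli (keepProb d) (keepProb_le_one d)).map fun keep => if keep then h ::ₘ s else s

/-! ### Messages and local states -/

/-- A triple `(t, B, x)` of the termination detection. -/
structure Entry (H : Type u) where
  iter : ℕ
  basis : Finset H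
  valid : Bool
  deriving DecidableEq

/-- The messages that are pushed: `elem h` is a copy of `h`, `orig h` is the pair `(h, 0)` of the
pull phase, and `entry e` belongs to the termination detection. -/
inductive Msg (H : Type u) where
  | elem (h : H)
  | orig (h : H)
  | entry (e : Entry H)

/-- The element carried by a message `h`. -/
def Msg.elem? {H : Type u} : Msg H → Option H
  | .elem h => some h
  | _ => none

/-- The element carried by a message `(h, 0)`. -/
def Msg.orig? {H : Type u} : Msg H → Option H
  | .orig h => some h
  | _ => none

/-- The triple carried by a message of the termination detection. -/
def Msg.entry? {H : Type u} : Msg H → Option (Entry H)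
  | .entry e => some e
  | _ => none

/-- Length in bits of a message without basis (0 for the other messages): two bits for the kind
and an index into `H`. -/
def Msg.elemBits {H : Type u} [Fintype H] : Msg H → ℕ
  | .entry _ => 0
  | _ => 2 + Nat.clog 2 (Fintype.card H)

/-- Length in bits of a message with a basis (0 for the other messages): two bits for the kind,
the iteration number, a list of indices into `H`, and one bit for `x`. -/
def Msg.entryBits {H : Type u} [Fintype H] : Msg H → ℕ
  | .entry e => 2 + Nat.size e.iter + e.basis.card * (1 + Nat.clog 2 (Fintype.card H)) + 1
  | _ => 0

/-- What the nodes know: the dimension `d`, an estimate `L` of `log n`, and the constants of the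
sampling procedure and of the termination detection. -/
structure Params where
  d : ℕ
  L : ℕ
  cs : ℕ
  ct : ℕ

/-- The state of a node `v`. No node identifier is part of it. -/
structure NodeState (H : Type u) where
  /-- `H₀(v)` -/
  orig : Multiset H
  /-- `H(v) - H₀(v)` -/
  copies : Multiset H
  /-- the Boolean variable `pull` -/
  pulling : Bool
  /-- the set `S` of triples -/
  entries : Finset (Entry H)
  /-- the basis `B` whose value `f B` the node has output; the node has stopped iff there is one -/
  output : Option (Finset H)

/-- The multiset `H(v)`. -/
def NodeState.known {H : Type u} (σ : NodeState H) : Multiset H := σ.orig + σ.copies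

/-- A node that has stopped is silent: it answers every request with "nothing". -/
def NodeState.answering {H : Type u} (σ : NodeState H) (m : Multiset H) : Multiset H :=
  if σ.output.isSome then 0 else m

/-! ### The two operations of the uniform gossip model -/

/-- A copy of an element in the multiset `H(V)`: `(v, h, k)` is the `k`-th copy of `h` in the node
`v`. The first and last component only serve to tell whether two replies are the same copy. -/
abbrev CopyOf (n : ℕ) (H : Type u) := Fin n × H × ℕ

/-- A pull operation: a uniformly random node `v` returns a uniformly random copy in
`store v`, or nothing if `store v` is empty. -/
def pullFrom {n : ℕ} [NeZero n] {H : Type u} [DecidableEq H] (store : Fin n → Multiset H) :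
    PMF (Option (CopyOf n H)) :=
  (PMF.uniformOfFintype (Fin n)).bind fun v =>
    if hv : (store v).toEnumFinset.Nonempty then
      (PMF.uniformOfFinset _ hv).map fun c => some (v, c)
    else PMF.pure none

/-- Push operations: every message goes to an independent uniformly random node; the result is the
multiset of messages received by each node. -/
def scatter {n : ℕ} [NeZero n] {H : Type u} : List (Msg H) → PMF (Fin n → Multiset (Msg H))
  | [] => PMF.pure fun _ => 0
  | m :: l => (scatter l).bind fun inbox =>
      (PMF.uniformOfFintype (Fin n)).map fun v => Function.update inbox v (m ::ₘ inbox v)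

/-- Length in bits of the reply to a pull request. -/
def replyBits {n : ℕ} {H : Type u} [Fintype H] : Option (CopyOf n H) → ℕ
  | none => 1
  | some c => 1 + Nat.clog 2 n + Nat.clog 2 (Fintype.card H) + Nat.size c.2.2

/-! ### One iteration of the algorithm -/

/-- The sampling procedure: `s = cs (6 d² + L)` random nodes are asked for a random copy; out of the
distinct copies that are returned, `6 d²` are chosen at random; it fails if there are fewer.
The replies are returned too, and the multiset that is chosen is represented by its support,
on which `f` is evaluated. -/
def sample {n : ℕ} [NeZero n] {H : Type u} [DecidableEq H] (P : Params)
    (store : Fin n → Multiset H) :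
    PMF ((Fin (P.cs * (6 * P.d ^ 2 + P.L)) → Option (CopyOf n H)) × Option (Finset H)) :=
  (indep (P.cs * (6 * P.d ^ 2 + P.L)) fun _ => pullFrom store).bind fun replies =>
    let D : Finset (CopyOf n H) := Finset.eraseNone (Finset.univ.image replies)
    if hD : (D.powersetCard (6 * P.d ^ 2)).Nonempty then
      (PMF.uniformOfFinset _ hD).map fun R => (replies, some (R.image fun c => c.2.1))
    else PMF.pure (replies, none)

/-- What a node does in an iteration: its new state, the messages it pushes, the number of its pull
requests, and the length of the longest reply to one of them. -/
structure Action (H : Type u) where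
  state : NodeState H
  pushes : Multiset (Msg H)
  pulls : ℕ
  replyBits : ℕ

/-- The active half of iteration `t` for a node in state `σ`, in the configuration `x`, which it
accesses by pull operations only. In any case all triples in `S` are pushed. In the pull phase the
node asks for an element of some `H₀(w)`, and on success pushes it as `(h, 0)` and leaves the pull
phase. Otherwise it samples `R` and, on success, pushes all of
`W = {h ∈ H(v) | f R < f (R ∪ {h})}`; if `W` is empty it stores and pushes `(t, B, 1)` for an
optimal basis `B` of `R`. -/
def act {n : ℕ} [NeZero n] {H : Type u} {T : Type v} [Fintype H] [LinearOrder H] [LinearOrder T]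
    (f : Finset H → T) (P : Params) (t : ℕ) (x : Fin n → NodeState H) (σ : NodeState H) :
    PMF (Action H) :=
  if σ.output.isSome then PMF.pure ⟨σ, 0, 0, 0⟩
  else
    let E : Multiset (Msg H) := σ.entries.val.map Msg.entry
    if σ.pulling then
      (pullFrom fun w => (x w).answering (x w).orig).map fun reply =>
        match reply with
        | none => ⟨σ, E, 1, replyBits reply⟩
        | some c => ⟨{ σ with pulling := false }, Msg.orig c.2.1 ::ₘ E, 1, replyBits reply⟩
    else
      (sample P fun w => (x w).answering (x w).known).map fun q =>
        let pulls := P.cs * (6 * P.d ^ 2 + P.L)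
        let bits := Finset.univ.sup fun i => replyBits (q.1 i)
        match q.2 with
        | none => ⟨σ, E, pulls, bits⟩
        | some R =>
          let W := σ.known.filter fun h => f R < f (insert h R)
          if W = 0 then
            let e : Entry H := ⟨t, basisOf f R, true⟩
            ⟨{ σ with entries := insert e σ.entries }, Msg.entry e ::ₘ E, pulls, bits⟩
          else ⟨σ, W.map Msg.elem + E, pulls, bits⟩

/-- The order in which triples of the same iteration are preferred: by `f B`, ties being broken by a
lexicographic order on the sets `B`, and for the same `B` the triple with the smaller `x` wins. -/
def Entry.key {H : Type u} {T : Type v} [LinearOrder H] [LinearOrder T] (f : Finset H → T)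
    (e : Entry H) : T ×ₗ (Colex (Finset H)) ×ₗ Bool :=
  toLex (f e.basis, toLex (toColex e.basis, !e.valid))

/-- Keep only the most preferred triple of each iteration. -/
def mergeEntries {H : Type u} {T : Type v} [LinearOrder H] [LinearOrder T] (f : Finset H → T)
    (S : Finset (Entry H)) : Finset (Entry H) :=
  S.filter fun e => ∀ e' ∈ S, e'.iter = e.iter → e'.key f ≤ e.key f

/-- Set `x := 0` in `(t, B, x)` if `f B < f (B ∪ H(v))`. -/
def Entry.check {H : Type u} {T : Type v} [DecidableEq H] [LinearOrder T] (f : Finset H → T)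
    (K : Finset H) (e : Entry H) : Entry H :=
  { e with valid := e.valid && !decide (f e.basis < f (e.basis ∪ K)) }

open Classical in
/-- The part of the termination detection at the beginning of iteration `t` that precedes the
pushes: merge the received triples, check them against `H(v)`, remove the mature ones, and if a
mature one is valid, output its basis and stop. -/
def terminate {H : Type u} {T : Type v} [LinearOrder H] [LinearOrder T]
    (f : Finset H → T) (P : Params) (t : ℕ) (received : Finset (Entry H)) (σ : NodeState H) :
    NodeState H :=
  let S := (mergeEntries f (σ.entries ∪ received)).image (Entry.check f σ.known.toFinset)
  { σ with
    entries := S.filter fun e => ¬ e.iter + P.ct * P.L < t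
    output := if h : ∃ e ∈ S, e.iter + P.ct * P.L < t ∧ e.valid = true then
        some h.choose.basis else none }

/-- The passive half of iteration `t` for a node in state `σ`: the received elements are added, the
copies are filtered, and the termination detection of iteration `t + 1` is started. -/
def receive {H : Type u} {T : Type v} [LinearOrder H] [LinearOrder T]
    (f : Finset H → T) (P : Params) (t : ℕ) (σ : NodeState H) (inbox : Multiset (Msg H)) :
    PMF (NodeState H) :=
  if σ.output.isSome then PMF.pure σ
  else
    (thin P.d (σ.copies + inbox.filterMap Msg.elem?).toList).map fun copies =>
      terminate f P (t + 1) (inbox.filterMap Msg.entry?).toFinset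
        { σ with orig := σ.orig + inbox.filterMap Msg.orig?, copies := copies }

/-! ### The algorithm -/

/-- The configuration after a number of iterations, with the maxima over all nodes and all these
iterations of the work (the number of pull and push operations of a node in an iteration) and of
the length of the messages without and with a basis. -/
structure Execution (n : ℕ) (H : Type u) where
  config : Fin n → NodeState H
  maxWork : ℕ
  maxElemBits : ℕ
  maxEntryBits : ℕ

/-- The initial configuration for a placement of the elements. With `ext = true` the nodes without
elements start in the pull phase, with `ext = false` there is no pull phase. -/
def initial {n : ℕ} {H : Type u} [Fintype H] (ext : Bool) (place : H → Fin n) :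
    Fin n → NodeState H := fun v =>
  let own := Finset.univ.val.filter fun h => place h = v
  ⟨own, 0, ext && decide (own.card = 0), ∅, none⟩

/-- Iteration `t`: all nodes act in parallel, the messages are delivered, all nodes process them. -/
def step {n : ℕ} [NeZero n] {H : Type u} {T : Type v} [Fintype H] [LinearOrder H] [LinearOrder T]
    (f : Finset H → T) (P : Params) (t : ℕ) (e : Execution n H) : PMF (Execution n H) :=
  (indep n fun v => act f P t e.config (e.config v)).bind fun a =>
    (scatter (∑ v, (a v).pushes).toList).bind fun inbox =>
      (indep n fun v => receive f P t (a v).state (inbox v)).map fun config =>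
        { config := config
          maxWork := max e.maxWork
            (Finset.univ.sup fun v => (a v).pulls + Multiset.card (a v).pushes)
          maxElemBits := max e.maxElemBits (Finset.univ.sup fun v =>
            max (a v).replyBits (((a v).pushes.map Msg.elemBits).toFinset.sup id))
          maxEntryBits := max e.maxEntryBits (Finset.univ.sup fun v =>
            ((a v).pushes.map Msg.entryBits).toFinset.sup id) }

/-- The law of the execution of the Low-Load Clarkson Algorithm (extended by a pull phase if
`ext = true`) after `k` iterations; initially every element is in an independent uniformly random
node. -/
def run {H : Type u} {T : Type v} [Fintype H] [LinearOrder H] [LinearOrder T]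
    (n : ℕ) [NeZero n] (f : Finset H → T) (P : Params) (ext : Bool) : ℕ → PMF (Execution n H)
  | 0 => (PMF.uniformOfFintype (H → Fin n)).map fun place => ⟨initial ext place, 0, 0, 0⟩
  | k + 1 => (run n f P ext k).bind (step f P k)

/-- The number of communication rounds of an iteration: one for pulling, one for pushing, and one
for processing what has been received. -/
def roundsPerIteration : ℕ := 3

end

end LowLoad

/-!
The execution is analysed as a Markov chain that is killed as soon as something unlikely happens.
A configuration is `Regular` if it satisfies the invariants that hold as long as no node stops, and
`Good` if none of the bad events below occurs. The argument has a deterministic part and a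
probabilistic one.

*Deterministic part.* From a regular and good configuration, an iteration leads to a regular
configuration again, or all nodes stop with an optimal basis (`Regular.step`). For the triples whose
age reaches `c_t L` are held by all nodes, and if the basis of such a triple is not optimal, then by
locality a single original element violates it, the node with this element has noticed the
violation, and all nodes know about it (`optimal_of_holders`, `outputs_of_output`). Conversely,
once an optimal triple exists, it is never replaced by a worse one or invalidated, so the regular
configurations come to an end when it matures (`Regular.lt_of_lt`). By the decomposition according
to the first exit from the good configurations (`expect_not_le_sum_killed`), it remains to bound,
for every iteration `t`, the probability that the chain is alive before `t` and a bad event occurs at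
`t`.

*Probabilistic part.* Every bad event is controlled by a potential whose expectation does not grow,
or contracts, from one iteration to the next as long as the chain is alive.

* Products `∏ v, wt v ^ (number of original elements at v)` with weights of average at most `1` are
  supermartingales (`expect_step_prod_orig_le`). Suitable weights show that no node holds more than
  `O(log n)` original elements (`killed_orig_le`), and that `n / 2` elements are never concentrated
  in fewer than `n / 64` nodes (`killed_suppliers_le`).
* By Clarkson's sampling lemma, in a form for draws that are independent but not uniform
  (`sum_subsetViolProb_le`, `expect_subsetViolProb_le`), an iteration pushes in expectation at most
  a fraction of about `1 / (6 d)` of the copies, while the filtering deletes a fraction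
  of about `1 / (2 d)`. So `2 ^ (number of copies at v)` stays bounded in expectation
  (`expect_step_two_pow_copies_le`).
* In the pull phase, the ratio of the nodes that still pull and the nodes that can supply an
  original element contracts by a constant factor (`expect_step_pullPot_le`): at first the suppliers
  become more, and when there are many of them, the pullers become fewer.
* After the pull phase, either a constant fraction of the samples is optimal, and then an optimal
  triple is almost certainly created, or some element of a fixed optimal basis violates a sample with
  constant probability. In the second case the geometric mean of `1 / √X`, taken over the numbers `X`
  of copies of the elements of the optimal basis, contracts by the factor `1 - 1 / (100 d)`
  (`expect_step_growthPot_le`). As it is always at least `1 / n`, an optimal triple is created within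
  `O(d log n)` iterations. The inverse moments of the binomial distribution that enter here are
  bounded by size biasing (`binom_inv_le`).
* The best triple of an iteration, and then the information that it is invalid, spread like rumours:
  if `i` nodes are informed, the potential `(n - i) / i` contracts by `5 / 6`
  (`expect_step_spreadPot_le`).

A contracting potential that is at least `1 / n` on the bad event makes this event
improbable after `O(log n)` contractions by a constant factor. A union bound over the
`O(n d log n)` events completes the proof (`expect_not_done_le`). The parameters are fixed by
`schedule`, and their inequalities hold for large `n` and `d ≤ n ^ (1 / 10)` (`Scale.admissible`,
`exists_scale`).
-/

set_option linter.unusedSectionVars false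

namespace LowLoad

open scoped ENNReal

noncomputable section

/-! ### Expectations of nonnegative functions -/

/-- The expectation of `g` under the law `p`. With values in `ℝ≥0∞` there are no summability
conditions. -/
def expect {A : Type*} (p : PMF A) (g : A → ℝ≥0∞) : ℝ≥0∞ := ∑' a, p a * g a

section expect

variable {A B : Type*}

theorem expect_pure (a : A) (g : A → ℝ≥0∞) : expect (PMF.pure a) g = g a := by
  classical
  unfold expect
  rw [tsum_eq_single a]
  · simp
  · intro b hb
    simp [PMF.pure_apply, hb]

theorem expect_bind (p : PMF A) (q : A → PMF B) (g : B → ℝ≥0∞) :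
    expect (p.bind q) g = expect p fun a => expect (q a) g := by
  unfold expect
  simp only [PMF.bind_apply, ← ENNReal.tsum_mul_right, ← ENNReal.tsum_mul_left]
  rw [ENNReal.tsum_comm]
  simp only [mul_assoc]

theorem expect_map (p : PMF A) (φ : A → B) (g : B → ℝ≥0∞) :
    expect (p.map φ) g = expect p fun a => g (φ a) := by
  rw [← PMF.bind_pure_comp, expect_bind]
  simp only [Function.comp, expect_pure]

theorem expect_mono_support {p : PMF A} {g g' : A → ℝ≥0∞} (h : ∀ a ∈ p.support, g a ≤ g' a) :
    expect p g ≤ expect p g' := by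
  refine ENNReal.tsum_le_tsum fun a => ?_
  by_cases ha : a ∈ p.support
  · exact mul_le_mul_right (h a ha) _
  · rw [(PMF.apply_eq_zero_iff p a).2 ha]; simp

theorem expect_mono {p : PMF A} {g g' : A → ℝ≥0∞} (h : ∀ a, g a ≤ g' a) :
    expect p g ≤ expect p g' := expect_mono_support fun a _ => h a

theorem expect_congr_support {p : PMF A} {g g' : A → ℝ≥0∞} (h : ∀ a ∈ p.support, g a = g' a) :
    expect p g = expect p g' :=
  le_antisymm (expect_mono_support fun a ha => (h a ha).le)
    (expect_mono_support fun a ha => (h a ha).ge)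

theorem expect_add (p : PMF A) (g g' : A → ℝ≥0∞) :
    expect p (fun a => g a + g' a) = expect p g + expect p g' := by
  simp only [expect, mul_add, ENNReal.tsum_add]

theorem expect_const_mul (p : PMF A) (c : ℝ≥0∞) (g : A → ℝ≥0∞) :
    expect p (fun a => c * g a) = c * expect p g := by
  simp only [expect, ← ENNReal.tsum_mul_left]
  exact tsum_congr fun a => by ring

theorem expect_mul_const (p : PMF A) (c : ℝ≥0∞) (g : A → ℝ≥0∞) :
    expect p (fun a => g a * c) = expect p g * c := by
  simp only [mul_comm _ c, expect_const_mul]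

theorem expect_const (p : PMF A) (c : ℝ≥0∞) : expect p (fun _ => c) = c := by
  simp only [expect, ENNReal.tsum_mul_right, PMF.tsum_coe, one_mul]

theorem expect_sum {ι : Type*} (p : PMF A) (s : Finset ι) (g : ι → A → ℝ≥0∞) :
    expect p (fun a => ∑ i ∈ s, g i a) = ∑ i ∈ s, expect p (g i) := by
  classical
  induction s using Finset.induction_on with
  | empty => simp [expect_const]
  | insert i s hi ih => simp only [Finset.sum_insert hi, expect_add, ih]

theorem expect_le_of_le {p : PMF A} {g : A → ℝ≥0∞} {c : ℝ≥0∞} (h : ∀ a ∈ p.support, g a ≤ c) :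
    expect p g ≤ c :=
  (expect_mono_support h).trans (expect_const p c).le

theorem expect_eq_zero {p : PMF A} {g : A → ℝ≥0∞} (h : ∀ a ∈ p.support, g a = 0) :
    expect p g = 0 := le_antisymm (expect_le_of_le fun a ha => (h a ha).le) zero_le

theorem expect_comm (p : PMF A) (q : PMF B) (g : A → B → ℝ≥0∞) :
    expect p (fun a => expect q (g a)) = expect q fun b => expect p fun a => g a b := by
  unfold expect
  simp only [← ENNReal.tsum_mul_left]
  rw [ENNReal.tsum_comm]
  exact tsum_congr fun b => tsum_congr fun a => by ring

theorem expect_uniformOfFintype [Fintype A] [Nonempty A] (g : A → ℝ≥0∞) :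
    expect (PMF.uniformOfFintype A) g = (∑ a, g a) / Fintype.card A := by
  simp only [expect, tsum_fintype, PMF.uniformOfFintype_apply, ← Finset.mul_sum]
  rw [mul_comm, ENNReal.div_eq_inv_mul, mul_comm]

theorem expect_uniformOfFinset (s : Finset A) (hs : s.Nonempty) (g : A → ℝ≥0∞) :
    expect (PMF.uniformOfFinset s hs) g = (∑ a ∈ s, g a) / s.card := by
  rw [expect, tsum_eq_sum (s := s)]
  · rw [ENNReal.div_eq_inv_mul, Finset.mul_sum]
    exact Finset.sum_congr rfl fun a ha => by rw [PMF.uniformOfFinset_apply_of_mem hs ha]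
  · intro a ha
    rw [PMF.uniformOfFinset_apply_of_notMem hs ha, zero_mul]

/-- The probability of an event is the expectation of its indicator. -/
theorem toOuterMeasure_eq_expect (p : PMF A) (s : Set A) [DecidablePred (· ∈ s)] :
    p.toOuterMeasure s = expect p fun a => if a ∈ s then 1 else 0 := by
  rw [PMF.toOuterMeasure_apply]
  refine tsum_congr fun a => ?_
  by_cases h : a ∈ s <;> simp [h]

/-- If the expectation of a square root is to be bounded, the tangent of the square root at `m ^ 2`
gives Jensen's inequality `E √g ≤ √(E g)`, here with `√(E g) ≤ m`. -/
theorem expect_sqrt_le {p : PMF A} {g : A → ℝ} {m : ℝ} (hm : 0 < m) (hg : ∀ a, 0 ≤ g a)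
    (h : expect p (fun a => ENNReal.ofReal (g a)) ≤ ENNReal.ofReal (m ^ 2)) :
    expect p (fun a => ENNReal.ofReal (√(g a))) ≤ ENNReal.ofReal m := by
  have key : ∀ a, ENNReal.ofReal (√(g a)) ≤
      ENNReal.ofReal (1 / (2 * m)) * ENNReal.ofReal (g a) + ENNReal.ofReal (m / 2) := by
    intro a
    rw [← ENNReal.ofReal_mul (by positivity), ← ENNReal.ofReal_add
      (mul_nonneg (by positivity) (hg a)) (by positivity)]
    refine ENNReal.ofReal_le_ofReal ?_
    have h1 := Real.sq_sqrt (hg a)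
    have h2 := sq_nonneg (√(g a) - m)
    have h3 : 1 / (2 * m) * g a + m / 2 = (g a + m ^ 2) / (2 * m) := by field_simp
    rw [h3, le_div_iff₀ (by positivity)]
    nlinarith
  refine (expect_mono key).trans ?_
  rw [expect_add, expect_const_mul, expect_const]
  refine (add_le_add_left (mul_le_mul_right h _) _).trans ?_
  rw [← ENNReal.ofReal_mul (by positivity), ← ENNReal.ofReal_add (by positivity) (by positivity)]
  refine ENNReal.ofReal_le_ofReal (le_of_eq ?_)
  field_simp
  ring

end expect

/-! ### Independent draws -/

section indep

variable {A : Type w}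

theorem expect_indep_prod : ∀ (k : ℕ) (p : Fin k → PMF A) (g : Fin k → A → ℝ≥0∞),
    expect (indep k p) (fun a => ∏ i, g i (a i)) = ∏ i, expect (p i) (g i)
  | 0, p, g => by simp [indep, expect_pure]
  | k + 1, p, g => by
    simp only [indep, expect_bind, expect_map, Fin.prod_univ_succ, Fin.cons_zero, Fin.cons_succ,
      expect_const_mul]
    rw [expect_indep_prod k (fun i => p i.succ) fun i => g i.succ, expect_mul_const]

theorem expect_indep_single {k : ℕ} (p : Fin k → PMF A) (i : Fin k) (g : A → ℝ≥0∞) :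
    expect (indep k p) (fun a => g (a i)) = expect (p i) g := by
  have := expect_indep_prod k p fun j => if j = i then g else fun _ => 1
  rw [Finset.prod_eq_single i] at this
  · rw [if_pos rfl] at this
    rw [← this]
    congr 1
    funext a
    rw [Finset.prod_eq_single i]
    · rw [if_pos rfl]
    · intro j _ hj; rw [if_neg hj]
    · simp
  · intro j _ hj
    rw [if_neg hj, expect_const]
  · simp

theorem mem_support_indep : ∀ {k : ℕ} {p : Fin k → PMF A} {a : Fin k → A},
    a ∈ (indep k p).support → ∀ i, a i ∈ (p i).support
  | 0, _, _, _, i => i.elim0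
  | k + 1, p, a, h, i => by
    simp only [indep, PMF.mem_support_bind_iff, PMF.mem_support_map_iff] at h
    obtain ⟨b, hb, g, hg, rfl⟩ := h
    refine Fin.cases ?_ (fun j => ?_) i
    · simpa using hb
    · simpa using mem_support_indep hg j

theorem indep_apply (k : ℕ) (p : Fin k → PMF A) (a : Fin k → A) :
    indep k p a = ∏ i, p i (a i) := by
  classical
  have h := expect_indep_prod k p fun i b => if b = a i then 1 else 0
  have h1 : ∀ b : Fin k → A, (∏ i, if b i = a i then (1 : ℝ≥0∞) else 0) = if b = a then 1 else 0 := by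
    intro b
    by_cases hb : b = a
    · simp [hb]
    · rw [if_neg hb]
      obtain ⟨i, hi⟩ := Function.ne_iff.1 hb
      exact Finset.prod_eq_zero (Finset.mem_univ i) (if_neg hi)
  have h2 : ∀ {C : Type w} (q : PMF C) (c : C),
      expect q (fun b => if b = c then (1 : ℝ≥0∞) else 0) = q c := by
    intro C q c
    rw [expect, tsum_eq_single c]
    · simp
    · intro b hb; simp [hb]
  simp only [h1] at h
  simp only [h2 (p _)] at h
  rw [← h]
  refine (h2 _ a).symm.trans ?_
  congr 1
  funext b
  by_cases hb : b = a <;> simp [hb]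

/-- Independent draws with the same law are exchangeable. -/
theorem expect_indep_perm {k : ℕ} (p : PMF A) (σ : Equiv.Perm (Fin k)) (g : (Fin k → A) → ℝ≥0∞) :
    expect (indep k fun _ => p) (fun a => g (a ∘ σ)) = expect (indep k fun _ => p) g := by
  unfold expect
  rw [← (Equiv.arrowCongr σ (Equiv.refl A)).tsum_eq]
  refine tsum_congr fun a => ?_
  simp only [indep_apply, Equiv.arrowCongr_apply, Equiv.coe_refl, Function.comp_def, id,
    Equiv.symm_apply_apply]
  congr 1
  exact Equiv.prod_comp σ.symm fun i => p (a i)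

end indep

/-! ### LP-type problems -/

section LPType

variable {H : Type u} {T : Type v} [LinearOrder H] [LinearOrder T] {f : Finset H → T}

theorem exists_isOptimalBasis (hf : IsLPType f) (R : Finset H) : ∃ B, IsOptimalBasis f R B := by
  classical
  obtain ⟨B, hB, hmin⟩ := Finset.exists_min_image (R.powerset.filter fun B => f B = f R)
    Finset.card ⟨R, by simp⟩
  simp only [Finset.mem_filter, Finset.mem_powerset] at hB hmin
  refine ⟨B, hB.1, fun B' hB' => lt_of_le_of_ne (hf.monotone _ _ hB'.subset) fun he => ?_, hB.2⟩
  exact absurd (Finset.card_lt_card hB') (not_lt.2 (hmin B' ⟨hB'.subset.trans hB.1, he.trans hB.2⟩))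

theorem basisOf_spec (hf : IsLPType f) (R : Finset H) : IsOptimalBasis f R (basisOf f R) := by
  unfold basisOf
  rw [dif_pos (exists_isOptimalBasis hf R)]
  exact (exists_isOptimalBasis hf R).choose_spec

theorem IsBasis.card_le_dim [Fintype H] {B : Finset H} (hB : IsBasis f B) : B.card ≤ dim f := by
  classical
  unfold dim
  exact Finset.le_sup (f := Finset.card) (by simpa using hB)

/-- If `R` does not have the value of `R ∪ G`, then a single element of `G` violates `R`. -/
theorem exists_violator (hf : IsLPType f) {R G : Finset H} (h : f R < f (R ∪ G)) :
    ∃ g ∈ G, f R < f (insert g R) := by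
  by_contra! hno
  refine h.ne ?_
  clear h
  induction G using Finset.induction_on with
  | empty => simp
  | insert g G _ ih =>
    have h1 : f R = f (R ∪ G) := ih fun x hx => hno x (Finset.mem_insert_of_mem hx)
    refine le_antisymm (hf.monotone _ _ Finset.subset_union_left) ?_
    by_contra hlt
    rw [not_le, Finset.union_insert] at hlt
    exact absurd (hf.locality R (R ∪ G) g Finset.subset_union_left h1 (h1 ▸ hlt))
      (not_lt.2 (hno g (Finset.mem_insert_self _ _)))

/-- At most `dim f` elements of a set are indispensable for its value: they are contained in every
optimal basis. -/
theorem card_indispensable_le [Fintype H] (hf : IsLPType f) (S : Finset H) :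
    (S.filter fun h => f (S.erase h) < f S).card ≤ dim f := by
  obtain ⟨B, hBS, hB, hfB⟩ := exists_isOptimalBasis hf S
  refine (Finset.card_le_card fun h hh => ?_).trans hB.card_le_dim
  rw [Finset.mem_filter] at hh
  by_contra hhB
  have : B ⊆ S.erase h := fun b hb => Finset.mem_erase.2 ⟨fun e => hhB (e ▸ hb), hBS hb⟩
  exact absurd (hf.monotone _ _ this) (not_le.2 (hfB ▸ hh.2))

end LPType

/-! ### Single pull operations -/

section pull

variable {n : ℕ} [NeZero n] {H : Type u} [DecidableEq H]

theorem expect_pullFrom (store : Fin n → Multiset H) (g : Option (CopyOf n H) → ℝ≥0∞) :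
    expect (pullFrom store) g = (∑ v, if store v = 0 then g none else
      (∑ c ∈ (store v).toEnumFinset, g (some (v, c))) / Multiset.card (store v)) / n := by
  unfold pullFrom
  rw [expect_bind, expect_uniformOfFintype, Fintype.card_fin]
  congr 1
  refine Finset.sum_congr rfl fun v _ => ?_
  by_cases hv : (store v).toEnumFinset.Nonempty
  · have : store v ≠ 0 := by
      rintro h; simp [h] at hv
      obtain ⟨x, hx⟩ := hv
      simp [Multiset.mem_toEnumFinset] at hx
    rw [dif_pos hv, if_neg this, expect_map, expect_uniformOfFinset, Multiset.card_toEnumFinset]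
  · have : store v = 0 := by
      rw [← Multiset.card_eq_zero, ← Multiset.card_toEnumFinset, Finset.card_eq_zero]
      exact Finset.not_nonempty_iff_eq_empty.1 hv
    rw [dif_neg hv, if_pos this, expect_pure]

/-- No copy is returned with probability more than `1 / n`. -/
theorem pullFrom_le (store : Fin n → Multiset H) (c : CopyOf n H) :
    expect (pullFrom store) (fun o => if o = some c then 1 else 0) ≤ 1 / n := by
  rw [expect_pullFrom]
  refine ENNReal.div_le_div_right ?_ _
  rw [Finset.sum_eq_single c.1]
  · split_ifs with h1 h2
    · simp at h2
    · simp
    · have hc : (Multiset.card (store c.1) : ℝ≥0∞) ≠ 0 := by simpa using h1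
      rw [ENNReal.div_le_iff hc (by simp), one_mul, Finset.sum_boole]
      rw [← Multiset.card_toEnumFinset]
      exact_mod_cast Finset.card_le_card (Finset.filter_subset _ _)
  · intro v _ hv
    split_ifs with h1 h2
    · simp at h2
    · rfl
    · rw [Finset.sum_eq_zero, ENNReal.zero_div]
      intro x _
      rw [if_neg]
      rintro h
      rw [Option.some.injEq] at h
      exact hv (by rw [← h])
  · simp

theorem expect_pullFrom_isSome (store : Fin n → Multiset H) :
    expect (pullFrom store) (fun o => if o.isSome then 1 else 0) =
      ((Finset.univ.filter fun v => store v ≠ 0).card : ℝ≥0∞) / n := by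
  rw [expect_pullFrom, ← Finset.sum_boole]
  congr 1
  refine Finset.sum_congr rfl fun v _ => ?_
  by_cases h : store v = 0
  · simp [h]
  · have hc : (Multiset.card (store v) : ℝ≥0∞) ≠ 0 := by simpa using h
    simp only [h, if_false, ne_eq, not_false_eq_true, if_true, Option.isSome_some,
      Finset.sum_const, Multiset.card_toEnumFinset, nsmul_eq_mul, mul_one]
    exact ENNReal.div_self hc (by simp)

theorem sum_map_eq_sum_toEnumFinset (m : Multiset H) (φ : H → ℝ≥0∞) :
    (m.map φ).sum = ∑ c ∈ m.toEnumFinset, φ c.1 := by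
  conv_lhs => rw [← Multiset.map_toEnumFinset_fst m, Multiset.map_map]
  rfl

/-- If no store has more than `M` copies, every copy is returned with probability at least
`1 / (n M)`. -/
theorem sum_copies_le_expect_pullFrom (store : Fin n → Multiset H) {M : ℕ}
    (hM : ∀ v, Multiset.card (store v) ≤ M) (φ : H → ℝ≥0∞) :
    ∑ v, ((store v).map φ).sum ≤
      n * M * expect (pullFrom store) (fun o => o.elim 0 fun c => φ c.2.1) := by
  have hn : (n : ℝ≥0∞) ≠ 0 := by simpa using NeZero.ne n
  rw [expect_pullFrom, mul_comm (n : ℝ≥0∞), mul_assoc,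
    ENNReal.mul_div_cancel hn (ENNReal.natCast_ne_top n), Finset.mul_sum]
  refine Finset.sum_le_sum fun v _ => ?_
  rw [sum_map_eq_sum_toEnumFinset]
  split_ifs with h
  · simp [h]
  · have hc : (Multiset.card (store v) : ℝ≥0∞) ≠ 0 := by simpa using h
    rw [← mul_div_assoc, ENNReal.le_div_iff_mul_le (Or.inl hc) (Or.inl (by simp)), mul_comm]
    refine mul_le_mul_left ?_ _
    exact_mod_cast hM v

end pull

/-! ### The sampling procedure -/

/-- The distinct copies among the replies. -/
def distinct {n k : ℕ} {H : Type u} [DecidableEq H] (x : Fin k → Option (CopyOf n H)) :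
    Finset (CopyOf n H) := Finset.eraseNone (Finset.univ.image x)

section sampling

variable {n : ℕ} {H : Type u} {T : Type v} [LinearOrder H] [LinearOrder T]

theorem mem_distinct {k : ℕ} {x : Fin k → Option (CopyOf n H)} {c : CopyOf n H} :
    c ∈ distinct x ↔ ∃ i, x i = some c := by simp [distinct]

theorem card_distinct_le {k : ℕ} (x : Fin k → Option (CopyOf n H)) : (distinct x).card ≤ k := by
  have h1 : (Finset.insertNone (distinct x)).card = (distinct x).card + 1 := by simp
  have h2 : ((distinct x).map Function.Embedding.some).card ≤ (Finset.univ.image x).card := by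
    refine Finset.card_le_card fun o ho => ?_
    rw [Finset.mem_map] at ho
    obtain ⟨c, hc, rfl⟩ := ho
    obtain ⟨i, hi⟩ := mem_distinct.1 hc
    exact Finset.mem_image.2 ⟨i, Finset.mem_univ _, hi⟩
  rw [Finset.card_map] at h2
  exact h2.trans (Finset.card_image_le.trans (by simp))

/-- `h` violates `R`: it increases the value. -/
def Violates (f : Finset H → T) (R : Finset H) (h : H) : Prop := f R < f (insert h R)

instance (f : Finset H → T) (R : Finset H) (h : H) : Decidable (Violates f R h) :=
  inferInstanceAs (Decidable (f R < f (insert h R)))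

/-- The probability that `h` violates a uniformly random `r`-subset of the set `D` of copies; it is
`0 / 0 = 0` if there is no such subset. -/
def subsetViolProb (f : Finset H → T) (r : ℕ) (D : Finset (CopyOf n H)) (h : H) : ℝ≥0∞ :=
  ((D.powersetCard r).filter fun R => Violates f (R.image fun c => c.2.1) h).card /
    (D.powersetCard r).card

theorem subsetViolProb_le_one (f : Finset H → T) (r : ℕ) (D : Finset (CopyOf n H)) (h : H) :
    subsetViolProb f r D h ≤ 1 :=
  ENNReal.div_le_of_le_mul (by
    rw [one_mul]; exact_mod_cast Finset.card_le_card (Finset.filter_subset _ _))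

/-- Clarkson's sampling lemma for sets of copies: a uniformly random copy outside of a uniformly
random `r`-subset violates it with probability at most `dim f / (r + 1)`. -/
theorem sum_subsetViolProb_le [Fintype H] {f : Finset H → T} (hf : IsLPType f) (r : ℕ)
    (D : Finset (CopyOf n H)) :
    ∑ c ∈ D, subsetViolProb f r (D.erase c) c.2.1 ≤ dim f * D.card / (r + 1 : ℕ) := by
  classical
  rcases D.eq_empty_or_nonempty with rfl | hD
  · simp
  obtain ⟨k, hk⟩ : ∃ k, D.card = k + 1 := ⟨D.card - 1, by have := hD.card_pos; omega⟩
  have hcard : ∀ c ∈ D, ((D.erase c).powersetCard r).card = k.choose r := by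
    intro c hc
    rw [Finset.card_powersetCard, Finset.card_erase_of_mem hc, hk, Nat.add_sub_cancel]
  -- few elements of an `(r + 1)`-set of copies violate the rest of it
  have hone : ∀ Q : Finset (CopyOf n H), (Q.filter fun c =>
      Violates f ((Q.erase c).image fun c => c.2.1) c.2.1).card ≤ dim f := by
    intro Q
    refine le_trans ?_ (card_indispensable_le hf (Q.image fun c => c.2.1))
    have huniq : ∀ c ∈ Q, Violates f ((Q.erase c).image fun c => c.2.1) c.2.1 →
        ∀ c' ∈ Q, c'.2.1 = c.2.1 → c' = c := by
      intro c _ hv c' hc' he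
      by_contra hne
      refine absurd hv ?_
      unfold Violates
      rw [Finset.insert_eq_of_mem]
      · exact lt_irrefl _
      · exact Finset.mem_image.2 ⟨c', Finset.mem_erase.2 ⟨hne, hc'⟩, he⟩
    refine Finset.card_le_card_of_injOn (fun c => c.2.1) ?_ ?_
    · intro c hc
      rw [Finset.mem_coe, Finset.mem_filter] at hc
      rw [Finset.mem_coe, Finset.mem_filter]
      refine ⟨Finset.mem_image_of_mem _ hc.1, ?_⟩
      have h1 : (Q.image fun c => c.2.1).erase c.2.1 = (Q.erase c).image fun c => c.2.1 := by
        ext h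
        simp only [Finset.mem_erase, Finset.mem_image]
        constructor
        · rintro ⟨hne, c', hc', rfl⟩
          exact ⟨c', ⟨fun e => hne (by rw [e]), hc'⟩, rfl⟩
        · rintro ⟨c', ⟨hne, hc'⟩, rfl⟩
          exact ⟨fun e => hne (huniq c hc.1 hc.2 c' hc' e), c', hc', rfl⟩
      have h2 : insert c.2.1 ((Q.erase c).image fun c => c.2.1) = Q.image fun c => c.2.1 := by
        rw [← Finset.image_insert (fun c : CopyOf n H => c.2.1), Finset.insert_erase hc.1]
      have := hc.2
      unfold Violates at this
      rw [h2] at this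
      rwa [h1]
    · intro c hc c' hc' he
      rw [Finset.mem_coe, Finset.mem_filter] at hc hc'
      exact (huniq c hc.1 hc.2 c' hc'.1 he.symm).symm
  -- double counting of the pairs of an `(r + 1)`-set and an element that violates the rest
  have hcount : ∑ c ∈ D, (((D.erase c).powersetCard r).filter fun R =>
      Violates f (R.image fun c => c.2.1) c.2.1).card ≤ (k + 1).choose (r + 1) * dim f := by
    rw [← Finset.card_sigma, ← hk, ← Finset.card_powersetCard, ← smul_eq_mul]
    refine le_trans ?_ (Finset.sum_le_card_nsmul (D.powersetCard (r + 1)) _ (dim f)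
      fun Q _ => hone Q)
    rw [← Finset.card_sigma]
    refine Finset.card_le_card_of_injOn (fun x => ⟨insert x.1 x.2, x.1⟩) ?_ ?_
    · rintro ⟨c, R⟩ h
      simp only [Finset.coe_sigma, Set.mem_sigma_iff, Finset.mem_coe, Finset.mem_filter,
        Finset.mem_powersetCard] at h ⊢
      obtain ⟨hc, ⟨hRD, hRc⟩, hv⟩ := h
      have hcR : c ∉ R := fun h => absurd (hRD h) (Finset.notMem_erase c D)
      refine ⟨⟨Finset.insert_subset hc (hRD.trans (Finset.erase_subset _ _)), ?_⟩,
        Finset.mem_insert_self _ _, ?_⟩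
      · rw [Finset.card_insert_of_notMem hcR, hRc]
      · rwa [Finset.erase_insert hcR]
    · rintro ⟨c, R⟩ h ⟨c', R'⟩ h' he
      simp only [Finset.coe_sigma, Set.mem_sigma_iff, Finset.mem_coe, Finset.mem_filter,
        Finset.mem_powersetCard] at h h'
      have hcR : c ∉ R := fun hh => absurd (h.2.1.1 hh) (Finset.notMem_erase c D)
      have hcR' : c' ∉ R' := fun hh => absurd (h'.2.1.1 hh) (Finset.notMem_erase c' D)
      simp only [Sigma.mk.injEq, heq_eq_eq] at he
      obtain ⟨he1, rfl⟩ := he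
      rw [← Finset.erase_insert hcR, he1, Finset.erase_insert hcR']
  have hsum : ∑ c ∈ D, subsetViolProb f r (D.erase c) c.2.1 =
      ((∑ c ∈ D, (((D.erase c).powersetCard r).filter fun R =>
        Violates f (R.image fun c => c.2.1) c.2.1).card : ℕ) : ℝ≥0∞) / (k.choose r : ℕ) := by
    rw [Nat.cast_sum, ENNReal.div_eq_inv_mul, Finset.mul_sum]
    refine Finset.sum_congr rfl fun c hc => ?_
    rw [subsetViolProb, hcard c hc, ENNReal.div_eq_inv_mul]
  rw [hsum]
  rcases Nat.eq_zero_or_pos (k.choose r) with h0 | hpos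
  · have : ∑ c ∈ D, (((D.erase c).powersetCard r).filter fun R =>
        Violates f (R.image fun c => c.2.1) c.2.1).card = 0 := by
      refine Finset.sum_eq_zero fun c hc => ?_
      have := Finset.card_le_card (Finset.filter_subset (fun R : Finset (CopyOf n H) =>
        Violates f (R.image fun c => c.2.1) c.2.1) ((D.erase c).powersetCard r))
      rw [hcard c hc, h0] at this
      omega
    rw [this]; simp
  · refine ENNReal.div_le_of_le_mul ?_
    rw [ENNReal.div_eq_inv_mul, mul_assoc, ← ENNReal.div_eq_inv_mul,
      ENNReal.le_div_iff_mul_le (Or.inl (by simp)) (Or.inl (by simp)), hk]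
    have h2 := Nat.add_one_mul_choose_eq k r
    have h3 : (∑ c ∈ D, (((D.erase c).powersetCard r).filter fun R =>
        Violates f (R.image fun c => c.2.1) c.2.1).card) * (r + 1) ≤
        dim f * (k + 1) * k.choose r := by
      calc _ ≤ (k + 1).choose (r + 1) * dim f * (r + 1) := Nat.mul_le_mul_right _ hcount
        _ = dim f * ((k + 1).choose (r + 1) * (r + 1)) := by ring
        _ = _ := by rw [← h2]; ring
    exact_mod_cast h3

end sampling

section draws

variable {n : ℕ} [NeZero n] {H : Type u} {T : Type v} [LinearOrder H] [LinearOrder T]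

theorem distinct_comp_perm {k : ℕ} (x : Fin k → Option (CopyOf n H)) (σ : Equiv.Perm (Fin k)) :
    distinct (x ∘ σ) = distinct x := by
  ext c
  simp only [mem_distinct, Function.comp]
  exact ⟨fun ⟨i, hi⟩ => ⟨σ i, hi⟩, fun ⟨i, hi⟩ => ⟨σ.symm i, by simpa using hi⟩⟩

/-- The probability that a fresh draw is a copy that has been drawn before. -/
theorem expect_repeated_le (store : Fin n → Multiset H) (s : ℕ) :
    expect (indep s fun _ => pullFrom store) (fun x => expect (pullFrom store) fun o =>
      if ∃ c ∈ distinct x, o = some c then 1 else 0) ≤ s / n := by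
  refine expect_le_of_le fun x _ => ?_
  calc expect (pullFrom store) (fun o => if ∃ c ∈ distinct x, o = some c then 1 else 0)
      ≤ expect (pullFrom store) (fun o => ∑ c ∈ distinct x, if o = some c then 1 else 0) := by
        refine expect_mono fun o => ?_
        split_ifs with h
        · obtain ⟨c, hc, rfl⟩ := h
          refine le_trans ?_ (Finset.single_le_sum (fun _ _ => zero_le) hc)
          simp
        · exact zero_le
    _ ≤ ∑ c ∈ distinct x, 1 / (n : ℝ≥0∞) := by
        rw [expect_sum]
        exact Finset.sum_le_sum fun c _ => pullFrom_le store c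
    _ ≤ s / n := by
        rw [Finset.sum_const, nsmul_eq_mul, ← mul_div_assoc, mul_one]
        exact ENNReal.div_le_div_right (by exact_mod_cast card_distinct_le x) _

/-- The contribution of the `i`-th draw if it is not repeated: the probability that it violates a
random subset of the other draws. -/
def freshViolProb {k : ℕ} (f : Finset H → T) (r : ℕ) (y : Fin k → Option (CopyOf n H))
    (i : Fin k) : ℝ≥0∞ :=
  if ∀ j, j ≠ i → y j ≠ y i then
    (y i).elim 0 fun c => subsetViolProb f r ((distinct y).erase c) c.2.1
  else 0

theorem sum_freshViolProb_le [Fintype H] {f : Finset H → T} (hf : IsLPType f) (r : ℕ) {k : ℕ}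
    (y : Fin k → Option (CopyOf n H)) :
    ∑ i, freshViolProb f r y i ≤ dim f * k / (r + 1 : ℕ) := by
  set F : Option (CopyOf n H) → ℝ≥0∞ := fun o =>
    o.elim 0 fun c => subsetViolProb f r ((distinct y).erase c) c.2.1 with hF
  set U := Finset.univ.filter fun i : Fin k => ∀ j, j ≠ i → y j ≠ y i with hU
  have h1 : ∑ i, freshViolProb f r y i = ∑ i ∈ U, F (y i) := by
    rw [hU, Finset.sum_filter]
    rfl
  have h2 : ∑ i ∈ U, F (y i) = ∑ o ∈ U.image y, F o := by
    rw [Finset.sum_image]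
    intro i hi j hj hij
    by_contra hne
    rw [hU, Finset.mem_coe, Finset.mem_filter] at hi
    exact hi.2 j (fun h => hne h.symm) hij.symm
  have h3 : U.image y ⊆ Finset.insertNone (distinct y) := by
    intro o ho
    obtain ⟨i, _, rfl⟩ := Finset.mem_image.1 ho
    rw [Finset.mem_insertNone]
    intro c hc
    exact mem_distinct.2 ⟨i, hc⟩
  rw [h1, h2]
  refine (Finset.sum_le_sum_of_subset h3).trans ?_
  rw [Finset.sum_insertNone]
  simp only [hF, Option.elim_none, Option.elim_some, zero_add]
  refine (sum_subsetViolProb_le hf r (distinct y)).trans (ENNReal.div_le_div_right ?_ _)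
  exact mul_le_mul_right (by exact_mod_cast card_distinct_le y) _

/-- The sampling lemma for draws that need not be uniform: the next draw violates a random subset of
`s` independent draws with probability at most `dim f / (r + 1)`, up to the probability that it
repeats one of them. The `s + 1` draws are exchangeable. -/
theorem expect_subsetViolProb_le [Fintype H] {f : Finset H → T} (hf : IsLPType f) (r s : ℕ)
    (store : Fin n → Multiset H) :
    expect (pullFrom store) (fun o => o.elim 0 fun c =>
      expect (indep s fun _ => pullFrom store) fun x => subsetViolProb f r (distinct x) c.2.1) ≤
      dim f / (r + 1 : ℕ) + s / n := by
  have hswap : expect (pullFrom store) (fun o => o.elim 0 fun c =>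
      expect (indep s fun _ => pullFrom store) fun x => subsetViolProb f r (distinct x) c.2.1) =
      expect (pullFrom store) fun o => expect (indep s fun _ => pullFrom store) fun x =>
        o.elim 0 fun c => subsetViolProb f r (distinct x) c.2.1 := by
    refine expect_congr_support fun o _ => ?_
    cases o <;> simp [expect_const]
  have hpt : ∀ (o : Option (CopyOf n H)) (x : Fin s → Option (CopyOf n H)),
      (o.elim 0 fun c => subsetViolProb f r (distinct x) c.2.1) ≤
      freshViolProb f r (Fin.cons o x : Fin (s + 1) → Option (CopyOf n H)) 0 +
        if ∃ c ∈ distinct x, o = some c then 1 else 0 := by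
    intro o x
    rcases o with _ | c
    · simp
    simp only [Option.elim_some, Option.some.injEq]
    by_cases hc : c ∈ distinct x
    · rw [if_pos ⟨c, hc, rfl⟩]
      exact (subsetViolProb_le_one _ _ _ _).trans le_add_self
    · refine le_trans (le_of_eq ?_) le_self_add
      unfold freshViolProb
      rw [if_pos]
      · simp only [Fin.cons_zero, Option.elim_some]
        congr 1
        ext c'
        simp only [Finset.mem_erase, mem_distinct, Fin.exists_fin_succ, Fin.cons_zero,
          Fin.cons_succ, Option.some.injEq]
        constructor
        · rintro ⟨i, hi⟩
          exact ⟨fun e => hc (e ▸ mem_distinct.2 ⟨i, hi⟩), Or.inr ⟨i, hi⟩⟩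
        · rintro ⟨hne, rfl | hi⟩
          · exact absurd rfl hne
          · exact hi
      · intro j hj
        obtain ⟨i, rfl⟩ := Fin.exists_succ_eq.2 hj
        simp only [Fin.cons_succ, Fin.cons_zero]
        exact fun h => hc (mem_distinct.2 ⟨i, h⟩)
  have hfresh : expect (indep (s + 1) fun _ => pullFrom store) (fun y => freshViolProb f r y 0) ≤
      dim f / (r + 1 : ℕ) := by
    have hperm : ∀ i : Fin (s + 1),
        expect (indep (s + 1) fun _ => pullFrom store) (fun y => freshViolProb f r y i) =
        expect (indep (s + 1) fun _ => pullFrom store) (fun y => freshViolProb f r y 0) := by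
      intro i
      rw [← expect_indep_perm _ (Equiv.swap 0 i) fun y => freshViolProb f r y 0]
      congr 1
      funext y
      unfold freshViolProb
      rw [distinct_comp_perm]
      have : (∀ j, j ≠ (0 : Fin (s + 1)) → (y ∘ Equiv.swap 0 i) j ≠ (y ∘ Equiv.swap 0 i) 0) ↔
          ∀ j, j ≠ i → y j ≠ y i := by
        simp only [Function.comp, Equiv.swap_apply_left]
        constructor
        · intro h j hj
          have := h (Equiv.swap 0 i j) (fun e => hj (by
            rw [← Equiv.swap_apply_self 0 i j, e, Equiv.swap_apply_left]))
          rwa [Equiv.swap_apply_self] at this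
        · intro h j hj
          refine h _ fun e => hj ?_
          rw [← Equiv.swap_apply_self 0 i j, e, Equiv.swap_apply_right]
      simp only [this]
      simp only [Function.comp, Equiv.swap_apply_left]
    have hsum : ((s + 1 : ℕ) : ℝ≥0∞) *
        expect (indep (s + 1) fun _ => pullFrom store) (fun y => freshViolProb f r y 0) ≤
        dim f * (s + 1 : ℕ) / (r + 1 : ℕ) := by
      calc _ = ∑ i : Fin (s + 1),
            expect (indep (s + 1) fun _ => pullFrom store) (fun y => freshViolProb f r y i) := by
            simp only [hperm, Finset.sum_const, Finset.card_univ, Fintype.card_fin, nsmul_eq_mul]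
        _ ≤ _ := by
            rw [← expect_sum]
            exact expect_le_of_le fun y _ => sum_freshViolProb_le hf r y
    have h0 : ((s + 1 : ℕ) : ℝ≥0∞) ≠ 0 := by simp
    rw [mul_comm, ← ENNReal.le_div_iff_mul_le (Or.inl h0) (Or.inl (by simp))] at hsum
    refine hsum.trans (le_of_eq ?_)
    rw [div_eq_mul_inv, div_eq_mul_inv, div_eq_mul_inv, mul_right_comm, mul_assoc _ _
      (((s + 1 : ℕ) : ℝ≥0∞)⁻¹), ENNReal.mul_inv_cancel h0 (by simp), mul_one]
  rw [hswap]
  refine (expect_mono fun o => expect_mono fun x => hpt o x).trans ?_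
  simp only [expect_add]
  refine add_le_add ?_ ?_
  · refine le_trans (le_of_eq ?_) hfresh
    simp only [indep, expect_bind, expect_map]
  · rw [expect_comm]
    exact expect_repeated_le store s

/-- If every `s` previously drawn copies leave probability at least `β` for a new one, then many
distinct copies are drawn. -/
theorem expect_two_inv_pow_distinct_le (store : Fin n → Multiset H) {s : ℕ} {β ρ : ℝ≥0∞}
    (hβ : ∀ D : Finset (CopyOf n H), D.card ≤ s → β ≤ expect (pullFrom store) fun o =>
      if ∃ c, o = some c ∧ c ∉ D then 1 else 0) (hρ : ρ + 2⁻¹ * β = 1) (k : ℕ) :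
    ∀ D : Finset (CopyOf n H), D.card + k ≤ s →
    expect (indep k fun _ => pullFrom store) (fun x => 2⁻¹ ^ (D ∪ distinct x).card) ≤
      ρ ^ k * 2⁻¹ ^ D.card := by
  induction k with
  | zero =>
    intro D _
    have : distinct (Fin.elim0 : Fin 0 → Option (CopyOf n H)) = ∅ := by
      ext c; simp [mem_distinct]
    simp [indep, expect_pure, this]
  | succ k ih =>
    intro D hD
    simp only [indep, expect_bind, expect_map]
    have hcons : ∀ (o : Option (CopyOf n H)) (x : Fin k → Option (CopyOf n H)),
        D ∪ distinct (Fin.cons o x : Fin (k + 1) → _) =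
          (D ∪ Finset.eraseNone {o}) ∪ distinct x := by
      intro o x
      ext c
      simp only [Finset.mem_union, mem_distinct, Fin.exists_fin_succ, Fin.cons_zero, Fin.cons_succ,
        Finset.mem_eraseNone, Finset.mem_singleton, or_assoc, eq_comm]
    simp only [hcons]
    have hcard : ∀ o : Option (CopyOf n H), (D ∪ Finset.eraseNone {o}).card =
        D.card + if ∃ c, o = some c ∧ c ∉ D then 1 else 0 := by
      intro o
      rcases o with _ | c
      · simp
      · have : Finset.eraseNone {some c} = {c} := by
          ext; simp
        rw [this]
        by_cases hc : c ∈ D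
        · simp [hc]
        · rw [if_pos ⟨c, rfl, hc⟩, Finset.card_union_of_disjoint (by simpa using hc)]
          simp
    have hle : expect (pullFrom store) (fun o => expect (indep k fun _ => pullFrom store)
        fun x => 2⁻¹ ^ ((D ∪ Finset.eraseNone {o}) ∪ distinct x).card) ≤
        ρ ^ k * expect (pullFrom store) fun o => 2⁻¹ ^ (D ∪ Finset.eraseNone {o}).card := by
      rw [← expect_const_mul]
      refine expect_mono fun o => ih _ ?_
      rw [hcard]
      split_ifs <;> omega
    refine hle.trans ?_
    rw [pow_succ, mul_assoc]
    refine mul_le_mul_right ?_ _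
    have hhalf : (2⁻¹ : ℝ≥0∞) + 2⁻¹ = 1 := ENNReal.inv_two_add_inv_two
    have heq : expect (pullFrom store) (fun o => 2⁻¹ ^ (D ∪ Finset.eraseNone {o}).card) +
        2⁻¹ ^ D.card * (2⁻¹ * expect (pullFrom store) fun o =>
          if ∃ c, o = some c ∧ c ∉ D then 1 else 0) = 2⁻¹ ^ D.card := by
      rw [← expect_const_mul, ← expect_const_mul, ← expect_add]
      conv_rhs => rw [← expect_const (pullFrom store) (2⁻¹ ^ D.card)]
      refine expect_congr_support fun o _ => ?_
      rw [hcard]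
      split_ifs
      · rw [pow_add, pow_one, mul_one, ← mul_add, hhalf, mul_one]
      · simp
    have hfin : (2⁻¹ : ℝ≥0∞) ^ D.card * (2⁻¹ * β) ≠ ∞ := by
      have hβ1 : 2⁻¹ * β ≤ 1 := hρ ▸ le_add_self
      exact ENNReal.mul_ne_top (ENNReal.pow_ne_top (by simp)) (ne_top_of_le_ne_top (by simp) hβ1)
    refine (ENNReal.add_le_add_iff_right hfin).1 ?_
    calc _ ≤ expect (pullFrom store) (fun o => 2⁻¹ ^ (D ∪ Finset.eraseNone {o}).card) +
        2⁻¹ ^ D.card * (2⁻¹ * expect (pullFrom store) fun o =>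
          if ∃ c, o = some c ∧ c ∉ D then 1 else 0) := by
          refine add_le_add_right (mul_le_mul_right (mul_le_mul_right (hβ D (by omega)) _) _) _
      _ = 2⁻¹ ^ D.card := heq
      _ = _ := by rw [mul_comm ρ, ← mul_add, hρ, mul_one]

end draws

section sample

variable {n : ℕ} [NeZero n] {H : Type u} {T : Type v} [LinearOrder H] [LinearOrder T]

theorem expect_sample (P : Params) (store : Fin n → Multiset H) (g : Option (Finset H) → ℝ≥0∞) :
    expect (sample P store) (fun q => g q.2) =
      expect (indep (P.cs * (6 * P.d ^ 2 + P.L)) fun _ => pullFrom store) fun x =>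
        if 6 * P.d ^ 2 ≤ (distinct x).card then
          (∑ R ∈ (distinct x).powersetCard (6 * P.d ^ 2), g (some (R.image fun c => c.2.1))) /
            ((distinct x).powersetCard (6 * P.d ^ 2)).card
        else g none := by
  unfold sample
  rw [expect_bind]
  refine expect_congr_support fun x _ => ?_
  change expect (dite _ _ _) _ = _
  by_cases hD : ((distinct x).powersetCard (6 * P.d ^ 2)).Nonempty
  · rw [if_pos (Finset.powersetCard_nonempty.1 hD)]
    unfold distinct at hD
    rw [dif_pos hD, expect_map, expect_uniformOfFinset]
    rfl
  · rw [if_neg (fun h => hD (Finset.powersetCard_nonempty.2 h))]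
    unfold distinct at hD
    rw [dif_neg hD, expect_pure]

/-- The probability that `h` violates the sample of a node. -/
def violProb (f : Finset H → T) (P : Params) (store : Fin n → Multiset H) (h : H) : ℝ≥0∞ :=
  expect (sample P store) fun q => q.2.elim 0 fun R => if Violates f R h then 1 else 0

theorem violProb_eq (f : Finset H → T) (P : Params) (store : Fin n → Multiset H) (h : H) :
    violProb f P store h = expect (indep (P.cs * (6 * P.d ^ 2 + P.L)) fun _ => pullFrom store)
      fun x => subsetViolProb f (6 * P.d ^ 2) (distinct x) h := by
  unfold violProb
  rw [expect_sample P store fun o => o.elim 0 fun R => if Violates f R h then 1 else 0]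
  refine expect_congr_support fun x _ => ?_
  unfold subsetViolProb
  split_ifs with hD
  · simp only [Option.elim_some, Finset.sum_boole]
  · rw [Finset.powersetCard_eq_empty.2 (not_le.1 hD)]
    simp

/-- The expected number of copies that violate a sample, in terms of the maximum load `M`. -/
theorem sum_violProb_le [Fintype H] {f : Finset H → T} (hf : IsLPType f) (P : Params)
    (store : Fin n → Multiset H) {M : ℕ} (hM : ∀ v, Multiset.card (store v) ≤ M) :
    ∑ v, ((store v).map (violProb f P store)).sum ≤ n * M * (dim f / (6 * P.d ^ 2 + 1 : ℕ) +
      (P.cs * (6 * P.d ^ 2 + P.L) : ℕ) / n) := by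
  refine (sum_copies_le_expect_pullFrom store hM _).trans (mul_le_mul_right ?_ _)
  simp only [violProb_eq]
  exact expect_subsetViolProb_le hf _ _ store

/-- The probability that a sample is optimal. -/
def optProb [Fintype H] (f : Finset H → T) (P : Params) (store : Fin n → Multiset H) : ℝ≥0∞ :=
  expect (sample P store) fun q =>
    q.2.elim 0 fun R => if f R = f Finset.univ then 1 else 0

/-- A successful sample is optimal or violated by an element of a given optimal basis. -/
theorem one_le_fail_add_optProb_add [Fintype H] {f : Finset H → T} (hf : IsLPType f) (P : Params)
    (store : Fin n → Multiset H) {B : Finset H} (hB : f B = f Finset.univ) :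
    1 ≤ expect (sample P store) (fun q => if q.2 = none then 1 else 0) + optProb f P store +
      ∑ h ∈ B, violProb f P store h := by
  unfold optProb violProb
  rw [← expect_sum, ← expect_add, ← expect_add]
  conv_lhs => rw [← expect_const (sample P store) 1]
  refine expect_mono fun q => ?_
  rcases q.2 with _ | R
  · simp
  simp only [Option.elim_some]
  by_cases h : f R = f Finset.univ
  · simp [h]
  · have hlt : f R < f (R ∪ B) := lt_of_lt_of_le
      (lt_of_le_of_ne (hf.monotone _ _ (Finset.subset_univ _)) h)
      (hB ▸ hf.monotone _ _ Finset.subset_union_right)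
    obtain ⟨g, hg, hv⟩ := exists_violator hf hlt
    refine le_trans ?_ le_add_self
    refine le_trans ?_ (Finset.single_le_sum (fun _ _ => zero_le) hg)
    rw [if_pos (show Violates f R g from hv)]

/-- If many stores are nonempty, a sample rarely fails. -/
theorem expect_sample_eq_none_le (P : Params) (store : Fin n → Multiset H) {β ρ : ℝ≥0∞}
    (hβ : β * n + (P.cs * (6 * P.d ^ 2 + P.L) : ℕ) ≤
      (Finset.univ.filter fun v => store v ≠ 0).card) (hρ : ρ + 2⁻¹ * β = 1) :
    expect (sample P store) (fun q => if q.2 = none then 1 else 0) ≤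
      2 ^ (6 * P.d ^ 2) * ρ ^ (P.cs * (6 * P.d ^ 2 + P.L)) := by
  set s := P.cs * (6 * P.d ^ 2 + P.L) with hs
  have hn : (n : ℝ≥0∞) ≠ 0 := by simpa using NeZero.ne n
  have hn' : (n : ℝ≥0∞) ≠ ∞ := ENNReal.natCast_ne_top n
  have hnew : ∀ D : Finset (CopyOf n H), D.card ≤ s → β ≤ expect (pullFrom store) fun o =>
      if ∃ c, o = some c ∧ c ∉ D then 1 else 0 := by
    intro D hD
    have h1 : expect (pullFrom store) (fun o => if o.isSome then 1 else 0) ≤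
        expect (pullFrom store) (fun o => if ∃ c, o = some c ∧ c ∉ D then 1 else 0) + s / n := by
      have h2 : (s : ℝ≥0∞) / n ≥ ∑ c ∈ D, expect (pullFrom store)
          fun o => if o = some c then 1 else 0 := by
        refine (Finset.sum_le_sum fun c _ => pullFrom_le store c).trans ?_
        rw [Finset.sum_const, nsmul_eq_mul, ← mul_div_assoc, mul_one]
        exact ENNReal.div_le_div_right (by exact_mod_cast hD) _
      refine le_trans ?_ (add_le_add_right h2 _)
      rw [← expect_sum, ← expect_add]
      refine expect_mono fun o => ?_
      rcases o with _ | c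
      · simp
      · by_cases hc : c ∈ D
        · refine le_trans ?_ le_add_self
          refine le_trans ?_ (Finset.single_le_sum (fun _ _ => zero_le) hc)
          simp
        · refine le_trans ?_ le_self_add
          have h3 : ∃ c', some c = some c' ∧ c' ∉ D := ⟨c, rfl, hc⟩
          rw [if_pos h3]
          simp
    rw [expect_pullFrom_isSome] at h1
    have h3 : β + s / n ≤ expect (pullFrom store) (fun o =>
        if ∃ c, o = some c ∧ c ∉ D then 1 else 0) + s / n := by
      refine le_trans ?_ h1
      rw [ENNReal.le_div_iff_mul_le (Or.inl hn) (Or.inl hn'), add_mul,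
        ENNReal.div_mul_cancel hn hn']
      exact hβ
    exact (ENNReal.add_le_add_iff_right
      (ENNReal.div_ne_top (ENNReal.natCast_ne_top s) hn)).1 h3
  have hmain := expect_two_inv_pow_distinct_le store hnew hρ s ∅ (by simp)
  simp only [Finset.empty_union, Finset.card_empty, pow_zero, mul_one] at hmain
  rw [expect_sample P store fun o => if o = none then 1 else 0, ← hs]
  refine le_trans ?_ (mul_le_mul_right hmain _)
  rw [← expect_const_mul]
  refine expect_mono fun x => ?_
  by_cases hD : 6 * P.d ^ 2 ≤ (distinct x).card
  · simp [hD]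
  · rw [if_neg hD]
    rw [not_le] at hD
    rw [← ENNReal.inv_pow, ← div_eq_mul_inv,
      ENNReal.le_div_iff_mul_le (Or.inl (by simp)) (Or.inl (by simp))]
    simp only [if_true, one_mul]
    exact pow_le_pow_right₀ (by norm_num) hD.le

theorem mem_toEnumFinset_of_mem_support_pullFrom {store : Fin n → Multiset H} {c : CopyOf n H}
    (h : some c ∈ (pullFrom store).support) : c.2 ∈ (store c.1).toEnumFinset := by
  unfold pullFrom at h
  rw [PMF.mem_support_bind_iff] at h
  obtain ⟨v, _, hv⟩ := h
  split_ifs at hv with h1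
  · rw [PMF.mem_support_map_iff] at hv
    obtain ⟨a, ha, hac⟩ := hv
    rw [Option.some.injEq] at hac
    subst hac
    simpa using ha
  · simp at hv

theorem mem_support_indep_of_mem_support_sample {P : Params} {store : Fin n → Multiset H}
    {q : (Fin (P.cs * (6 * P.d ^ 2 + P.L)) → Option (CopyOf n H)) × Option (Finset H)}
    (h : q ∈ (sample P store).support) :
    ∀ i, q.1 i ∈ (pullFrom store).support := by
  unfold sample at h
  rw [PMF.mem_support_bind_iff] at h
  obtain ⟨x, hx, hq⟩ := h
  have : q.1 = x := by
    dsimp only at hq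
    split_ifs at hq with h1
    · rw [PMF.mem_support_map_iff] at hq
      obtain ⟨a, _, rfl⟩ := hq
      rfl
    · rw [PMF.mem_support_pure_iff] at hq
      rw [hq]
  rw [this]
  exact mem_support_indep hx

end sample

/-! ### Push operations -/

section scatter

variable {n : ℕ} [NeZero n] {H : Type u}

/-- The generating function of the numbers of messages with a property `Q` that the nodes
receive. -/
theorem expect_scatter_prod (Q : Msg H → Prop) [DecidablePred Q] (wt : Fin n → ℝ≥0∞) :
    ∀ l : List (Msg H), expect (scatter l) (fun inbox => ∏ v, wt v ^ (inbox v).countP Q) =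
      ((∑ v, wt v) / n) ^ (l : Multiset (Msg H)).countP Q
  | [] => by simp [scatter, expect_pure]
  | m :: l => by
    have hn : (n : ℝ≥0∞) ≠ 0 := by simpa using NeZero.ne n
    unfold scatter
    simp only [expect_bind, expect_map, expect_uniformOfFintype, Fintype.card_fin]
    rw [← Multiset.cons_coe]
    by_cases hm : Q m
    · rw [Multiset.countP_cons_of_pos _ hm, pow_succ, ← expect_scatter_prod Q wt l,
        ← expect_mul_const]
      refine expect_congr_support fun inbox _ => ?_
      rw [← mul_div_assoc, Finset.mul_sum]
      congr 1
      refine Finset.sum_congr rfl fun u _ => ?_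
      rw [← Finset.mul_prod_erase _ _ (Finset.mem_univ u),
        ← Finset.mul_prod_erase Finset.univ (fun v => wt v ^ (inbox v).countP Q)
          (Finset.mem_univ u), Function.update_self, Multiset.countP_cons_of_pos _ hm, pow_succ]
      rw [mul_right_comm]
      congr 2
      refine Finset.prod_congr rfl fun v hv => ?_
      rw [Function.update_of_ne (Finset.ne_of_mem_erase hv)]
    · rw [Multiset.countP_cons_of_neg _ hm, ← expect_scatter_prod Q wt l]
      refine expect_congr_support fun inbox _ => ?_
      have : ∀ u : Fin n, ∏ v, wt v ^ (Function.update inbox u (m ::ₘ inbox u) v).countP Q =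
          ∏ v, wt v ^ (inbox v).countP Q := by
        intro u
        refine Finset.prod_congr rfl fun v _ => ?_
        by_cases hv : v = u
        · subst hv
          rw [Function.update_self, Multiset.countP_cons_of_neg _ hm]
        · rw [Function.update_of_ne hv]
      simp only [this, Finset.sum_const, Finset.card_univ, Fintype.card_fin, nsmul_eq_mul]
      rw [mul_comm, ENNReal.mul_div_cancel_right hn (ENNReal.natCast_ne_top n)]

theorem expect_scatter_pow (Q : Msg H → Prop) [DecidablePred Q] (v : Fin n) (b : ℝ≥0∞)
    (l : List (Msg H)) : expect (scatter l) (fun inbox => b ^ (inbox v).countP Q) =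
      (((n - 1 : ℕ) + b) / n) ^ (l : Multiset (Msg H)).countP Q := by
  have h := expect_scatter_prod Q (fun u => if u = v then b else 1) l
  have h1 : ∀ inbox : Fin n → Multiset (Msg H),
      ∏ u, (if u = v then b else 1) ^ (inbox u).countP Q = b ^ (inbox v).countP Q := by
    intro inbox
    rw [Finset.prod_eq_single v]
    · simp
    · intro u _ hu; simp [hu]
    · simp
  have h2 : ∑ u : Fin n, (if u = v then b else 1) = (n - 1 : ℕ) + b := by
    rw [← Finset.add_sum_erase _ _ (Finset.mem_univ v), if_pos rfl, Finset.sum_congr rfl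
      (fun u hu => if_neg (Finset.ne_of_mem_erase hu)), Finset.sum_const,
      Finset.card_erase_of_mem (Finset.mem_univ v), Finset.card_univ, Fintype.card_fin,
      nsmul_eq_mul, mul_one, add_comm]
  simp only [h1, h2] at h
  exact h

/-- Every message is received by exactly one node. -/
theorem sum_of_mem_support_scatter : ∀ {l : List (Msg H)} {inbox : Fin n → Multiset (Msg H)},
    inbox ∈ (scatter l).support → ∑ v, inbox v = l
  | [], inbox, h => by
    simp only [scatter, PMF.mem_support_pure_iff] at h
    simp [h]
  | m :: l, inbox, h => by
    simp only [scatter, PMF.mem_support_bind_iff, PMF.mem_support_map_iff] at h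
    obtain ⟨ib, hib, u, _, rfl⟩ := h
    rw [← Multiset.cons_coe, ← sum_of_mem_support_scatter hib,
      ← Finset.add_sum_erase _ _ (Finset.mem_univ u),
      ← Finset.add_sum_erase Finset.univ ib (Finset.mem_univ u), Function.update_self,
      Multiset.cons_add]
    congr 2
    refine Finset.sum_congr rfl fun v hv => ?_
    rw [Function.update_of_ne (Finset.ne_of_mem_erase hv)]

end scatter

/-! ### Thinning and the binomial distribution -/

/-- The expectation of `g` under the binomial distribution with `m` trials of probability `κ`. -/
def binom (κ : ℝ≥0∞) : ℕ → (ℕ → ℝ≥0∞) → ℝ≥0∞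
  | 0, g => g 0
  | m + 1, g => κ * binom κ m (fun s => g (s + 1)) + (1 - κ) * binom κ m g

section binom

variable {κ : ℝ≥0∞}

theorem binom_mono {g g' : ℕ → ℝ≥0∞} (h : ∀ s, g s ≤ g' s) : ∀ m, binom κ m g ≤ binom κ m g' := by
  intro m
  induction m generalizing g g' with
  | zero => exact h 0
  | succ m ih =>
    exact add_le_add (mul_le_mul_right (ih fun s => h (s + 1)) _) (mul_le_mul_right (ih h) _)

theorem binom_const (hκ : κ ≤ 1) (c : ℝ≥0∞) (m : ℕ) : binom κ m (fun _ => c) = c := by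
  induction m with
  | zero => rfl
  | succ m ih => rw [binom, ih, ← add_mul, add_tsub_cancel_of_le hκ, one_mul]

theorem binom_add_fun (g g' : ℕ → ℝ≥0∞) (m : ℕ) :
    binom κ m (fun s => g s + g' s) = binom κ m g + binom κ m g' := by
  induction m generalizing g g' with
  | zero => rfl
  | succ m ih => simp only [binom, ih]; ring

theorem binom_add (m k : ℕ) (g : ℕ → ℝ≥0∞) :
    binom κ (m + k) g = binom κ m fun s => binom κ k fun r => g (s + r) := by
  induction m generalizing g with
  | zero => simp [binom]
  | succ m ih =>
    rw [Nat.add_right_comm, binom, binom, ih, ih]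
    simp only [Nat.add_right_comm]

/-- Size biasing: `E[S g(S)] = κ (m + 1) E[g(S' + 1)]` for binomial `S`, `S'` with `m + 1` and `m`
trials. -/
theorem binom_size_bias (m : ℕ) : ∀ g : ℕ → ℝ≥0∞,
    binom κ (m + 1) (fun s => s * g s) = κ * (m + 1) * binom κ m fun s => g (s + 1) := by
  induction m with
  | zero => intro g; simp [binom]
  | succ m ih =>
    intro g
    have h1 : binom κ (m + 1) (fun s => ((s + 1 : ℕ) : ℝ≥0∞) * g (s + 1)) =
        binom κ (m + 1) (fun s => s * g (s + 1)) + binom κ (m + 1) fun s => g (s + 1) := by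
      rw [← binom_add_fun]
      congr 1
      funext s
      push_cast
      ring
    have h2 : binom κ (m + 1) (fun s => g (s + 1)) =
      κ * binom κ m (fun s => g (s + 1 + 1)) + (1 - κ) * binom κ m fun s => g (s + 1) := rfl
    calc binom κ (m + 1 + 1) (fun s => s * g s)
        = κ * binom κ (m + 1) (fun s => ((s + 1 : ℕ) : ℝ≥0∞) * g (s + 1)) +
          (1 - κ) * binom κ (m + 1) (fun s => s * g s) := rfl
      _ = κ * binom κ (m + 1) (fun s => g (s + 1)) + κ * (m + 1) *
          (κ * binom κ m (fun s => g (s + 1 + 1)) + (1 - κ) * binom κ m fun s => g (s + 1)) := by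
          rw [h1, ih fun s => g (s + 1), ih g]; ring
      _ = _ := by rw [← h2]; push_cast; ring

/-- For a binomial `S` with `m` trials, `E[1 / (o + S)] ≤ 1 / (κ (o + m))` if `o ≥ 1`. -/
theorem binom_inv_le (hκ : κ ≤ 1) (hκ0 : κ ≠ 0) (o m : ℕ) (ho : 1 ≤ o) :
    binom κ m (fun s => ((o + s : ℕ) : ℝ≥0∞)⁻¹) ≤ (κ * (o + m : ℕ))⁻¹ := by
  induction o, ho using Nat.le_induction generalizing m with
  | base =>
    have h1 : κ * (m + 1) * binom κ m (fun s => ((s + 1 : ℕ) : ℝ≥0∞)⁻¹) ≤ 1 := by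
      rw [← binom_size_bias m fun s => ((s : ℕ) : ℝ≥0∞)⁻¹]
      refine (binom_mono (fun s => ENNReal.mul_inv_le_one _) _).trans ?_
      rw [binom_const hκ]
    have h2 : κ * ((m : ℝ≥0∞) + 1) ≠ 0 := mul_ne_zero hκ0 (by simp)
    have h3 : κ * ((m : ℝ≥0∞) + 1) ≠ ∞ :=
      ENNReal.mul_ne_top (ne_top_of_le_ne_top (by simp) hκ) (by finiteness)
    have h4 : (fun s : ℕ => ((1 + s : ℕ) : ℝ≥0∞)⁻¹) = fun s => ((s + 1 : ℕ) : ℝ≥0∞)⁻¹ := by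
      funext s; rw [add_comm]
    rw [h4, add_comm 1 m, ENNReal.le_inv_iff_mul_le, mul_comm]
    push_cast at h1 ⊢
    exact h1
  | succ o ho ih =>
    have h1 := ih (m + 1)
    rw [show o + 1 + m = o + (m + 1) by ring]
    refine le_trans ?_ h1
    have h4 : (fun s : ℕ => ((o + 1 + s : ℕ) : ℝ≥0∞)⁻¹) =
        fun s => ((o + (s + 1) : ℕ) : ℝ≥0∞)⁻¹ := by
      funext s; rw [show o + 1 + s = o + (s + 1) by ring]
    rw [h4, binom]
    have h5 : binom κ m (fun s => ((o + (s + 1) : ℕ) : ℝ≥0∞)⁻¹) ≤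
        binom κ m (fun s => ((o + s : ℕ) : ℝ≥0∞)⁻¹) := by
      refine binom_mono (fun s => ENNReal.inv_le_inv.2 ?_) m
      exact_mod_cast (by omega : o + s ≤ o + (s + 1))
    calc _ = (κ + (1 - κ)) * binom κ m (fun s => ((o + (s + 1) : ℕ) : ℝ≥0∞)⁻¹) := by
          rw [add_tsub_cancel_of_le hκ, one_mul]
      _ ≤ _ := by
          rw [add_mul]
          exact add_le_add_right (mul_le_mul_right h5 _) _

/-- A sum of independent binomial numbers is binomial. -/
theorem expect_indep_binom {A : Type w} (φ : A → ℕ) : ∀ (k : ℕ) (p : Fin k → PMF A)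
    (m : Fin k → ℕ) (_ : ∀ i g, expect (p i) (fun a => g (φ a)) = binom κ (m i) g) (g : ℕ → ℝ≥0∞),
    expect (indep k p) (fun a => g (∑ i, φ (a i))) = binom κ (∑ i, m i) g
  | 0, p, m, _, g => by simp [indep, expect_pure, binom]
  | k + 1, p, m, h, g => by
    simp only [indep, expect_bind, expect_map, Fin.sum_univ_succ, Fin.cons_zero, Fin.cons_succ]
    rw [binom_add, ← h 0]
    refine expect_congr_support fun a _ => ?_
    exact expect_indep_binom φ k (fun i => p i.succ) (fun i => m i.succ)
      (fun i g => h i.succ g) fun r => g (φ a + r)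

end binom

section thin

variable {H : Type u}

set_option linter.deprecated false in
theorem expect_bernoulli (d : ℕ) (g : Bool → ℝ≥0∞) :
    expect (PMF.bernoulli (keepProb d) (keepProb_le_one d)) g =
      keepProb d * g true + (1 - keepProb d) * g false := by
  rw [expect, tsum_fintype]
  simp [PMF.bernoulli_apply]

theorem expect_thin_cons (d : ℕ) (h : H) (l : List H) (g : Multiset H → ℝ≥0∞) :
    expect (thin d (h :: l)) g = keepProb d * expect (thin d l) (fun s => g (h ::ₘ s)) +
      (1 - keepProb d) * expect (thin d l) g := by
  simp only [thin, expect_bind, expect_map, expect_bernoulli, if_true]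
  rw [expect_add, expect_const_mul, expect_const_mul]
  simp

theorem expect_thin_count [DecidableEq H] (d : ℕ) (h : H) (l : List H) : ∀ g : ℕ → ℝ≥0∞,
    expect (thin d l) (fun s => g (s.count h)) = binom (keepProb d) ((l : Multiset H).count h) g := by
  induction l with
  | nil => intro g; simp [thin, expect_pure, binom]
  | cons a l ih =>
    intro g
    rw [expect_thin_cons, ← Multiset.cons_coe]
    by_cases ha : h = a
    · subst ha
      simp only [Multiset.count_cons_self]
      rw [binom, ih fun s => g (s + 1), ih]
    · simp only [Multiset.count_cons_of_ne ha]
      rw [ih, ← add_mul, add_tsub_cancel_of_le (by exact_mod_cast keepProb_le_one d), one_mul]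

theorem expect_thin_pow_card (d : ℕ) (b : ℝ≥0∞) (l : List H) :
    expect (thin d l) (fun s => b ^ Multiset.card s) =
      (keepProb d * b + (1 - keepProb d)) ^ l.length := by
  induction l with
  | nil => simp [thin, expect_pure]
  | cons a l ih =>
    rw [expect_thin_cons]
    simp only [Multiset.card_cons, pow_succ, expect_mul_const, ih, List.length_cons]
    ring

theorem le_of_mem_support_thin {d : ℕ} {l : List H} : ∀ {s : Multiset H},
    s ∈ (thin d l).support → s ≤ l := by
  induction l with
  | nil => intro s h; simp [thin] at h; simp [h]
  | cons a l ih =>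
    intro s h
    simp only [thin, PMF.mem_support_bind_iff, PMF.mem_support_map_iff] at h
    obtain ⟨s', hs', keep, _, rfl⟩ := h
    rw [← Multiset.cons_coe]
    cases keep
    · exact (ih hs').trans (Multiset.le_cons_self _ _)
    · exact Multiset.cons_le_cons a (ih hs')

end thin

/-! ### The active half of an iteration -/

/-- The elements of the messages `h` in a multiset of messages. -/
def elems {H : Type u} (m : Multiset (Msg H)) : Multiset H := m.filterMap Msg.elem?

/-- The elements of the messages `(h, 0)` in a multiset of messages. -/
def origs {H : Type u} (m : Multiset (Msg H)) : Multiset H := m.filterMap Msg.orig?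

/-- The triples in a multiset of messages. -/
def triples {H : Type u} (m : Multiset (Msg H)) : Multiset (Entry H) := m.filterMap Msg.entry?

section messages

variable {H : Type u}

theorem card_filterMap_eq_countP {A B : Type*} (φ : A → Option B) (m : Multiset A) :
    Multiset.card (m.filterMap φ) = m.countP fun x => (φ x).isSome := by
  induction m using Multiset.induction_on with
  | empty => rfl
  | cons a m ih =>
    rcases h : φ a with _ | b
    · rw [Multiset.filterMap_cons_none _ _ h, Multiset.countP_cons_of_neg _ (by simp [h]), ih]
    · rw [Multiset.filterMap_cons_some _ _ _ h, Multiset.countP_cons_of_pos _ (by simp [h]),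
        Multiset.card_cons, ih]

theorem count_filterMap_eq_countP {A B : Type*} [DecidableEq B] (φ : A → Option B) (b : B)
    (m : Multiset A) : (m.filterMap φ).count b = m.countP fun x => φ x = some b := by
  induction m using Multiset.induction_on with
  | empty => rfl
  | cons a m ih =>
    rcases h : φ a with _ | b'
    · rw [Multiset.filterMap_cons_none _ _ h, Multiset.countP_cons_of_neg _ (by simp [h]), ih]
    · rw [Multiset.filterMap_cons_some _ _ _ h]
      by_cases hb : b = b'
      · rw [Multiset.countP_cons_of_pos _ (by simp [h, hb]), hb, Multiset.count_cons_self, ← hb, ih]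
      · rw [Multiset.countP_cons_of_neg _ (by simp [h, Ne.symm hb]), Multiset.count_cons_of_ne hb,
          ih]

theorem elems_mk (W O : Multiset H) (E : Multiset (Entry H)) :
    elems (W.map Msg.elem + O.map Msg.orig + E.map Msg.entry) = W := by
  have : ∀ (A : Type u) (m : Multiset A), m.filterMap (fun _ => (none : Option H)) = 0 := by
    intro A m
    exact Multiset.eq_zero_of_forall_notMem (by simp [Multiset.mem_filterMap])
  simp [elems, Multiset.filterMap_add, Multiset.filterMap_map, Function.comp_def, Msg.elem?, this]

theorem origs_mk (W O : Multiset H) (E : Multiset (Entry H)) :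
    origs (W.map Msg.elem + O.map Msg.orig + E.map Msg.entry) = O := by
  have : ∀ (A : Type u) (m : Multiset A), m.filterMap (fun _ => (none : Option H)) = 0 := by
    intro A m
    exact Multiset.eq_zero_of_forall_notMem (by simp [Multiset.mem_filterMap])
  simp [origs, Multiset.filterMap_add, Multiset.filterMap_map, Function.comp_def, Msg.orig?, this]

theorem triples_mk (W O : Multiset H) (E : Multiset (Entry H)) :
    triples (W.map Msg.elem + O.map Msg.orig + E.map Msg.entry) = E := by
  have : ∀ (A : Type u) (m : Multiset A), m.filterMap (fun _ => (none : Option (Entry H))) = 0 := by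
    intro A m
    exact Multiset.eq_zero_of_forall_notMem (by simp [Multiset.mem_filterMap])
  simp [triples, Multiset.filterMap_add, Multiset.filterMap_map, Function.comp_def, Msg.entry?,
    this]

end messages

section act

variable {n : ℕ} [NeZero n] {H : Type u} {T : Type v} [Fintype H] [LinearOrder H] [LinearOrder T]

/-- What a node in the pull phase does after a reply. -/
def pullAction (σ : NodeState H) (reply : Option (CopyOf n H)) : Action H :=
  match reply with
  | none => ⟨σ, σ.entries.val.map Msg.entry, 1, replyBits reply⟩
  | some c => ⟨{ σ with pulling := false }, Msg.orig c.2.1 ::ₘ σ.entries.val.map Msg.entry, 1,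
      replyBits reply⟩

/-- What a node outside of the pull phase does after the sampling procedure. -/
def sampleAction (f : Finset H → T) (P : Params) (t : ℕ) (σ : NodeState H)
    (q : (Fin (P.cs * (6 * P.d ^ 2 + P.L)) → Option (CopyOf n H)) × Option (Finset H)) :
    Action H :=
  let E : Multiset (Msg H) := σ.entries.val.map Msg.entry
  let pulls := P.cs * (6 * P.d ^ 2 + P.L)
  let bits := Finset.univ.sup fun i => replyBits (q.1 i)
  match q.2 with
  | none => ⟨σ, E, pulls, bits⟩
  | some R =>
    let W := σ.known.filter fun h => f R < f (insert h R)
    if W = 0 then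
      let e : Entry H := ⟨t, basisOf f R, true⟩
      ⟨{ σ with entries := insert e σ.entries }, Msg.entry e ::ₘ E, pulls, bits⟩
    else ⟨σ, W.map Msg.elem + E, pulls, bits⟩

/-- The copies that a node with knowledge `K` pushes after sampling `o`. -/
def pushedElems (f : Finset H → T) (K : Multiset H) (o : Option (Finset H)) : Multiset H :=
  o.elim 0 fun R => K.filter (Violates f R)

variable {f : Finset H → T} {P : Params} {t : ℕ} {x : Fin n → NodeState H} {σ : NodeState H}

theorem act_of_pulling (hx : ∀ v, (x v).output = none) (hσ : σ.output = none)
    (hp : σ.pulling = true) :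
    act f P t x σ = (pullFrom fun w => (x w).orig).map (pullAction σ) := by
  have hs : (fun w => (x w).answering (x w).orig) = fun w => (x w).orig := by
    funext w
    simp [NodeState.answering, hx]
  unfold act
  rw [if_neg (by simp [hσ])]
  dsimp only
  rw [if_pos hp, hs]
  congr 1

theorem act_of_not_pulling (hx : ∀ v, (x v).output = none) (hσ : σ.output = none)
    (hp : σ.pulling = false) :
    act f P t x σ = (sample P fun w => (x w).known).map (sampleAction f P t σ) := by
  have hs : (fun w => (x w).answering (x w).known) = fun w => (x w).known := by
    funext w
    simp [NodeState.answering, hx]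
  unfold act
  rw [if_neg (by simp [hσ])]
  dsimp only
  rw [if_neg (by simp [hp]), hs]
  congr 1

theorem elems_pullAction (σ : NodeState H) (o : Option (CopyOf n H)) :
    elems (pullAction σ o).pushes = 0 := by
  rcases o with _ | c
  · simpa [pullAction] using elems_mk 0 0 σ.entries.val
  · simpa [pullAction] using elems_mk 0 {c.2.1} σ.entries.val

theorem elems_sampleAction (f : Finset H → T) (P : Params) (t : ℕ) (σ : NodeState H)
    (q : (Fin (P.cs * (6 * P.d ^ 2 + P.L)) → Option (CopyOf n H)) × Option (Finset H)) :
    elems (sampleAction f P t σ q).pushes = pushedElems f σ.known q.2 := by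
  rcases q with ⟨x, _ | R⟩
  · simpa [sampleAction, pushedElems] using elems_mk 0 0 σ.entries.val
  · simp only [sampleAction, pushedElems, Option.elim_some]
    have he : (σ.known.filter (Violates f R)) = σ.known.filter fun h => f R < f (insert h R) := by
      congr
    rw [he]
    split_ifs with hW
    · rw [hW]
      simpa using elems_mk 0 0 ((⟨t, basisOf f R, true⟩ : Entry H) ::ₘ σ.entries.val)
    · simpa using elems_mk (σ.known.filter fun h => f R < f (insert h R)) 0 σ.entries.val

theorem expect_act_elems (hx : ∀ v, (x v).output = none) (hσ : σ.output = none)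
    (hp : σ.pulling = false) (g : Multiset H → ℝ≥0∞) :
    expect (act f P t x σ) (fun a => g (elems a.pushes)) =
      expect (sample P fun w => (x w).known) fun q => g (pushedElems f σ.known q.2) := by
  rw [act_of_not_pulling hx hσ hp, expect_map]
  simp only [elems_sampleAction]

/-- The expected number of copies of `h` that a node outside of the pull phase pushes. -/
theorem expect_act_count_elems (hx : ∀ v, (x v).output = none) (hσ : σ.output = none)
    (hp : σ.pulling = false) (h : H) :
    expect (act f P t x σ) (fun a => ((elems a.pushes).count h : ℝ≥0∞)) =
      σ.known.count h * violProb f P (fun w => (x w).known) h := by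
  rw [expect_act_elems hx hσ hp fun m => (m.count h : ℝ≥0∞), violProb, ← expect_const_mul]
  refine expect_congr_support fun q _ => ?_
  rcases q.2 with _ | R
  · simp [pushedElems]
  · simp only [pushedElems, Option.elim_some]
    by_cases hv : Violates f R h
    · rw [Multiset.count_filter_of_pos hv, if_pos hv, mul_one]
    · rw [Multiset.count_filter_of_neg hv, if_neg hv]; simp

/-- The expected number of copies that a node pushes. -/
theorem expect_act_card_elems_le (hx : ∀ v, (x v).output = none) (hσ : σ.output = none) :
    expect (act f P t x σ) (fun a => (Multiset.card (elems a.pushes) : ℝ≥0∞)) ≤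
      (σ.known.map (violProb f P fun w => (x w).known)).sum := by
  cases hp : σ.pulling
  · rw [expect_act_elems hx hσ hp fun m => (Multiset.card m : ℝ≥0∞)]
    have hcard : ∀ (K : Multiset H) (o : Option (Finset H)),
        (Multiset.card (pushedElems f K o) : ℝ≥0∞) =
          (K.map fun h => o.elim 0 fun R => if Violates f R h then (1 : ℝ≥0∞) else 0).sum := by
      intro K o
      rcases o with _ | R
      · simp [pushedElems]
      · simp only [pushedElems, Option.elim_some]
        induction K using Multiset.induction_on with
        | empty => simp
        | cons h K ih =>
          rw [Multiset.map_cons, Multiset.sum_cons, ← ih]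
          by_cases hv : Violates f R h
          · rw [Multiset.filter_cons_of_pos _ hv, if_pos hv, Multiset.card_cons]
            push_cast; ring
          · rw [Multiset.filter_cons_of_neg _ hv, if_neg hv, zero_add]
    simp only [hcard]
    refine le_of_eq ?_
    induction σ.known using Multiset.induction_on with
    | empty => simp [expect_const]
    | cons h K ih =>
      simp only [Multiset.map_cons, Multiset.sum_cons, expect_add]
      rw [ih]
      rfl
  · rw [act_of_pulling hx hσ hp, expect_map]
    simp [elems_pullAction, expect_const]

/-- A node that samples an optimal set creates an optimal triple. -/
theorem expect_act_no_optimal_add_optProb_le (hf : IsLPType f) (hx : ∀ v, (x v).output = none)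
    (hσ : σ.output = none) (hp : σ.pulling = false) :
    expect (act f P t x σ) (fun a => if ∃ e ∈ a.state.entries, e.iter = t ∧
      f e.basis = f Finset.univ then 0 else 1) + optProb f P (fun w => (x w).known) ≤ 1 := by
  rw [act_of_not_pulling hx hσ hp, expect_map, optProb, ← expect_add]
  refine expect_le_of_le fun q _ => ?_
  rcases q with ⟨y, _ | R⟩
  · simp only [Option.elim_none, add_zero]
    split_ifs <;> simp
  · simp only [Option.elim_some]
    by_cases hR : f R = f Finset.univ
    · rw [if_pos hR, if_pos, zero_add]
      have hW : σ.known.filter (fun h => f R < f (insert h R)) = 0 := by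
        rw [Multiset.filter_eq_nil]
        intro h _
        rw [hR, not_lt]
        exact hf.monotone _ _ (Finset.subset_univ _)
      simp only [sampleAction, hW, if_true]
      exact ⟨_, Finset.mem_insert_self _ _, rfl, (basisOf_spec hf R).2.2.trans hR⟩
    · rw [if_neg hR, add_zero]
      split_ifs <;> simp

/-- A node leaves the pull phase if it asks a node with an element. -/
theorem expect_act_pulling (hx : ∀ v, (x v).output = none) (hσ : σ.output = none)
    (hp : σ.pulling = true) :
    expect (act f P t x σ) (fun a => if a.state.pulling = true then 1 else 0) +
      ((Finset.univ.filter fun v => (x v).orig ≠ 0).card : ℝ≥0∞) / n = 1 := by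
  rw [act_of_pulling hx hσ hp, expect_map, ← expect_pullFrom_isSome, ← expect_add]
  conv_rhs => rw [← expect_const (pullFrom fun w => (x w).orig) 1]
  refine expect_congr_support fun o _ => ?_
  rcases o with _ | c
  · simp [pullAction, hp]
  · simp [pullAction]

theorem card_origs_pullAction (σ : NodeState H) (o : Option (CopyOf n H)) :
    Multiset.card (origs (pullAction σ o).pushes) = if o.isSome then 1 else 0 := by
  rcases o with _ | c
  · have := origs_mk 0 0 σ.entries.val
    simp only [Multiset.map_zero, zero_add] at this
    simp [pullAction, this]
  · have := origs_mk 0 {c.2.1} σ.entries.val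
    simp only [Multiset.map_zero, zero_add, Multiset.map_singleton, Multiset.singleton_add] at this
    simp [pullAction, this]

/-- The generating function of the number of messages `(h, 0)` of a node in the pull phase. -/
theorem expect_act_pow_card_origs (hx : ∀ v, (x v).output = none) (hσ : σ.output = none)
    (hp : σ.pulling = true) {q q' : ℝ≥0∞} (hqq : q + q' = 1)
    (hq : q = ((Finset.univ.filter fun v => (x v).orig ≠ 0).card : ℝ≥0∞) / n) (b : ℝ≥0∞) :
    expect (act f P t x σ) (fun a => b ^ Multiset.card (origs a.pushes)) = q * b + q' := by
  rw [act_of_pulling hx hσ hp, expect_map]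
  simp only [card_origs_pullAction]
  have h1 := expect_pullFrom_isSome fun w => (x w).orig
  rw [← hq] at h1
  have h2 : expect (pullFrom fun w => (x w).orig) (fun o => if o.isSome then 0 else 1) + q =
      q' + q := by
    rw [← h1, ← expect_add, h1, add_comm q', hqq]
    conv_rhs => rw [← expect_const (pullFrom fun w => (x w).orig) 1]
    refine expect_congr_support fun o _ => ?_
    rcases o with _ | c <;> simp
  have hfin : q ≠ ∞ := ne_top_of_le_ne_top (by simp) (hqq ▸ le_self_add : q ≤ 1)
  have h3 := (ENNReal.add_left_inj hfin).1 h2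
  rw [← h3, ← h1, ← expect_mul_const, ← expect_add]
  refine expect_congr_support fun o _ => ?_
  rcases o with _ | c <;> simp

/-- What is certain about the action of a node that has not stopped, in a configuration where no
node holds more than `M` copies. -/
structure ActionSpec (f : Finset H → T) (P : Params) (t n M : ℕ) (σ : NodeState H)
    (a : Action H) : Prop where
  orig : a.state.orig = σ.orig
  copies : a.state.copies = σ.copies
  output : a.state.output = none
  entries : a.state.entries = σ.entries ∨
    ∃ R, a.state.entries = insert ⟨t, basisOf f R, true⟩ σ.entries
  triples : triples a.pushes = a.state.entries.val
  origs : Multiset.card (origs a.pushes) + (if a.state.pulling then 1 else 0) =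
    if σ.pulling then 1 else 0
  elems : elems a.pushes ≤ σ.known
  card : Multiset.card a.pushes ≤ Multiset.card σ.known + σ.entries.card + 1
  pulls : a.pulls ≤ P.cs * (6 * P.d ^ 2 + P.L) + 1
  bits : a.replyBits ≤ 1 + Nat.clog 2 n + Nat.clog 2 (Fintype.card H) + Nat.size M

theorem replyBits_le {M : ℕ} {o : Option (CopyOf n H)} (h : ∀ c, o = some c → c.2.2 ≤ M) :
    replyBits o ≤ 1 + Nat.clog 2 n + Nat.clog 2 (Fintype.card H) + Nat.size M := by
  rcases o with _ | c
  · simp only [replyBits]; omega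
  · have := Nat.size_le_size (h c rfl)
    simp only [replyBits]; omega

theorem actionSpec {M : ℕ} (hx : ∀ v, (x v).output = none) (hσ : σ.output = none)
    (hM : ∀ v, Multiset.card (x v).known ≤ M) (hfresh : ∀ e ∈ σ.entries, e.iter < t)
    {a : Action H} (ha : a ∈ (act f P t x σ).support) : ActionSpec f P t n M σ a := by
  have hcount : ∀ {store : Fin n → Multiset H} {c : CopyOf n H},
      (∀ v, Multiset.card (store v) ≤ M) → some c ∈ (pullFrom store).support → c.2.2 ≤ M := by
    intro store c hs hc
    have h1 := mem_toEnumFinset_of_mem_support_pullFrom hc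
    rw [Multiset.mem_toEnumFinset] at h1
    exact h1.le.trans ((Multiset.count_le_card _ _).trans (hs _))
  cases hp : σ.pulling
  · rw [act_of_not_pulling hx hσ hp, PMF.mem_support_map_iff] at ha
    obtain ⟨q, hq, rfl⟩ := ha
    have hbits : (Finset.univ.sup fun i => replyBits (q.1 i)) ≤
        1 + Nat.clog 2 n + Nat.clog 2 (Fintype.card H) + Nat.size M := by
      refine Finset.sup_le fun i _ => replyBits_le fun c hc => ?_
      have := mem_support_indep_of_mem_support_sample hq i
      rw [hc] at this
      exact hcount hM this
    have hel := elems_sampleAction f P t σ q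
    rcases q with ⟨y, _ | R⟩
    · refine ⟨rfl, rfl, hσ, Or.inl rfl, ?_, ?_, ?_, ?_, Nat.le_succ _, hbits⟩
      · simpa [sampleAction] using triples_mk 0 0 σ.entries.val
      · have := origs_mk 0 0 σ.entries.val
        simp only [Multiset.map_zero, zero_add] at this
        simp [sampleAction, this, hp]
      · rw [hel]; simp [pushedElems]
      · simp only [sampleAction, Multiset.card_map, Finset.card_val]; omega
    · have hle : elems (sampleAction f P t σ (y, some R)).pushes ≤ σ.known := by
        rw [hel]; exact Multiset.filter_le _ _
      have hW := Multiset.card_le_card (Multiset.filter_le (fun h => f R < f (insert h R)) σ.known)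
      have hnot : (⟨t, basisOf f R, true⟩ : Entry H) ∉ σ.entries :=
        fun h => lt_irrefl _ (hfresh _ h)
      simp only [sampleAction] at hle ⊢
      by_cases h0 : σ.known.filter (fun h => f R < f (insert h R)) = 0
      · simp only [h0, if_true] at hle ⊢
        refine ⟨rfl, rfl, hσ, Or.inr ⟨R, rfl⟩, ?_, ?_, hle, ?_, Nat.le_succ _, hbits⟩
        · have := triples_mk 0 0 ((⟨t, basisOf f R, true⟩ : Entry H) ::ₘ σ.entries.val)
          simp only [Multiset.map_zero, zero_add, Multiset.map_cons] at this
          rw [this, Finset.insert_val_of_notMem hnot]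
        · have := origs_mk 0 0 ((⟨t, basisOf f R, true⟩ : Entry H) ::ₘ σ.entries.val)
          simp only [Multiset.map_zero, zero_add, Multiset.map_cons] at this
          simp [this, hp]
        · simp only [Multiset.card_cons, Multiset.card_map, Finset.card_val]; omega
      · simp only [h0, if_false] at hle ⊢
        refine ⟨rfl, rfl, hσ, Or.inl rfl, ?_, ?_, hle, ?_, Nat.le_succ _, hbits⟩
        · simpa using triples_mk (σ.known.filter fun h => f R < f (insert h R)) 0 σ.entries.val
        · have := origs_mk (σ.known.filter fun h => f R < f (insert h R)) 0 σ.entries.val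
          simp only [Multiset.map_zero, add_zero] at this
          simp [this, hp]
        · simp only [Multiset.card_add, Multiset.card_map, Finset.card_val]; omega
  · rw [act_of_pulling hx hσ hp, PMF.mem_support_map_iff] at ha
    obtain ⟨o, ho, rfl⟩ := ha
    have hbits : replyBits o ≤ 1 + Nat.clog 2 n + Nat.clog 2 (Fintype.card H) + Nat.size M := by
      refine replyBits_le fun c hc => ?_
      rw [hc] at ho
      refine hcount (fun v => le_trans ?_ (hM v)) ho
      exact Multiset.card_le_card (Multiset.le_add_right _ _)
    have hel := elems_pullAction σ o
    have hor := card_origs_pullAction σ o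
    rcases o with _ | c
    · refine ⟨rfl, rfl, hσ, Or.inl rfl, ?_, ?_, ?_, ?_, Nat.le_add_left _ _, hbits⟩
      · simpa [pullAction] using triples_mk 0 0 σ.entries.val
      · rw [hor]; simp [pullAction, hp]
      · rw [hel]; exact Multiset.zero_le _
      · simp only [pullAction, Multiset.card_map, Finset.card_val]; omega
    · refine ⟨rfl, rfl, hσ, Or.inl rfl, ?_, ?_, ?_, ?_, Nat.le_add_left _ _, hbits⟩
      · simpa [pullAction] using triples_mk 0 {c.2.1} σ.entries.val
      · rw [hor]; simp [pullAction, hp]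
      · rw [hel]; exact Multiset.zero_le _
      · simp only [pullAction, Multiset.card_cons, Multiset.card_map, Finset.card_val]; omega

end act

/-! ### The passive half of an iteration and the termination detection -/

section entries

variable {H : Type u} {T : Type v} [LinearOrder H] [LinearOrder T] {f : Finset H → T}

/-- The part of the preference order of the triples that ignores `x`. -/
def basisKey (f : Finset H → T) (e : Entry H) : T ×ₗ Colex (Finset H) :=
  toLex (f e.basis, toColex e.basis)

theorem basisKey_injective {e e' : Entry H} (h : basisKey f e = basisKey f e') :
    e.basis = e'.basis := by
  have := congrArg (fun k => (ofLex k).2) h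
  simpa [basisKey] using this

theorem basisKey_le_of_key_le {e e' : Entry H} (h : e.key f ≤ e'.key f) :
    basisKey f e ≤ basisKey f e' := by
  unfold Entry.key at h
  unfold basisKey
  rw [Prod.Lex.toLex_le_toLex] at h ⊢
  rcases h with h | ⟨h1, h2⟩
  · exact Or.inl h
  · refine Or.inr ⟨h1, ?_⟩
    rw [Prod.Lex.toLex_le_toLex] at h2
    rcases h2 with h2 | ⟨h2, _⟩
    · exact h2.le
    · exact h2.le

theorem value_le_of_basisKey_le {e e' : Entry H} (h : basisKey f e ≤ basisKey f e') :
    f e.basis ≤ f e'.basis := by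
  unfold basisKey at h
  rw [Prod.Lex.toLex_le_toLex] at h
  rcases h with h | ⟨h1, _⟩
  · exact h.le
  · exact h1.le

theorem valid_eq_false_of_key_le {e e' : Entry H} (h : e.key f ≤ e'.key f)
    (hb : e.basis = e'.basis) (hv : e.valid = false) : e'.valid = false := by
  unfold Entry.key at h
  rw [hb, Prod.Lex.toLex_le_toLex] at h
  rcases h with h | ⟨_, h⟩
  · exact absurd h (lt_irrefl _)
  · rw [Prod.Lex.toLex_le_toLex] at h
    rcases h with h | ⟨_, h⟩
    · exact absurd h (lt_irrefl _)
    · rw [hv] at h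
      cases h' : e'.valid
      · rfl
      · rw [h'] at h
        exact absurd h (by simp)

theorem key_injective {e e' : Entry H} (h : e.key f = e'.key f) (hi : e.iter = e'.iter) :
    e = e' := by
  have h1 := basisKey_injective (le_antisymm (basisKey_le_of_key_le h.le)
    (basisKey_le_of_key_le h.ge))
  rcases e with ⟨i, B, v⟩
  rcases e' with ⟨i', B', v'⟩
  simp only at h1 hi
  subst h1 hi
  unfold Entry.key at h
  simpa using h

theorem eq_of_mem_mergeEntries {S : Finset (Entry H)} {e e' : Entry H}
    (he : e ∈ mergeEntries f S) (he' : e' ∈ mergeEntries f S) (hi : e.iter = e'.iter) :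
    e = e' := by
  unfold mergeEntries at he he'
  rw [Finset.mem_filter] at he he'
  exact key_injective (le_antisymm (he'.2 e he.1 hi) (he.2 e' he'.1 hi.symm)) hi

theorem exists_mem_mergeEntries {S : Finset (Entry H)} {e : Entry H} (he : e ∈ S) :
    ∃ e' ∈ mergeEntries f S, e'.iter = e.iter ∧ e.key f ≤ e'.key f := by
  obtain ⟨m, hm, hmax⟩ := Finset.exists_max_image (S.filter fun e' => e'.iter = e.iter)
    (fun e' => e'.key f) ⟨e, by simp [he]⟩
  simp only [Finset.mem_filter] at hm hmax
  refine ⟨m, ?_, hm.2, hmax e ⟨he, rfl⟩⟩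
  unfold mergeEntries
  rw [Finset.mem_filter]
  exact ⟨hm.1, fun e' he' hi => hmax e' ⟨he', hi.trans hm.2⟩⟩

/-- The triples of a node after the termination detection, in terms of those it had or
received. -/
theorem mem_terminate_entries {P : Params} {t : ℕ} {rec : Finset (Entry H)} {σ : NodeState H}
    {e : Entry H} : e ∈ (terminate f P t rec σ).entries ↔
      (∃ e' ∈ mergeEntries f (σ.entries ∪ rec), e'.check f σ.known.toFinset = e) ∧
        t ≤ e.iter + P.ct * P.L := by
  unfold terminate
  simp only [Finset.mem_filter, Finset.mem_image, not_lt]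

theorem terminate_output_eq_some {P : Params} {t : ℕ} {rec : Finset (Entry H)} {σ : NodeState H}
    {B : Finset H} (h : (terminate f P t rec σ).output = some B) :
    ∃ e ∈ mergeEntries f (σ.entries ∪ rec), e.iter + P.ct * P.L < t ∧
      (e.check f σ.known.toFinset).valid = true ∧ e.basis = B := by
  unfold terminate at h
  dsimp only at h
  split_ifs at h with h1
  rw [Option.some.injEq] at h
  obtain ⟨hm, hi, hv⟩ := h1.choose_spec
  obtain ⟨e, he, hc⟩ := Finset.mem_image.1 hm
  rw [← hc] at hi hv
  refine ⟨e, he, hi, hv, ?_⟩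
  rw [← h, ← hc]
  rfl

theorem terminate_output_isSome {P : Params} {t : ℕ} {rec : Finset (Entry H)} {σ : NodeState H}
    {e : Entry H} (he : e ∈ mergeEntries f (σ.entries ∪ rec)) (hi : e.iter + P.ct * P.L < t)
    (hv : (e.check f σ.known.toFinset).valid = true) :
    ∃ B, (terminate f P t rec σ).output = some B := by
  have h1 : ∃ e ∈ (mergeEntries f (σ.entries ∪ rec)).image (Entry.check f σ.known.toFinset),
      e.iter + P.ct * P.L < t ∧ e.valid = true := ⟨_, Finset.mem_image_of_mem _ he, hi, hv⟩
  refine ⟨h1.choose.basis, ?_⟩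
  unfold terminate
  dsimp only
  rw [dif_pos h1]

theorem check_valid {K : Finset H} {e : Entry H} :
    (e.check f K).valid = true ↔ e.valid = true ∧ ¬ f e.basis < f (e.basis ∪ K) := by
  simp [Entry.check]

end entries

/-! ### Certain facts about an iteration -/

section step

variable {n : ℕ} [NeZero n] {H : Type u} {T : Type v} [Fintype H] [LinearOrder H] [LinearOrder T]
  {f : Finset H → T} {P : Params} {t M : ℕ} {x x' : Fin n → NodeState H} {a : Fin n → Action H}
  {inbox : Fin n → Multiset (Msg H)}

/-- What is certain about an iteration from the configuration `x` to the configuration `x'`, in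
which the nodes take the actions `a` and receive the messages `inbox`. -/
structure StepData (f : Finset H → T) (P : Params) (t M : ℕ) (x : Fin n → NodeState H)
    (a : Fin n → Action H) (inbox : Fin n → Multiset (Msg H)) (x' : Fin n → NodeState H) :
    Prop where
  act : ∀ v, ActionSpec f P t n M (x v) (a v)
  sum : ∑ v, inbox v = ∑ v, (a v).pushes
  receive : ∀ v, ∃ cp ≤ (a v).state.copies + elems (inbox v), x' v =
    terminate f P (t + 1) (triples (inbox v)).toFinset
      { (a v).state with orig := (a v).state.orig + origs (inbox v), copies := cp }

theorem receive_of_output_eq_none {σ : NodeState H} (hσ : σ.output = none)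
    (m : Multiset (Msg H)) :
    receive f P t σ m = (thin P.d (σ.copies + elems m).toList).map fun copies =>
      terminate f P (t + 1) (triples m).toFinset
        { σ with orig := σ.orig + origs m, copies := copies } := by
  unfold receive
  rw [if_neg (by simp [hσ])]
  rfl

theorem stepData (hx : ∀ v, (x v).output = none) (hM : ∀ v, Multiset.card (x v).known ≤ M)
    (hfresh : ∀ v, ∀ e ∈ (x v).entries, e.iter < t)
    (ha : a ∈ (indep n fun v => LowLoad.act f P t x (x v)).support)
    (hi : inbox ∈ (scatter (∑ v, (a v).pushes).toList).support)
    (hc : x' ∈ (indep n fun v => LowLoad.receive f P t (a v).state (inbox v)).support) :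
    StepData f P t M x a inbox x' := by
  have hact : ∀ v, ActionSpec f P t n M (x v) (a v) := fun v =>
    actionSpec hx (hx v) hM (hfresh v) (mem_support_indep ha v)
  refine ⟨hact, ?_, fun v => ?_⟩
  · rw [sum_of_mem_support_scatter hi, Multiset.coe_toList]
  · have h := mem_support_indep hc v
    rw [receive_of_output_eq_none (hact v).output, PMF.mem_support_map_iff] at h
    obtain ⟨cp, hcp, he⟩ := h
    have := le_of_mem_support_thin hcp
    rw [Multiset.coe_toList] at this
    exact ⟨cp, this, he.symm⟩

theorem expect_step (e : Execution n H) (Φ : (Fin n → NodeState H) → ℝ≥0∞) :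
    expect (step f P t e) (fun e' => Φ e'.config) =
      expect (indep n fun v => act f P t e.config (e.config v)) fun a =>
        expect (scatter (∑ v, (a v).pushes).toList) fun inbox =>
          expect (indep n fun v => receive f P t (a v).state (inbox v)) Φ := by
  unfold step
  simp only [expect_bind, expect_map]

theorem mem_support_step {e e' : Execution n H} (h : e' ∈ (step f P t e).support) :
    ∃ a ∈ (indep n fun v => act f P t e.config (e.config v)).support,
    ∃ inbox ∈ (scatter (∑ v, (a v).pushes).toList).support,
      e'.config ∈ (indep n fun v => receive f P t (a v).state (inbox v)).support ∧
      e'.maxWork = max e.maxWork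
        (Finset.univ.sup fun v => (a v).pulls + Multiset.card (a v).pushes) ∧
      e'.maxElemBits = max e.maxElemBits (Finset.univ.sup fun v =>
        max (a v).replyBits (((a v).pushes.map Msg.elemBits).toFinset.sup id)) ∧
      e'.maxEntryBits = max e.maxEntryBits (Finset.univ.sup fun v =>
        ((a v).pushes.map Msg.entryBits).toFinset.sup id) := by
  unfold step at h
  simp only [PMF.mem_support_bind_iff, PMF.mem_support_map_iff] at h
  obtain ⟨a, ha, inbox, hi, c, hc, rfl⟩ := h
  exact ⟨a, ha, inbox, hi, hc, rfl, rfl, rfl⟩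

namespace StepData

theorem orig_eq (hs : StepData f P t M x a inbox x') (v : Fin n) :
    (x' v).orig = (x v).orig + origs (inbox v) := by
  obtain ⟨cp, _, h⟩ := hs.receive v
  rw [h, ← (hs.act v).orig]
  rfl

theorem pulling_eq (hs : StepData f P t M x a inbox x') (v : Fin n) :
    (x' v).pulling = (a v).state.pulling := by
  obtain ⟨cp, _, h⟩ := hs.receive v
  rw [h]
  rfl

/-- Every triple that a node has or receives is in the set of some node. -/
theorem exists_mem_of_mem_triples (hs : StepData f P t M x a inbox x') {v : Fin n} {e : Entry H}
    (he : e ∈ triples (inbox v)) : ∃ u, e ∈ (a u).state.entries := by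
  obtain ⟨m, hm, hme⟩ := (Multiset.mem_filterMap _ _).1 he
  have h1 : m ∈ ∑ v, (a v).pushes := by
    rw [← hs.sum]
    exact Multiset.mem_of_le (Finset.single_le_sum (f := inbox)
      (fun _ _ => Multiset.zero_le _) (Finset.mem_univ v)) hm
  obtain ⟨u, _, hu⟩ := Multiset.mem_sum.1 h1
  refine ⟨u, ?_⟩
  rw [← Finset.mem_val, ← (hs.act u).triples]
  exact (Multiset.mem_filterMap _ _).2 ⟨m, hu, hme⟩

theorem mem_entries_of_iter_lt (hs : StepData f P t M x a inbox x') {u : Fin n} {e : Entry H}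
    (he : e ∈ (a u).state.entries) (hi : e.iter < t) : e ∈ (x u).entries := by
  rcases (hs.act u).entries with h | ⟨R, h⟩
  · rwa [h] at he
  · rw [h, Finset.mem_insert] at he
    rcases he with rfl | he
    · exact absurd hi (lt_irrefl _)
    · exact he

theorem entries_subset (hs : StepData f P t M x a inbox x') (u : Fin n) :
    (x u).entries ⊆ (a u).state.entries := by
  rcases (hs.act u).entries with h | ⟨R, h⟩
  · rw [h]
  · rw [h]; exact Finset.subset_insert _ _

/-- A triple before an iteration that is responsible for the triple `e` after it. -/
theorem exists_source (hs : StepData f P t M x a inbox x') {v : Fin n} {e : Entry H}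
    (he : e ∈ (x' v).entries) :
    ∃ u, ∃ e' ∈ (a u).state.entries, e'.iter = e.iter ∧ e'.basis = e.basis ∧
      (e.valid = true ↔ e'.valid = true ∧
        ¬ f e.basis < f (e.basis ∪ (x' v).known.toFinset)) := by
  obtain ⟨cp, _, h⟩ := hs.receive v
  rw [h, mem_terminate_entries] at he
  obtain ⟨⟨e', he', rfl⟩, _⟩ := he
  have hmem := (Finset.mem_filter.1 he').1
  have hu : ∃ u, e' ∈ (a u).state.entries := by
    rcases Finset.mem_union.1 hmem with h1 | h1
    · exact ⟨v, h1⟩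
    · exact hs.exists_mem_of_mem_triples (Multiset.mem_toFinset.1 h1)
  obtain ⟨u, hu⟩ := hu
  refine ⟨u, e', hu, rfl, rfl, ?_⟩
  rw [check_valid, h]
  rfl

/-- A triple that a node has or receives and that is not mature is represented by one that is
at least as good. -/
theorem exists_target (hs : StepData f P t M x a inbox x') {v : Fin n} {e : Entry H}
    (he : e ∈ (a v).state.entries ∨ e ∈ triples (inbox v))
    (hi : t + 1 ≤ e.iter + P.ct * P.L) :
    ∃ e' ∈ (x' v).entries, e'.iter = e.iter ∧ basisKey f e ≤ basisKey f e' ∧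
      (e'.basis = e.basis → e.valid = false → e'.valid = false) := by
  obtain ⟨cp, _, h⟩ := hs.receive v
  have hmem : e ∈ (a v).state.entries ∪ (triples (inbox v)).toFinset := by
    rw [Finset.mem_union, Multiset.mem_toFinset]
    exact he
  obtain ⟨m, hm, hmi, hmk⟩ := exists_mem_mergeEntries (f := f) hmem
  rw [h]
  refine ⟨_, mem_terminate_entries.2 ⟨⟨m, hm, rfl⟩, ?_⟩, hmi,
      (basisKey_le_of_key_le hmk : basisKey f e ≤ basisKey f m), ?_⟩
  · change t + 1 ≤ m.iter + P.ct * P.L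
    omega
  · intro hb hv
    change m.basis = e.basis at hb
    have := valid_eq_false_of_key_le hmk hb.symm hv
    simp [Entry.check, this]

end StepData

/-- The invariant of the termination detection at the beginning of iteration `t`: the ages of the
triples are between `1` and `c_t L`, a node has at most one triple of every iteration, optimal triples
are valid, and a triple that is still valid has been compared with everything its node knows. -/
structure EntryInv (f : Finset H → T) (P : Params) (t : ℕ) (x : Fin n → NodeState H) : Prop where
  basis : ∀ v, ∀ e ∈ (x v).entries, IsBasis f e.basis
  iter_lt : ∀ v, ∀ e ∈ (x v).entries, e.iter < t
  le_iter : ∀ v, ∀ e ∈ (x v).entries, t ≤ e.iter + P.ct * P.L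
  unique : ∀ v, ∀ e ∈ (x v).entries, ∀ e' ∈ (x v).entries, e.iter = e'.iter → e = e'
  optimal : ∀ v, ∀ e ∈ (x v).entries, f e.basis = f Finset.univ → e.valid = true
  checked : ∀ v, ∀ e ∈ (x v).entries, e.valid = true →
    ¬ f e.basis < f (e.basis ∪ (x v).known.toFinset)

theorem EntryInv.action (hf : IsLPType f) (hinv : EntryInv f P t x)
    (hs : StepData f P t M x a inbox x') (u : Fin n) :
    ∀ e ∈ (a u).state.entries, IsBasis f e.basis ∧ e.iter ≤ t ∧
      (f e.basis = f Finset.univ → e.valid = true) := by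
  intro e he
  have hold : e ∈ (x u).entries → _ := fun h =>
    (⟨hinv.basis u e h, (hinv.iter_lt u e h).le, hinv.optimal u e h⟩ :
      IsBasis f e.basis ∧ e.iter ≤ t ∧ (f e.basis = f Finset.univ → e.valid = true))
  rcases (hs.act u).entries with h | ⟨R, h⟩
  · exact hold (h ▸ he)
  · rw [h, Finset.mem_insert] at he
    rcases he with rfl | he
    · exact ⟨(basisOf_spec hf R).2.1, le_rfl, fun _ => rfl⟩
    · exact hold he

theorem EntryInv.step (hf : IsLPType f) (hinv : EntryInv f P t x)
    (hs : StepData f P t M x a inbox x') : EntryInv f P (t + 1) x' := by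
  refine ⟨?_, ?_, ?_, ?_, ?_, ?_⟩
  · intro v e he
    obtain ⟨u, e', he', _, hb, _⟩ := hs.exists_source he
    exact hb ▸ (hinv.action hf hs u e' he').1
  · intro v e he
    obtain ⟨u, e', he', hi, _, _⟩ := hs.exists_source he
    have := (hinv.action hf hs u e' he').2.1
    omega
  · intro v e he
    obtain ⟨cp, _, h⟩ := hs.receive v
    rw [h, mem_terminate_entries] at he
    exact he.2
  · intro v e he e' he' hi
    obtain ⟨cp, _, h⟩ := hs.receive v
    rw [h, mem_terminate_entries] at he he'
    obtain ⟨⟨m, hm, rfl⟩, _⟩ := he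
    obtain ⟨⟨m', hm', rfl⟩, _⟩ := he'
    rw [eq_of_mem_mergeEntries hm hm' hi]
  · intro v e he hopt
    obtain ⟨u, e', he', _, hb, hv⟩ := hs.exists_source he
    rw [hv]
    refine ⟨(hinv.action hf hs u e' he').2.2 (hb ▸ hopt), ?_⟩
    rw [hopt, not_lt]
    exact hf.monotone _ _ (Finset.subset_univ _)
  · intro v e he hval
    obtain ⟨u, e', he', _, _, hv⟩ := hs.exists_source he
    exact (hv.1 hval).2

theorem EntryInv.card_entries_le (hinv : EntryInv f P t x) (v : Fin n) :
    (x v).entries.card ≤ P.ct * P.L := by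
  have h : (x v).entries.card ≤ (Finset.Ico (t - P.ct * P.L) t).card := by
    refine Finset.card_le_card_of_injOn Entry.iter ?_ ?_
    · intro e he
      rw [Finset.mem_coe, Finset.mem_Ico]
      have h1 := hinv.iter_lt v e he
      have h2 := hinv.le_iter v e he
      omega
    · intro e he e' he' hi
      exact hinv.unique v e he e' he' hi
  rw [Nat.card_Ico] at h
  omega

/-! ### Spreading of the best triple of an iteration -/

/-- `e` is a best triple of iteration `τ`, as far as its basis is concerned. -/
def IsTop (f : Finset H → T) (x : Fin n → NodeState H) (τ : ℕ) (e : Entry H) : Prop :=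
  e.iter = τ ∧ ∀ u, ∀ e' ∈ (x u).entries, e'.iter = τ → basisKey f e' ≤ basisKey f e

open Classical in
/-- The nodes with a best triple of iteration `τ`, for `b = true` only those with a best triple
that is known to be invalid. -/
def holders (f : Finset H → T) (b : Bool) (x : Fin n → NodeState H) (τ : ℕ) : Finset (Fin n) :=
  Finset.univ.filter fun v => ∃ e ∈ (x v).entries, IsTop f x τ e ∧ (b = true → e.valid = false)

theorem mem_holders {b : Bool} {τ : ℕ} {v : Fin n} : v ∈ holders f b x τ ↔
    ∃ e ∈ (x v).entries, IsTop f x τ e ∧ (b = true → e.valid = false) := by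
  simp [holders]

theorem holders_nonempty {τ : ℕ} {v : Fin n} {e : Entry H} (he : e ∈ (x v).entries)
    (hi : e.iter = τ) : (holders f false x τ).Nonempty := by
  obtain ⟨m, hm, hmax⟩ := Finset.exists_max_image
    ((Finset.univ.biUnion fun u => (x u).entries).filter fun e => e.iter = τ)
    (basisKey f) ⟨e, by simp only [Finset.mem_filter, Finset.mem_biUnion]; exact ⟨⟨v, Finset.mem_univ v, he⟩, hi⟩⟩
  simp only [Finset.mem_filter, Finset.mem_biUnion, Finset.mem_univ, true_and] at hm hmax
  obtain ⟨⟨u, hu⟩, hmi⟩ := hm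
  exact ⟨u, mem_holders.2 ⟨m, hu, ⟨hmi, fun w e' he' hi' => hmax e' ⟨⟨w, he'⟩, hi'⟩⟩, by simp⟩⟩

/-- A node that has or receives a best triple of iteration `τ < t` keeps one. -/
theorem StepData.mem_holders (hs : StepData f P t M x a inbox x') {b : Bool} {τ : ℕ} (hτ : τ < t)
    (hmat : t + 1 ≤ τ + P.ct * P.L) {v : Fin n} {e : Entry H}
    (he : e ∈ (x v).entries ∨ e ∈ triples (inbox v)) (htop : IsTop f x τ e)
    (hb : b = true → e.valid = false) : v ∈ holders f b x' τ := by
  have hold : ∀ u, ∀ e' ∈ (x' u).entries, e'.iter = τ → basisKey f e' ≤ basisKey f e := by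
    intro u e' he' hi'
    obtain ⟨w, e₀, he₀, hi₀, hb₀, _⟩ := hs.exists_source he'
    have := htop.2 w e₀ (hs.mem_entries_of_iter_lt he₀ (by omega)) (hi₀.trans hi')
    unfold basisKey at this ⊢
    rwa [hb₀] at this
  obtain ⟨e', he', hi', hk, hv⟩ := hs.exists_target (he.imp_left fun h => hs.entries_subset v h)
    (by rw [htop.1]; exact hmat)
  have hk' := hold v e' he' (hi'.trans htop.1)
  have hkey : basisKey f e' = basisKey f e := le_antisymm hk' hk
  refine LowLoad.mem_holders.2 ⟨e', he', ⟨hi'.trans htop.1, fun u e'' he'' hi'' => ?_⟩, fun h => ?_⟩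
  · exact hkey ▸ hold u e'' he'' hi''
  · exact hv (basisKey_injective hkey) (hb h)

end step

/-! ### Rumour spreading -/

section spread

variable {n : ℕ} [NeZero n] {H : Type u}

theorem one_sub_inv_pow_le {n i : ℕ} (hn : n ≠ 0) (hi : i ≤ n) :
    (((n : ℝ) - 1) / n) ^ i ≤ 1 - i / (2 * n) := by
  have hn' : (0 : ℝ) < n := by positivity
  have hn1 : (1 : ℝ) ≤ n := by exact_mod_cast Nat.one_le_iff_ne_zero.2 hn
  have hi' : (i : ℝ) ≤ n := by exact_mod_cast hi
  have h0 : (0 : ℝ) ≤ ((n : ℝ) - 1) / n := div_nonneg (by linarith) hn'.le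
  have h1 : 1 + (i : ℝ) * (1 / n) ≤ (1 + 1 / (n : ℝ)) ^ i :=
    one_add_mul_le_pow (by have : (0 : ℝ) ≤ 1 / n := by positivity
                           linarith) i
  have h2 : (((n : ℝ) - 1) / n) ^ i * (1 + 1 / (n : ℝ)) ^ i ≤ 1 := by
    rw [← mul_pow]
    refine pow_le_one₀ (mul_nonneg h0 (by positivity)) ?_
    have : ((n : ℝ) - 1) / n * (1 + 1 / n) = 1 - (1 / n) ^ 2 := by field_simp; ring
    rw [this]
    nlinarith [sq_nonneg (1 / (n : ℝ))]
  have h3 : (((n : ℝ) - 1) / n) ^ i * (1 + (i : ℝ) * (1 / n)) ≤ 1 :=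
    (mul_le_mul_of_nonneg_left h1 (pow_nonneg h0 i)).trans h2
  set q := (((n : ℝ) - 1) / n) ^ i
  set y := (i : ℝ) * (1 / n) with hy
  have hy0 : 0 ≤ y := by positivity
  have hy1 : y ≤ 1 := by
    rw [hy, mul_one_div, div_le_one hn']; exact hi'
  have hiy : (i : ℝ) / (2 * n) = y / 2 := by rw [hy]; field_simp
  rw [hiy]
  have h4 : 1 ≤ (1 - y / 2) * (1 + y) := by nlinarith
  have h5 : q * (1 + y) ≤ (1 - y / 2) * (1 + y) := h3.trans h4
  exact le_of_mul_le_mul_right h5 (by linarith)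

theorem le_expect_scatter_hit (Q : Msg H → Prop) [DecidablePred Q] (v : Fin n) {l : List (Msg H)}
    (hl : (l : Multiset (Msg H)).countP Q ≤ n) :
    ENNReal.ofReal ((l : Multiset (Msg H)).countP Q / (2 * n)) ≤
      expect (scatter l) fun inbox => if 0 < (inbox v).countP Q then 1 else 0 := by
  set i := (l : Multiset (Msg H)).countP Q with hi
  have hn0 : n ≠ 0 := NeZero.ne n
  have hn : (0 : ℝ) < n := by exact_mod_cast Nat.pos_of_ne_zero hn0
  have hi' : (i : ℝ) ≤ n := by exact_mod_cast hl
  have h1 := expect_scatter_pow Q v 0 l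
  rw [add_zero, ← hi] at h1
  have h2 : (((n - 1 : ℕ) : ℝ≥0∞) / n) ^ i = ENNReal.ofReal ((((n : ℝ) - 1) / n) ^ i) := by
    rw [ENNReal.ofReal_pow (div_nonneg (by
      have : (1 : ℝ) ≤ n := by exact_mod_cast Nat.one_le_iff_ne_zero.2 hn0
      linarith) hn.le), ENNReal.ofReal_div_of_pos hn, ENNReal.ofReal_natCast,
      ← Nat.cast_pred (Nat.pos_of_ne_zero hn0), ENNReal.ofReal_natCast]
  have h3 : expect (scatter l) (fun inbox => if 0 < (inbox v).countP Q then 1 else 0) +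
      expect (scatter l) (fun inbox => 0 ^ (inbox v).countP Q) = 1 := by
    rw [← expect_add]
    conv_rhs => rw [← expect_const (scatter (n := n) l) 1]
    refine expect_congr_support fun inbox _ => ?_
    rcases Nat.eq_zero_or_pos ((inbox v).countP Q) with h | h
    · simp [h]
    · simp [h, h.ne']
  rw [h1, h2] at h3
  have h5 : (i : ℝ) / (2 * n) ≤ 1 := by
    rw [div_le_one (by positivity)]; linarith
  have h4 : ENNReal.ofReal (i / (2 * n)) + ENNReal.ofReal ((((n : ℝ) - 1) / n) ^ i) ≤ 1 := by
    refine (add_le_add_right (ENNReal.ofReal_le_ofReal (one_sub_inv_pow_le hn0 hl)) _).trans ?_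
    rw [← ENNReal.ofReal_add (by positivity) (by linarith)]
    simp
  rw [← h3] at h4
  exact (ENNReal.add_le_add_iff_right ENNReal.ofReal_ne_top).1 h4

/-- The potential of a rumour that `i` of `n` nodes know: the ratio of the nodes without and with
the rumour. If nobody knows it, it is `0` (by the convention on division). -/
def spreadPot (n i : ℕ) : ℝ≥0∞ := ENNReal.ofReal (((n : ℝ) - i) / i)

theorem spreadPot_zero (n : ℕ) : spreadPot n 0 = 0 := by simp [spreadPot]

theorem spreadPot_le (n i : ℕ) : spreadPot n i ≤ n := by
  unfold spreadPot
  rw [← ENNReal.ofReal_natCast]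
  refine ENNReal.ofReal_le_ofReal ?_
  rcases Nat.eq_zero_or_pos i with rfl | hi
  · simp
  · have : (1 : ℝ) ≤ i := by exact_mod_cast hi
    rw [div_le_iff₀ (by linarith)]
    nlinarith [(Nat.cast_nonneg n : (0 : ℝ) ≤ n)]

theorem spreadPot_anti {n i j : ℕ} (hi : 0 < i) (hij : i ≤ j) (hj : j ≤ n) :
    spreadPot n j ≤ spreadPot n i := by
  unfold spreadPot
  refine ENNReal.ofReal_le_ofReal ?_
  have h1 : (0 : ℝ) < i := by exact_mod_cast hi
  have h2 : (i : ℝ) ≤ j := by exact_mod_cast hij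
  have h3 : (j : ℝ) ≤ n := by exact_mod_cast hj
  exact div_le_div₀ (by linarith) (by linarith) h1 h2

theorem inv_le_spreadPot {n i : ℕ} (hi : 0 < i) (hin : i < n) : (n : ℝ≥0∞)⁻¹ ≤ spreadPot n i := by
  unfold spreadPot
  have h1 : (0 : ℝ) < i := by exact_mod_cast hi
  have h2 : (i : ℝ) + 1 ≤ n := by exact_mod_cast hin
  rw [← ENNReal.ofReal_natCast, ← ENNReal.ofReal_inv_of_pos (by linarith)]
  refine ENNReal.ofReal_le_ofReal ?_
  rw [inv_eq_one_div]
  exact div_le_div₀ (by linarith) (by linarith) h1 (by linarith)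

/-- If every informed node sends the rumour to a random node, the potential drops by a constant
factor: the number of newly informed nodes has expectation at least `i (n - i) / (2 n)`. -/
theorem expect_scatter_spreadPot_le (Q : Msg H → Prop) [DecidablePred Q] {l : List (Msg H)}
    {I : Finset (Fin n)} (hI : 0 < I.card) (hl : (l : Multiset (Msg H)).countP Q = I.card) :
    expect (scatter l) (fun inbox => spreadPot n
      (I ∪ Finset.univ.filter fun v => 0 < (inbox v).countP Q).card) ≤
      ENNReal.ofReal (5 / 6) * spreadPot n I.card := by
  set i := I.card with hi
  have hin : i ≤ n := by simpa using Finset.card_le_univ I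
  have hn : (0 : ℝ) < n := by exact_mod_cast (lt_of_lt_of_le hI hin)
  have hi0 : (0 : ℝ) < i := by exact_mod_cast hI
  have hin' : (i : ℝ) ≤ n := by exact_mod_cast hin
  set u : ℝ := n - i with hu
  have hu0 : 0 ≤ u := by rw [hu]; linarith
  set K : ℝ := max (1 / i) (u / (2 * i ^ 2)) with hK
  have hK0 : 0 ≤ K := le_max_of_le_left (by positivity)
  set fresh : (Fin n → Multiset (Msg H)) → ℝ≥0∞ := fun inbox =>
    ∑ v ∈ Iᶜ, if 0 < (inbox v).countP Q then 1 else 0 with hfresh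
  have hpt : ∀ inbox ∈ (scatter l).support,
      spreadPot n (I ∪ Finset.univ.filter fun v => 0 < (inbox v).countP Q).card +
        ENNReal.ofReal K * fresh inbox ≤ ENNReal.ofReal (u / i) := by
    intro inbox hin
    set A := (Iᶜ).filter fun v => 0 < (inbox v).countP Q with hA
    have h1 : (I ∪ Finset.univ.filter fun v => 0 < (inbox v).countP Q) = I ∪ A := by
      ext v
      simp only [hA, Finset.mem_union, Finset.mem_filter, Finset.mem_univ, true_and,
        Finset.mem_compl]
      tauto
    have hdisj : Disjoint I A := by
      rw [Finset.disjoint_left]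
      intro v hv hvA
      rw [hA, Finset.mem_filter, Finset.mem_compl] at hvA
      exact hvA.1 hv
    have h2 : fresh inbox = A.card := by
      rw [hfresh, hA]
      simp only [Finset.sum_boole]
    have h3 : A.card ≤ i := by
      rw [← hl, ← sum_of_mem_support_scatter hin]
      have hsum : (∑ v, inbox v).countP Q = ∑ v, (inbox v).countP Q := by
        rw [← Multiset.coe_countPAddMonoidHom, map_sum]
      rw [hsum, Finset.card_eq_sum_ones]
      refine (Finset.sum_le_sum (g := fun v => (inbox v).countP Q) fun v hv => ?_).trans
        (Finset.sum_le_sum_of_subset (Finset.subset_univ A))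
      exact (Finset.mem_filter.1 hv).2
    have h4 : i + A.card ≤ n := by
      have := Finset.card_le_univ (I ∪ A)
      rw [Finset.card_union_of_disjoint hdisj, Fintype.card_fin] at this
      exact this
    rw [h1, Finset.card_union_of_disjoint hdisj, h2, ← hi, ← ENNReal.ofReal_natCast,
      ← ENNReal.ofReal_mul hK0]
    unfold spreadPot
    have h3' : (A.card : ℝ) ≤ i := by exact_mod_cast h3
    have h4' : (i : ℝ) + A.card ≤ n := by exact_mod_cast h4
    have hA0 : (0 : ℝ) ≤ A.card := by positivity
    set N : ℝ := (A.card : ℝ)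
    push_cast
    rw [← ENNReal.ofReal_add (div_nonneg (by linarith) (by linarith)) (mul_nonneg hK0 hA0)]
    refine ENNReal.ofReal_le_ofReal ?_
    have hnum : (n : ℝ) - (i + N) = u - N := by rw [hu]; ring
    rw [hnum]
    have hNu : N ≤ u := by rw [hu]; linarith
    rw [hK]
    rcases max_choice (1 / (i : ℝ)) (u / (2 * (i : ℝ) ^ 2)) with h | h
    · rw [h]
      have : (u - N) / (i + N) ≤ (u - N) / i :=
        div_le_div_of_nonneg_left (by linarith) hi0 (by linarith)
      have h5 : (u - N) / i + 1 / i * N = u / i := by ring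
      linarith
    · rw [h]
      have h5 : (u - N) / (i + N) ≤ u / (i + N) :=
        div_le_div_of_nonneg_right (by linarith) (by linarith)
      have h6 : u / (i + N) ≤ u / i - u / (2 * i ^ 2) * N := by
        rw [div_le_iff₀ (by linarith)]
        have : (u / i - u / (2 * i ^ 2) * N) * (i + N) = u + u * N * (i - N) / (2 * i ^ 2) := by
          field_simp; ring
        rw [this]
        have : 0 ≤ u * N * (i - N) / (2 * i ^ 2) :=
          div_nonneg (mul_nonneg (mul_nonneg hu0 hA0) (by linarith)) (mul_nonneg zero_le_two (sq_nonneg _))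
        linarith
      linarith
  have hE : ENNReal.ofReal (u * (i / (2 * n))) ≤ expect (scatter l) fresh := by
    rw [hfresh, expect_sum]
    calc ENNReal.ofReal (u * (i / (2 * n)))
        = ∑ v ∈ Iᶜ, ENNReal.ofReal (i / (2 * n)) := by
          rw [Finset.sum_const, nsmul_eq_mul, Finset.card_compl, Fintype.card_fin, ← hi,
            ENNReal.ofReal_mul hu0, hu, ← Nat.cast_sub hin, ENNReal.ofReal_natCast]
      _ ≤ _ := Finset.sum_le_sum fun v _ => by
          rw [← hl]
          exact le_expect_scatter_hit Q v (hl ▸ hin)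
  have hsum : expect (scatter l) (fun inbox => spreadPot n
      (I ∪ Finset.univ.filter fun v => 0 < (inbox v).countP Q).card) +
      ENNReal.ofReal (u / i / 6) ≤ ENNReal.ofReal (u / i) := by
    calc _ ≤ expect (scatter l) (fun inbox => spreadPot n
          (I ∪ Finset.univ.filter fun v => 0 < (inbox v).countP Q).card) +
          ENNReal.ofReal K * expect (scatter l) fresh := by
          refine add_le_add_right ?_ _
          refine le_trans ?_ (mul_le_mul_right hE _)
          rw [← ENNReal.ofReal_mul hK0]
          refine ENNReal.ofReal_le_ofReal ?_
          rcases le_or_gt (n : ℝ) (3 * i) with h | h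
          · have h7 : 1 / (i : ℝ) ≤ K := le_max_left _ _
            refine le_trans ?_ (mul_le_mul_of_nonneg_right h7 (by positivity))
            have : 1 / (i : ℝ) * (u * (i / (2 * n))) = u / (2 * n) := by field_simp
            rw [this, div_div]
            exact div_le_div_of_nonneg_left hu0 (by positivity) (by linarith)
          · have h7 : u / (2 * i ^ 2) ≤ K := le_max_right _ _
            refine le_trans ?_ (mul_le_mul_of_nonneg_right h7 (by positivity))
            have : u / (2 * (i : ℝ) ^ 2) * (u * (i / (2 * n))) = u * u / (4 * n * i) := by
              field_simp; ring
            rw [this, div_div, div_le_div_iff₀ (by positivity) (by positivity)]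
            have h8 : 2 * (n : ℝ) ≤ 3 * u := by rw [hu]; linarith
            have : 0 ≤ u * i := by positivity
            nlinarith
      _ ≤ _ := by
          rw [← expect_const_mul, ← expect_add]
          exact expect_le_of_le hpt
  refine (ENNReal.add_le_add_iff_right (a := ENNReal.ofReal (u / i / 6))
    ENNReal.ofReal_ne_top).1 (hsum.trans (le_of_eq ?_))
  unfold spreadPot
  rw [← hu, ← ENNReal.ofReal_mul (by norm_num), ← ENNReal.ofReal_add (by positivity)
    (by positivity)]
  congr 1
  ring

end spread

section spread_step

variable {n : ℕ} [NeZero n] {H : Type u} {T : Type v} [Fintype H] [LinearOrder H] [LinearOrder T]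
  {f : Finset H → T} {P : Params} {t M : ℕ}

theorem countP_some {A B : Type*} (φ : A → Option B) (R : B → Prop) [DecidablePred R]
    [DecidablePred fun x => ∃ b, φ x = some b ∧ R b] (m : Multiset A) :
    (m.filterMap φ).countP R = m.countP fun x => ∃ b, φ x = some b ∧ R b := by
  induction m using Multiset.induction_on with
  | empty => rfl
  | cons a m ih =>
    rcases h : φ a with _ | b
    · rw [Multiset.filterMap_cons_none _ _ h, Multiset.countP_cons_of_neg _ (by simp [h]), ih]
    · rw [Multiset.filterMap_cons_some _ _ _ h]
      by_cases hb : R b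
      · rw [Multiset.countP_cons_of_pos _ hb, Multiset.countP_cons_of_pos _ ⟨b, h, hb⟩, ih]
      · rw [Multiset.countP_cons_of_neg _ hb, Multiset.countP_cons_of_neg, ih]
        rintro ⟨b', h', hb'⟩
        rw [h, Option.some.injEq] at h'
        exact hb (h' ▸ hb')

/-- The best triple of iteration `τ` spreads like a rumour, and so does the information that it is
invalid, provided that it is invalid at all. -/
theorem expect_step_spreadPot_le (hf : IsLPType f) {e : Execution n H} {τ : ℕ} (b : Bool)
    (hx : ∀ v, (e.config v).output = none) (hM : ∀ v, Multiset.card (e.config v).known ≤ M)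
    (hinv : EntryInv f P t e.config) (hτ : τ < t)
    (hb : b = true → holders f b e.config τ = ∅ → ∀ v, ∀ e' ∈ (e.config v).entries,
      e'.iter = τ → f e'.basis = f Finset.univ) :
    expect (step f P t e) (fun e' => spreadPot n (holders f b e'.config τ).card) ≤
      ENNReal.ofReal (5 / 6) * spreadPot n (holders f b e.config τ).card := by
  classical
  rw [expect_step e fun x' => spreadPot n (holders f b x' τ).card]
  by_cases hne : (holders f b e.config τ).Nonempty
  swap
  · rw [Finset.not_nonempty_iff_eq_empty] at hne
    refine le_trans (le_of_eq ?_) zero_le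
    refine expect_eq_zero fun a ha => expect_eq_zero fun inbox hi => expect_eq_zero fun x' hc => ?_
    have hs := stepData hx hM hinv.iter_lt ha hi hc
    have hempty : holders f b x' τ = ∅ := by
      rw [Finset.eq_empty_iff_forall_notMem]
      intro v hv
      obtain ⟨m, hm, htop, hbv⟩ := mem_holders.1 hv
      obtain ⟨u, e₀, he₀, hi₀, hb₀, _⟩ := hs.exists_source hm
      have he₀' := hs.mem_entries_of_iter_lt he₀ (by rw [hi₀, htop.1]; exact hτ)
      cases b with
      | false =>
        have := holders_nonempty (f := f) he₀' (hi₀.trans htop.1)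
        rw [hne] at this
        exact Finset.not_nonempty_empty this
      | true =>
        have h1 := hb rfl hne u e₀ he₀' (hi₀.trans htop.1)
        have h2 := (hinv.step hf hs).optimal v m hm (hb₀ ▸ h1)
        rw [hbv rfl] at h2
        exact absurd h2 (by simp)
    rw [hempty, Finset.card_empty, spreadPot_zero]
  by_cases hmat : t + 1 ≤ τ + P.ct * P.L
  swap
  · refine le_trans (le_of_eq ?_) zero_le
    refine expect_eq_zero fun a ha => expect_eq_zero fun inbox hi => expect_eq_zero fun x' hc => ?_
    have hs := stepData hx hM hinv.iter_lt ha hi hc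
    have hempty : holders f b x' τ = ∅ := by
      rw [Finset.eq_empty_iff_forall_notMem]
      intro v hv
      obtain ⟨m, hm, htop, _⟩ := mem_holders.1 hv
      have := (hinv.step hf hs).le_iter v m hm
      rw [htop.1] at this
      exact hmat this
    rw [hempty, Finset.card_empty, spreadPot_zero]
  set R : Entry H → Prop := fun e' => IsTop f e.config τ e' ∧ (b = true → e'.valid = false) with hR
  set Q : Msg H → Prop := fun m => ∃ e', m.entry? = some e' ∧ R e' with hQ
  refine expect_le_of_le fun a ha => ?_
  have hact : ∀ v, ActionSpec f P t n M (e.config v) (a v) := fun v =>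
    actionSpec hx (hx v) hM (hinv.iter_lt v) (mem_support_indep ha v)
  have hcount : (((∑ v, (a v).pushes).toList : List (Msg H)) : Multiset (Msg H)).countP Q =
      (holders f b e.config τ).card := by
    rw [Multiset.coe_toList, ← Multiset.coe_countPAddMonoidHom, map_sum, holders,
      Finset.card_filter]
    refine Finset.sum_congr rfl fun v _ => ?_
    rw [Multiset.coe_countPAddMonoidHom, ← countP_some Msg.entry? R]
    change (triples (a v).pushes).countP R = _
    rw [(hact v).triples]
    have h1 : (a v).state.entries.val.countP R = ((a v).state.entries.filter R).card := by
      rw [Multiset.countP_eq_card_filter]; rfl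
    have h2 : (a v).state.entries.filter R = (e.config v).entries.filter R := by
      rcases (hact v).entries with h | ⟨S, h⟩
      · rw [h]
      · rw [h, Finset.filter_insert, if_neg]
        rintro ⟨h3, _⟩
        exact absurd h3.1 hτ.ne'
    rw [h1, h2]
    split_ifs with h3
    · obtain ⟨e', he', hRe⟩ := h3
      rw [Finset.card_eq_one]
      refine ⟨e', ?_⟩
      ext e''
      rw [Finset.mem_filter, Finset.mem_singleton]
      constructor
      · rintro ⟨h4, h5⟩
        exact hinv.unique v e'' h4 e' he' (h5.1.1.trans hRe.1.1.symm)
      · rintro rfl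
        exact ⟨he', hRe⟩
    · rw [Finset.card_eq_zero, Finset.filter_eq_empty_iff]
      exact fun e' he' hRe => h3 ⟨e', he', hRe⟩
  refine le_trans (expect_mono_support fun inbox hi => ?_)
    (expect_scatter_spreadPot_le Q hne.card_pos hcount)
  refine expect_le_of_le fun x' hc => ?_
  have hs := stepData hx hM hinv.iter_lt ha hi hc
  have hsub : holders f b e.config τ ∪ Finset.univ.filter (fun v => 0 < (inbox v).countP Q) ⊆
      holders f b x' τ := by
    intro v hv
    rcases Finset.mem_union.1 hv with h | h
    · obtain ⟨e', he', htop, hbv⟩ := mem_holders.1 h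
      exact hs.mem_holders hτ hmat (Or.inl he') htop hbv
    · obtain ⟨m, hm, e', hme, htop, hbv⟩ := Multiset.countP_pos.1 (Finset.mem_filter.1 h).2
      exact hs.mem_holders hτ hmat (Or.inr ((Multiset.mem_filterMap _ _).2 ⟨m, hm, hme⟩)) htop hbv
  refine spreadPot_anti ?_ (Finset.card_le_card hsub)
    (by simpa using Finset.card_le_univ (holders f b x' τ))
  exact lt_of_lt_of_le hne.card_pos (Finset.card_le_card Finset.subset_union_left)

end spread_step

/-! ### The loads -/

section loads

variable {n : ℕ} [NeZero n] {H : Type u} {T : Type v} [Fintype H] [LinearOrder H] [LinearOrder T]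
  {f : Finset H → T} {P : Params} {t M : ℕ}

/-- A message `(h, 0)` multiplies the product by a random weight of average at most `1`, so the
product of the weights of all original elements is a supermartingale. -/
theorem expect_step_prod_orig_le {e : Execution n H}
    (hx : ∀ v, (e.config v).output = none) (hM : ∀ v, Multiset.card (e.config v).known ≤ M)
    (hinv : EntryInv f P t e.config) {wt : Fin n → ℝ≥0∞} (hwt : ∑ v, wt v ≤ n) :
    expect (step f P t e) (fun e' => ∏ v, wt v ^ Multiset.card (e'.config v).orig) ≤
      ∏ v, wt v ^ Multiset.card (e.config v).orig := by
  have hn : (n : ℝ≥0∞) ≠ 0 := by simpa using NeZero.ne n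
  rw [expect_step e fun x' => ∏ v, wt v ^ Multiset.card (x' v).orig]
  refine expect_le_of_le fun a ha => ?_
  calc _ ≤ expect (scatter (∑ v, (a v).pushes).toList) (fun inbox =>
        (∏ v, wt v ^ Multiset.card (e.config v).orig) *
          ∏ v, wt v ^ (inbox v).countP fun m => (Msg.orig? m).isSome) := by
        refine expect_mono_support fun inbox hi => expect_le_of_le fun x' hc => ?_
        have hs := stepData hx hM hinv.iter_lt ha hi hc
        rw [← Finset.prod_mul_distrib]
        refine le_of_eq (Finset.prod_congr rfl fun v _ => ?_)
        rw [hs.orig_eq, Multiset.card_add, pow_add, origs, card_filterMap_eq_countP]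
    _ ≤ _ := by
        rw [expect_const_mul, expect_scatter_prod]
        refine mul_le_of_le_one_right' (pow_le_one' ?_ _)
        exact ENNReal.div_le_of_le_mul (by rwa [one_mul])

theorem coe_keepProb {d : ℕ} (hd : 1 ≤ d) : (keepProb d : ℝ) = 2 * d / (2 * d + 1) := by
  have : (0 : ℝ) < d := by exact_mod_cast hd
  unfold keepProb
  push_cast
  field_simp

theorem prod_one_add_le_exp {ι : Type*} {s : Finset ι} {z : ι → ℝ≥0∞} {y : ℝ} (hy : 0 ≤ y)
    (h : ∑ i ∈ s, z i ≤ ENNReal.ofReal y) : ∏ i ∈ s, (1 + z i) ≤ ENNReal.ofReal (Real.exp y) := by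
  have hz : ∀ i ∈ s, z i ≠ ∞ := fun i hi => ne_top_of_le_ne_top ENNReal.ofReal_ne_top
    ((Finset.single_le_sum (fun _ _ => zero_le) hi).trans h)
  have h1 : ∀ i ∈ s, 1 + z i ≤ ENNReal.ofReal (Real.exp (z i).toReal) := by
    intro i hi
    conv_lhs => rw [← ENNReal.ofReal_toReal (hz i hi)]
    rw [← ENNReal.ofReal_one, ← ENNReal.ofReal_add zero_le_one ENNReal.toReal_nonneg]
    refine ENNReal.ofReal_le_ofReal ?_
    rw [add_comm]
    exact Real.add_one_le_exp _
  refine (Finset.prod_le_prod' h1).trans ?_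
  rw [← ENNReal.ofReal_prod_of_nonneg (fun _ _ => (Real.exp_pos _).le), ← Real.exp_sum,
    ← ENNReal.toReal_sum hz]
  exact ENNReal.ofReal_le_ofReal (Real.exp_le_exp.2 (ENNReal.toReal_le_of_le_ofReal hy h))

theorem one_add_pow_le {y z : ℝ} (hy : 0 ≤ y) {W : ℕ} (hz : W * y ≤ z) (hz1 : z ≤ 1) :
    (1 + y) ^ W ≤ 1 + y * (1 + z) * W := by
  have hW : (0 : ℝ) ≤ W * y := by positivity
  have h1 : (1 + y) ^ W ≤ Real.exp (W * y) := by
    rw [mul_comm, Real.exp_mul, Real.rpow_natCast]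
    exact pow_le_pow_left₀ (by linarith) (by rw [add_comm]; exact Real.add_one_le_exp y) W
  have h2 := Real.abs_exp_sub_one_sub_id_le (x := W * y) (by rw [abs_of_nonneg hW]; linarith)
  have h3 := (abs_le.1 h2).2
  nlinarith

/-- The decisive estimate for the load: thinning beats the arrival of copies as long as there are at
least `4 M / 5` copies. -/
theorem keep_pow_mul_exp_le {d M X₀ X : ℕ} (hd : 1 ≤ d) (hX₀ : 4 * M ≤ 5 * X₀) :
    (1 + (keepProb d : ℝ)) ^ X * Real.exp (keepProb d * (M / (5 * d))) ≤
      max (2 ^ X) (2 ^ X₀) := by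
  have hd' : (0 : ℝ) < d := by exact_mod_cast hd
  set k : ℝ := (keepProb d : ℝ) with hk
  have hk' := coe_keepProb hd
  rw [← hk] at hk'
  have hk0 : 0 ≤ k := (keepProb d).2
  have hk1 : k ≤ 1 := by exact_mod_cast keepProb_le_one d
  have hbase : 1 + k ≤ 2 * Real.exp (-((1 - k) / 2)) := by
    have := Real.add_one_le_exp (-((1 - k) / 2))
    linarith
  have hmain : (1 + k) ^ X₀ * Real.exp (k * (M / (5 * d))) ≤ 2 ^ X₀ := by
    have h1 : (1 + k) ^ X₀ ≤ 2 ^ X₀ * Real.exp (-(X₀ * ((1 - k) / 2))) := by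
      refine (pow_le_pow_left₀ (by linarith) hbase X₀).trans (le_of_eq ?_)
      rw [mul_pow, ← Real.exp_nat_mul]
      congr 2
      ring
    have h2 : k * (M / (5 * d)) ≤ X₀ * ((1 - k) / 2) := by
      have h3 : (4 : ℝ) * M ≤ 5 * X₀ := by exact_mod_cast hX₀
      rw [hk']
      have h4 : (2 * (d : ℝ) / (2 * d + 1)) * (M / (5 * d)) = (2 * M / 5) / (2 * d + 1) := by
        field_simp
      have h5 : (X₀ : ℝ) * ((1 - 2 * d / (2 * d + 1)) / 2) = (X₀ / 2) / (2 * d + 1) := by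
        field_simp; ring
      rw [h4, h5]
      exact div_le_div_of_nonneg_right (by linarith) (by linarith)
    calc (1 + k) ^ X₀ * Real.exp (k * (M / (5 * d)))
        ≤ 2 ^ X₀ * Real.exp (-(X₀ * ((1 - k) / 2))) * Real.exp (X₀ * ((1 - k) / 2)) :=
          mul_le_mul h1 (Real.exp_le_exp.2 h2) (Real.exp_pos _).le (by positivity)
      _ = 2 ^ X₀ := by rw [mul_assoc, ← Real.exp_add]; simp
  rcases le_or_gt X X₀ with h | h
  · refine le_trans ?_ (le_max_right _ _)
    refine le_trans ?_ hmain
    exact mul_le_mul_of_nonneg_right (pow_le_pow_right₀ (by linarith) h) (Real.exp_pos _).le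
  · refine le_trans ?_ (le_max_left _ _)
    obtain ⟨j, rfl⟩ := Nat.exists_eq_add_of_le h.le
    rw [pow_add, pow_add, mul_right_comm]
    exact mul_le_mul hmain (pow_le_pow_left₀ (by linarith) (by linarith) j) (by positivity)
      (by positivity)

/-- The exponential potential of the number of copies at a node stays bounded. -/
theorem expect_step_two_pow_copies_le (hf : IsLPType f) {e : Execution n H}
    (hx : ∀ v, (e.config v).output = none) (hM : ∀ v, Multiset.card (e.config v).known ≤ M)
    (hinv : EntryInv f P t e.config) (hd : 1 ≤ P.d) (hdim : dim f = P.d) (hMn : M ≤ n)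
    (hnum : (1 + (M : ℝ) / n) * (P.d / (6 * P.d ^ 2 + 1 : ℕ) +
      (P.cs * (6 * P.d ^ 2 + P.L) : ℕ) / n) ≤ 1 / (5 * P.d))
    {X₀ : ℕ} (hX₀ : 4 * M ≤ 5 * X₀) (v : Fin n) :
    expect (step f P t e) (fun e' => 2 ^ Multiset.card (e'.config v).copies) ≤
      2 ^ Multiset.card (e.config v).copies + 2 ^ X₀ := by
  have hn0 : n ≠ 0 := NeZero.ne n
  have hn : (0 : ℝ) < n := by exact_mod_cast Nat.pos_of_ne_zero hn0
  have hd' : (0 : ℝ) < P.d := by exact_mod_cast hd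
  have hMn' : (M : ℝ) / n ≤ 1 := by rw [div_le_one hn]; exact_mod_cast hMn
  set k : ℝ := (keepProb P.d : ℝ) with hk
  have hk0 : 0 ≤ k := (keepProb P.d).2
  have hk1 : k ≤ 1 := by exact_mod_cast keepProb_le_one P.d
  set X := Multiset.card (e.config v).copies with hX
  set y : ℝ := k / n with hy
  have hy0 : 0 ≤ y := by positivity
  have hbase : (keepProb P.d : ℝ≥0∞) * 2 + (1 - keepProb P.d) = ENNReal.ofReal (1 + k) := by
    have h1 : (keepProb P.d : ℝ≥0∞) ≤ 1 := by exact_mod_cast keepProb_le_one P.d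
    have h2 : (keepProb P.d : ℝ≥0∞) = ENNReal.ofReal k := by rw [hk, ENNReal.ofReal_coe_nnreal]
    rw [mul_two, add_assoc, add_tsub_cancel_of_le h1, h2, ← ENNReal.ofReal_one,
      ← ENNReal.ofReal_add hk0 zero_le_one, add_comm]
  rw [expect_step e fun x' => 2 ^ Multiset.card (x' v).copies]
  calc _ ≤ expect (indep n fun v => act f P t e.config (e.config v)) (fun a =>
        ENNReal.ofReal (1 + k) ^ X *
          ∏ u, ENNReal.ofReal (1 + y) ^ Multiset.card (elems (a u).pushes)) := by
        refine expect_mono_support fun a ha => ?_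
        have hact : ∀ v, ActionSpec f P t n M (e.config v) (a v) := fun v =>
          actionSpec hx (hx v) hM (hinv.iter_lt v) (mem_support_indep ha v)
        have h1 : ∀ inbox : Fin n → Multiset (Msg H),
            expect (indep n fun v => receive f P t (a v).state (inbox v))
              (fun x' => 2 ^ Multiset.card (x' v).copies) =
            ENNReal.ofReal (1 + k) ^ X *
              ENNReal.ofReal (1 + k) ^ (inbox v).countP fun m => (Msg.elem? m).isSome := by
          intro inbox
          rw [expect_indep_single _ v fun σ : NodeState H => 2 ^ Multiset.card σ.copies,
            receive_of_output_eq_none (hact v).output, expect_map]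
          change expect _ (fun s : Multiset H => (2 : ℝ≥0∞) ^ Multiset.card s) = _
          rw [expect_thin_pow_card, hbase, Multiset.length_toList, Multiset.card_add, pow_add,
            (hact v).copies, elems, card_filterMap_eq_countP]
        simp only [h1]
        rw [expect_const_mul, expect_scatter_pow, Multiset.coe_toList]
        have h2 : (((n - 1 : ℕ) : ℝ≥0∞) + ENNReal.ofReal (1 + k)) / n = ENNReal.ofReal (1 + y) := by
          rw [← ENNReal.ofReal_natCast, ← ENNReal.ofReal_natCast n,
            ← ENNReal.ofReal_add (by positivity) (by positivity),
            ← ENNReal.ofReal_div_of_pos hn, Nat.cast_pred (Nat.pos_of_ne_zero hn0)]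
          congr 1
          rw [hy]
          field_simp
          ring
        rw [h2, ← Multiset.coe_countPAddMonoidHom, map_sum, ← Finset.prod_pow_eq_pow_sum]
        refine le_of_eq ?_
        congr 1
        refine Finset.prod_congr rfl fun u _ => ?_
        rw [Multiset.coe_countPAddMonoidHom, elems, card_filterMap_eq_countP]
    _ ≤ ENNReal.ofReal (1 + k) ^ X * ENNReal.ofReal (Real.exp (k * (M / (5 * P.d)))) := by
        rw [expect_const_mul, expect_indep_prod n _ fun u (a : Action H) =>
          ENNReal.ofReal (1 + y) ^ Multiset.card (elems a.pushes)]
        refine mul_le_mul_right ?_ _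
        set S : Fin n → ℝ≥0∞ := fun u =>
          ((e.config u).known.map (violProb f P fun w => (e.config w).known)).sum with hS
        refine le_trans (Finset.prod_le_prod' (g := fun u =>
          1 + ENNReal.ofReal (y * (1 + M / n)) * S u) fun u _ => ?_)
          (prod_one_add_le_exp (by positivity) ?_)
        · refine le_trans (expect_mono_support (g' := fun a => 1 +
            ENNReal.ofReal (y * (1 + M / n)) * Multiset.card (elems a.pushes)) fun a ha => ?_) ?_
          · have hW : Multiset.card (elems a.pushes) ≤ M :=
              (Multiset.card_le_card (actionSpec hx (hx u) hM (hinv.iter_lt u) ha).elems).trans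
                (hM u)
            set W := Multiset.card (elems a.pushes)
            rw [← ENNReal.ofReal_pow (by positivity), ← ENNReal.ofReal_natCast W,
              ← ENNReal.ofReal_mul (by positivity), ← ENNReal.ofReal_one,
              ← ENNReal.ofReal_add zero_le_one (by positivity)]
            refine ENNReal.ofReal_le_ofReal (one_add_pow_le hy0 ?_ hMn')
            have hW' : (W : ℝ) ≤ M := by exact_mod_cast hW
            rw [hy, ← mul_div_assoc]
            refine div_le_div_of_nonneg_right ?_ hn.le
            nlinarith [(Nat.cast_nonneg W : (0 : ℝ) ≤ W)]
          · rw [expect_add, expect_const, expect_const_mul]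
            exact add_le_add_right (mul_le_mul_right (expect_act_card_elems_le hx (hx u)) _) _
        · rw [← Finset.mul_sum]
          refine (mul_le_mul_right (sum_violProb_le hf P (fun w => (e.config w).known) hM) _).trans ?_
          rw [hdim]
          have h3 : (n : ℝ≥0∞) * M * (P.d / (6 * P.d ^ 2 + 1 : ℕ) +
              (P.cs * (6 * P.d ^ 2 + P.L) : ℕ) / n) = ENNReal.ofReal (n * M * (P.d /
              (6 * P.d ^ 2 + 1 : ℕ) + (P.cs * (6 * P.d ^ 2 + P.L) : ℕ) / n)) := by
            rw [ENNReal.ofReal_mul (by positivity), ENNReal.ofReal_mul (by positivity),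
              ENNReal.ofReal_add (by positivity) (by positivity),
              ENNReal.ofReal_div_of_pos (by positivity), ENNReal.ofReal_div_of_pos hn]
            simp only [ENNReal.ofReal_natCast]
          rw [h3, ← ENNReal.ofReal_mul (by positivity)]
          refine ENNReal.ofReal_le_ofReal ?_
          set A : ℝ := P.d / (6 * P.d ^ 2 + 1 : ℕ) + (P.cs * (6 * P.d ^ 2 + P.L) : ℕ) / n
          have h4 : y * (1 + M / n) * (n * M * A) = k * M * ((1 + M / n) * A) := by
            rw [hy]; field_simp
          rw [h4, mul_assoc]
          refine mul_le_mul_of_nonneg_left ?_ hk0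
          calc (M : ℝ) * ((1 + M / n) * A) ≤ M * (1 / (5 * P.d)) :=
                mul_le_mul_of_nonneg_left hnum (by positivity)
            _ = M / (5 * P.d) := by ring
    _ ≤ _ := by
        rw [← ENNReal.ofReal_pow (by positivity), ← ENNReal.ofReal_mul (by positivity)]
        refine (ENNReal.ofReal_le_ofReal (keep_pow_mul_exp_le hd hX₀)).trans ?_
        have h2 : ∀ j : ℕ, (2 : ℝ≥0∞) ^ j = ENNReal.ofReal (2 ^ j) := by
          intro j
          rw [ENNReal.ofReal_pow (by norm_num)]; norm_num
        rw [h2, h2, ← ENNReal.ofReal_add (by positivity) (by positivity)]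
        exact ENNReal.ofReal_le_ofReal (max_le_add_of_nonneg (by positivity) (by positivity))

end loads

/-! ### The pull phase -/

section pullPhase

variable {n : ℕ} [NeZero n] {H : Type u} {T : Type v} [Fintype H] [LinearOrder H] [LinearOrder T]
  {f : Finset H → T} {P : Params} {t M : ℕ}

/-- The nodes in the pull phase. -/
def pullers (x : Fin n → NodeState H) : Finset (Fin n) :=
  Finset.univ.filter fun v => (x v).pulling = true

/-- The nodes with an original element. -/
def suppliers (x : Fin n → NodeState H) : Finset (Fin n) :=
  Finset.univ.filter fun v => (x v).orig ≠ 0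

/-- The ratio of the number of nodes in the pull phase and the number of nodes with an original
element. -/
def pullPot (x : Fin n → NodeState H) : ℝ≥0∞ := (pullers x).card / (suppliers x).card

theorem StepData.suppliers_subset {x x' : Fin n → NodeState H} {a : Fin n → Action H}
    {inbox : Fin n → Multiset (Msg H)} (hs : StepData f P t M x a inbox x') :
    suppliers x ⊆ suppliers x' := by
  intro v hv
  simp only [suppliers, Finset.mem_filter, Finset.mem_univ, true_and] at hv ⊢
  rw [hs.orig_eq]
  intro h
  exact hv (by simpa using (add_eq_zero.1 h).1)

theorem StepData.pulling_of_pulling {x x' : Fin n → NodeState H} {a : Fin n → Action H}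
    {inbox : Fin n → Multiset (Msg H)} (hs : StepData f P t M x a inbox x') {v : Fin n}
    (h : (x' v).pulling = true) : (x v).pulling = true := by
  rw [hs.pulling_eq] at h
  have := (hs.act v).origs
  rw [if_pos h] at this
  by_contra hc
  rw [if_neg hc] at this
  omega

theorem StepData.pullers_subset {x x' : Fin n → NodeState H} {a : Fin n → Action H}
    {inbox : Fin n → Multiset (Msg H)} (hs : StepData f P t M x a inbox x') :
    pullers x' ⊆ pullers x := by
  intro v hv
  simp only [pullers, Finset.mem_filter, Finset.mem_univ, true_and] at hv ⊢
  exact hs.pulling_of_pulling hv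

/-- The generating function of the total number of messages `(h, 0)` of an iteration. -/
theorem expect_act_pow_sum_origs {e : Execution n H}
    (hx : ∀ v, (e.config v).output = none) (hM : ∀ v, Multiset.card (e.config v).known ≤ M)
    (hinv : EntryInv f P t e.config) {q q' : ℝ≥0∞} (hqq : q + q' = 1)
    (hq : q = ((suppliers e.config).card : ℝ≥0∞) / n) (b : ℝ≥0∞) :
    expect (indep n fun v => act f P t e.config (e.config v))
      (fun a => b ^ ∑ v, Multiset.card (origs (a v).pushes)) =
      (q * b + q') ^ (pullers e.config).card := by
  simp only [← Finset.prod_pow_eq_pow_sum]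
  rw [expect_indep_prod n _ fun u (a : Action H) => b ^ Multiset.card (origs a.pushes),
    ← Finset.prod_const, pullers, Finset.prod_filter]
  refine Finset.prod_congr rfl fun v _ => ?_
  cases hp : (e.config v).pulling
  · rw [if_neg (by simp), ← expect_const (act f P t e.config (e.config v)) 1]
    refine expect_congr_support fun a ha => ?_
    have := (actionSpec hx (hx v) hM (hinv.iter_lt v) ha).origs
    rw [hp, if_neg Bool.false_ne_true] at this
    rw [show Multiset.card (origs a.pushes) = 0 by omega, pow_zero]
  · rw [if_pos rfl]
    exact expect_act_pow_card_origs hx (hx v) hp hqq hq b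

/-- While there are many suppliers, the number of nodes in the pull phase drops geometrically. -/
theorem expect_step_card_pullers {e : Execution n H}
    (hx : ∀ v, (e.config v).output = none) (hM : ∀ v, Multiset.card (e.config v).known ≤ M)
    (hinv : EntryInv f P t e.config) (hsup : n ≤ 64 * (suppliers e.config).card) :
    expect (step f P t e) (fun e' => ((pullers e'.config).card : ℝ≥0∞)) ≤
      ENNReal.ofReal (63 / 64) * (pullers e.config).card := by
  have hn0 : n ≠ 0 := NeZero.ne n
  have hn : (n : ℝ≥0∞) ≠ 0 := by simpa using hn0
  rw [expect_step e fun x' => ((pullers x').card : ℝ≥0∞)]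
  calc _ ≤ expect (indep n fun v => act f P t e.config (e.config v)) (fun a =>
        ∑ v ∈ pullers e.config, if (a v).state.pulling = true then 1 else 0) := by
        refine expect_mono_support fun a ha => expect_le_of_le fun inbox hi =>
          expect_le_of_le fun x' hc => ?_
        have hs := stepData hx hM hinv.iter_lt ha hi hc
        rw [Finset.sum_boole]
        refine Nat.cast_le.2 (Finset.card_le_card fun v hv => ?_)
        refine Finset.mem_filter.2 ⟨hs.pullers_subset hv, ?_⟩
        rw [← hs.pulling_eq]
        exact (Finset.mem_filter.1 hv).2
    _ ≤ ∑ v ∈ pullers e.config, ENNReal.ofReal (63 / 64) := by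
        rw [expect_sum]
        refine Finset.sum_le_sum fun v hv => ?_
        rw [expect_indep_single _ v fun a : Action H => if a.state.pulling = true then 1 else 0]
        have h1 := expect_act_pulling (f := f) (P := P) (t := t) hx (hx v)
          (Finset.mem_filter.1 hv).2
        have h2 : ENNReal.ofReal (1 / 64) ≤ ((suppliers e.config).card : ℝ≥0∞) / n := by
          rw [ENNReal.le_div_iff_mul_le (Or.inl hn) (Or.inl (ENNReal.natCast_ne_top n)),
            ← ENNReal.ofReal_natCast, ← ENNReal.ofReal_natCast,
            ← ENNReal.ofReal_mul (by norm_num)]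
          refine ENNReal.ofReal_le_ofReal ?_
          have : (n : ℝ) ≤ 64 * (suppliers e.config).card := by exact_mod_cast hsup
          linarith
        refine (ENNReal.add_le_add_iff_right (a := ENNReal.ofReal (1 / 64))
          ENNReal.ofReal_ne_top).1 ((add_le_add_right h2 _).trans ?_)
        rw [← ENNReal.ofReal_add (by norm_num) (by norm_num)]
        refine h1.le.trans (le_of_eq ?_)
        norm_num
    _ = _ := by rw [Finset.sum_const, nsmul_eq_mul, mul_comm]

/-- The second-order term of the binomial expansion of `(1 + 1 / a) ^ S`. -/
theorem sq_le_four_mul_one_add_inv_pow {a : ℕ} (ha : 0 < a) (S : ℕ) :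
    ((S : ℝ) / a) ^ 2 ≤ 4 * (1 + 1 / (a : ℝ)) ^ S := by
  have ha' : (0 : ℝ) < a := by exact_mod_cast ha
  have ha1 : (1 : ℝ) ≤ a := by exact_mod_cast ha
  set z : ℝ := 1 / a with hz
  have hz0 : 0 < z := by positivity
  have hz1 : z ≤ 1 := by rw [hz, div_le_one ha']; exact ha1
  have key : ∀ S : ℕ, 1 + S * z + S * (S - 1) / 2 * z ^ 2 ≤ (1 + z) ^ S := by
    intro S
    induction S with
    | zero => simp
    | succ S ih =>
      rw [pow_succ]
      refine le_trans ?_ (mul_le_mul_of_nonneg_right ih (by linarith))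
      push_cast
      have : 0 ≤ (S : ℝ) * (S - 1) := by
        rcases Nat.eq_zero_or_pos S with rfl | h
        · simp
        · have : (1 : ℝ) ≤ S := by exact_mod_cast h
          exact mul_nonneg (by linarith) (by linarith)
      nlinarith [mul_nonneg this (pow_pos hz0 3).le]
  have h1 := key S
  have h2 : (S : ℝ) / a = S * z := by rw [hz]; ring
  rw [h2]
  have hS : (0 : ℝ) ≤ S := by positivity
  nlinarith [mul_nonneg hS hz0.le, mul_nonneg (mul_nonneg hS hz0.le) (sub_nonneg.2 hz1)]

theorem one_div_one_add_add_le {y E : ℝ} (hy : 0 ≤ y) (hE : y ^ 2 ≤ 4 * E) :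
    1 / (1 + y) + y / 40 ≤ 1 + 1 / 400 * E := by
  have h7 : 1 / (1 + y) ≤ 1 - y / 40 + (y / 40) ^ 2 := by
    rw [div_le_iff₀ (by linarith)]
    have : 0 ≤ y * (y ^ 2 - 39 * y + 1560) := mul_nonneg hy (by nlinarith [sq_nonneg (y - 39 / 2)])
    nlinarith
  nlinarith

theorem one_sub_div_pow_le {A U n : ℝ} {u : ℕ} (hu : (u : ℝ) = U) (hn : 0 < n) (hn1 : 1 ≤ n)
    (hA0 : 0 < A) (hAn : 64 * A ≤ n) (hUn : n ≤ 2 * U) :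
    (1 - A / n / n) ^ u ≤ 1 - 2 / 5 * (A / n) := by
  have hw1 : A / n ≤ 1 / 64 := by rw [div_le_iff₀ hn]; linarith
  have hw0 : 0 ≤ A / n := by positivity
  generalize A / n = w' at *
  have hz0 : 0 ≤ w' / n := by positivity
  have hz1 : w' / n ≤ 1 := by rw [div_le_one hn]; linarith
  have h6 : (1 - w' / n) ^ u ≤ Real.exp (-(U * (w' / n))) := by
    rw [← hu, ← mul_neg, Real.exp_nat_mul]
    refine pow_le_pow_left₀ (by linarith) ?_ u
    have := Real.add_one_le_exp (-(w' / n))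
    linarith
  have h7 : w' / 2 ≤ U * (w' / n) := by
    rw [← mul_div_assoc, le_div_iff₀ hn]
    nlinarith
  have h8 : Real.exp (-(U * (w' / n))) ≤ Real.exp (-(w' / 2)) :=
    Real.exp_le_exp.2 (by linarith)
  have h9 := (abs_le.1 (Real.abs_exp_sub_one_sub_id_le (x := -(w' / 2))
    (by rw [abs_neg, abs_of_nonneg (by linarith)]; linarith))).2
  nlinarith

theorem card_pullers_le (x : Fin n → NodeState H) : (pullers x).card ≤ n := by
  have := Finset.card_le_univ (pullers x)
  rwa [Fintype.card_fin] at this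

theorem card_suppliers_le (x : Fin n → NodeState H) : (suppliers x).card ≤ n := by
  have := Finset.card_le_univ (suppliers x)
  rwa [Fintype.card_fin] at this

theorem countP_toList_sum_pushes (a : Fin n → Action H) :
    (((∑ v, (a v).pushes).toList : List (Msg H)) : Multiset (Msg H)).countP
      (fun m => (Msg.orig? m).isSome) = ∑ v, Multiset.card (origs (a v).pushes) := by
  rw [Multiset.coe_toList, ← Multiset.coe_countPAddMonoidHom, map_sum]
  refine Finset.sum_congr rfl fun v _ => ?_
  rw [Multiset.coe_countPAddMonoidHom, origs, card_filterMap_eq_countP]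

/-- Whether a node receives a message `(h, 0)`. -/
def hit (inbox : Fin n → Multiset (Msg H)) (v : Fin n) : ℝ≥0∞ :=
  if 0 < (inbox v).countP (fun m => (Msg.orig? m).isSome) then 1 else 0

theorem suppliers_div_add {e : Execution n H} :
    ((suppliers e.config).card : ℝ≥0∞) / n =
        ENNReal.ofReal ((suppliers e.config).card / n) ∧
      ((suppliers e.config).card : ℝ≥0∞) / n +
        ENNReal.ofReal (1 - (suppliers e.config).card / n) = 1 := by
  have hn : (0 : ℝ) < n := by exact_mod_cast Nat.pos_of_ne_zero (NeZero.ne n)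
  have h1 : ((suppliers e.config).card : ℝ≥0∞) / n =
      ENNReal.ofReal ((suppliers e.config).card / n) := by
    rw [ENNReal.ofReal_div_of_pos hn, ENNReal.ofReal_natCast, ENNReal.ofReal_natCast]
  have h2 : ((suppliers e.config).card : ℝ) / n ≤ 1 := by
    rw [div_le_one hn]
    exact_mod_cast card_suppliers_le e.config
  refine ⟨h1, ?_⟩
  rw [h1, ← ENNReal.ofReal_add (by positivity) (by linarith)]
  simp

/-- While many nodes are in the pull phase, every node receives a message `(h, 0)` with a
probability of the order of the fraction of suppliers. -/
theorem le_expect_hit {e : Execution n H}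
    (hx : ∀ v, (e.config v).output = none) (hM : ∀ v, Multiset.card (e.config v).known ≤ M)
    (hinv : EntryInv f P t e.config) (hpos : 0 < (suppliers e.config).card)
    (hsup : 64 * (suppliers e.config).card ≤ n) (hpull : n ≤ 2 * (pullers e.config).card)
    (v : Fin n) :
    ENNReal.ofReal (2 / 5 * ((suppliers e.config).card / n)) ≤
      expect (indep n fun v => act f P t e.config (e.config v)) fun a =>
        expect (scatter (∑ v, (a v).pushes).toList) fun inbox => hit inbox v := by
  have hn0 : n ≠ 0 := NeZero.ne n
  have hn : (0 : ℝ) < n := by exact_mod_cast Nat.pos_of_ne_zero hn0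
  have hn1 : (1 : ℝ) ≤ n := by exact_mod_cast Nat.pos_of_ne_zero hn0
  obtain ⟨hq1, hqq⟩ := suppliers_div_add (e := e)
  have hA0 : (0 : ℝ) < (suppliers e.config).card := by exact_mod_cast hpos
  have hAn : 64 * ((suppliers e.config).card : ℝ) ≤ n := by exact_mod_cast hsup
  have hUn : (n : ℝ) ≤ 2 * (pullers e.config).card := by exact_mod_cast hpull
  have hgen := expect_act_pow_sum_origs hx hM hinv hqq rfl (ENNReal.ofReal (((n : ℝ) - 1) / n))
  have hpow := one_sub_div_pow_le rfl hn hn1 hA0 hAn hUn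
  rw [hq1] at hgen
  generalize ((suppliers e.config).card : ℝ) = A at *
  generalize (pullers e.config).card = U at *
  have hAn1 : A / n ≤ 1 / 64 := by rw [div_le_iff₀ hn]; linarith
  have hAn0 : 0 < A / n := by positivity
  have h1 : ∀ a : Fin n → Action H,
      expect (scatter (∑ v, (a v).pushes).toList) (fun inbox => hit inbox v) +
        ENNReal.ofReal (((n : ℝ) - 1) / n) ^ (∑ v, Multiset.card (origs (a v).pushes)) = 1 := by
    intro a
    have h2 := expect_scatter_pow (fun m : Msg H => (Msg.orig? m).isSome) v 0
      (∑ v, (a v).pushes).toList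
    have h3 : (((n - 1 : ℕ) : ℝ≥0∞) + 0) / n = ENNReal.ofReal (((n : ℝ) - 1) / n) := by
      rw [add_zero, ENNReal.ofReal_div_of_pos hn, ENNReal.ofReal_natCast,
        ← Nat.cast_pred (Nat.pos_of_ne_zero hn0), ENNReal.ofReal_natCast]
    rw [countP_toList_sum_pushes, h3] at h2
    rw [← h2, ← expect_add]
    conv_rhs => rw [← expect_const (scatter (n := n) (∑ v, (a v).pushes).toList) 1]
    refine expect_congr_support fun inbox _ => ?_
    rw [hit]
    rcases Nat.eq_zero_or_pos ((inbox v).countP fun m => (Msg.orig? m).isSome) with h | h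
    · simp [h]
    · simp [h, h.ne']
  have h4 : expect (indep n fun v => act f P t e.config (e.config v)) (fun a =>
      expect (scatter (∑ v, (a v).pushes).toList) fun inbox => hit inbox v) +
      ENNReal.ofReal ((1 - A / n / n) ^ U) = 1 := by
    have h6 : ENNReal.ofReal (A / n) * ENNReal.ofReal (((n : ℝ) - 1) / n) +
        ENNReal.ofReal (1 - A / n) = ENNReal.ofReal (1 - A / n / n) := by
      rw [← ENNReal.ofReal_mul hAn0.le, ← ENNReal.ofReal_add
        (mul_nonneg hAn0.le (div_nonneg (by linarith) hn.le)) (by linarith)]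
      congr 1
      rw [sub_div, div_self hn.ne']
      ring
    have h7 : 0 ≤ 1 - A / n / n := by
      have : A / n / n ≤ 1 := by
        rw [div_le_one hn]; linarith
      linarith
    rw [h6, ← ENNReal.ofReal_pow h7] at hgen
    rw [← hgen, ← expect_add,
      ← expect_const (indep n fun v => act f P t e.config (e.config v)) 1]
    exact expect_congr_support fun a _ => h1 a
  refine (ENNReal.add_le_add_iff_right (a := ENNReal.ofReal ((1 - A / n / n) ^ U))
    ENNReal.ofReal_ne_top).1 ?_
  rw [h4]
  refine (add_le_add_right (ENNReal.ofReal_le_ofReal hpow) _).trans ?_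
  rw [← ENNReal.ofReal_add (by linarith) (by linarith)]
  simp

theorem expect_one_add_inv_pow_sum_origs_le {e : Execution n H}
    (hx : ∀ v, (e.config v).output = none) (hM : ∀ v, Multiset.card (e.config v).known ≤ M)
    (hinv : EntryInv f P t e.config) (hpos : 0 < (suppliers e.config).card) :
    expect (indep n fun v => act f P t e.config (e.config v))
      (fun a => ENNReal.ofReal (1 + 1 / (suppliers e.config).card) ^
        ∑ v, Multiset.card (origs (a v).pushes)) ≤ ENNReal.ofReal 2.7182818286 := by
  have hn : (0 : ℝ) < n := by exact_mod_cast Nat.pos_of_ne_zero (NeZero.ne n)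
  obtain ⟨hq1, hqq⟩ := suppliers_div_add (e := e)
  have hA0 : (0 : ℝ) < (suppliers e.config).card := by exact_mod_cast hpos
  have hAn : ((suppliers e.config).card : ℝ) ≤ n := by exact_mod_cast card_suppliers_le e.config
  have hUle : ((pullers e.config).card : ℝ) ≤ n := by exact_mod_cast card_pullers_le e.config
  rw [expect_act_pow_sum_origs hx hM hinv hqq rfl, hq1]
  generalize ((suppliers e.config).card : ℝ) = A at *
  generalize (pullers e.config).card = U at *
  have hAn1 : A / n ≤ 1 := by rw [div_le_one hn]; linarith
  rw [← ENNReal.ofReal_mul (by positivity),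
    ← ENNReal.ofReal_add (by positivity) (by linarith), ← ENNReal.ofReal_pow
    (add_nonneg (by positivity) (by linarith))]
  refine ENNReal.ofReal_le_ofReal ?_
  have h1 : A / n * (1 + 1 / A) + (1 - A / n) = 1 / n + 1 := by
    rw [mul_add, div_mul_div_comm, mul_comm (n : ℝ) A, mul_one, mul_one, ← div_div,
      div_self hA0.ne']
    ring
  have h2 : (1 / (n : ℝ) + 1) ^ U ≤ Real.exp 1 := by
    refine (pow_le_pow_left₀ (by positivity) (Real.add_one_le_exp _) U).trans ?_
    rw [← Real.exp_nat_mul]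
    refine Real.exp_le_exp.2 ?_
    rw [mul_one_div, div_le_one hn]
    exact hUle
  rw [h1]
  exact h2.trans Real.exp_one_lt_d9.le

/-- If `y` is the relative growth of the set of suppliers, the potential drops by the factor
`1 / (1 + y) ≤ 1 - y / 40 + (y / 40) ^ 2`. The linear term is the sum of `hit` on the left-hand side,
the quadratic one is bounded by the generating function of the number of messages `(h, 0)`. -/
theorem expect_pullPot_add_hit_le {e : Execution n H}
    (hx : ∀ v, (e.config v).output = none) (hM : ∀ v, Multiset.card (e.config v).known ≤ M)
    (hinv : EntryInv f P t e.config) (hpos : 0 < (suppliers e.config).card)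
    {a : Fin n → Action H}
    (ha : a ∈ (indep n fun v => act f P t e.config (e.config v)).support)
    {inbox : Fin n → Multiset (Msg H)} (hi : inbox ∈ (scatter (∑ v, (a v).pushes).toList).support) :
    expect (indep n fun v => receive f P t (a v).state (inbox v)) pullPot +
      ENNReal.ofReal ((pullers e.config).card / (suppliers e.config).card *
        (1 / (40 * (suppliers e.config).card))) * ∑ v ∈ (suppliers e.config)ᶜ, hit inbox v ≤
      ENNReal.ofReal ((pullers e.config).card / (suppliers e.config).card) +
        ENNReal.ofReal ((pullers e.config).card / (suppliers e.config).card * (1 / 400)) *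
          ENNReal.ofReal (1 + 1 / (suppliers e.config).card) ^
            ∑ v, Multiset.card (origs (a v).pushes) := by
  obtain ⟨N, hN⟩ : ∃ N, N = ((suppliers e.config)ᶜ.filter fun v =>
    0 < (inbox v).countP fun m => (Msg.orig? m).isSome).card := ⟨_, rfl⟩
  have hNsum : ∑ v ∈ (suppliers e.config)ᶜ, hit inbox v = N := by
    rw [hN]
    simp only [hit, Finset.sum_boole]
  have hNS : N ≤ ∑ v, Multiset.card (origs (a v).pushes) := by
    have h1 : ∑ v, Multiset.card (origs (a v).pushes) =
        ∑ v, (inbox v).countP fun m => (Msg.orig? m).isSome := by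
      rw [← countP_toList_sum_pushes a, ← sum_of_mem_support_scatter hi,
        ← Multiset.coe_countPAddMonoidHom, map_sum]
    rw [h1, hN, Finset.card_eq_sum_ones]
    refine (Finset.sum_le_sum (g := fun v => (inbox v).countP fun m => (Msg.orig? m).isSome)
      fun v hv => ?_).trans (Finset.sum_le_sum_of_subset (Finset.subset_univ _))
    exact (Finset.mem_filter.1 hv).2
  have hrec : expect (indep n fun v => receive f P t (a v).state (inbox v)) pullPot ≤
      ENNReal.ofReal ((pullers e.config).card / ((suppliers e.config).card + N)) := by
    refine expect_le_of_le fun x' hc => ?_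
    have hs := stepData hx hM hinv.iter_lt ha hi hc
    have h1 : (suppliers e.config).card + N ≤ (suppliers x').card := by
      rw [hN, ← Finset.card_union_of_disjoint]
      · refine Finset.card_le_card (Finset.union_subset hs.suppliers_subset fun v hv => ?_)
        have h2 := (Finset.mem_filter.1 hv).2
        simp only [suppliers, Finset.mem_filter, Finset.mem_univ, true_and]
        rw [hs.orig_eq]
        intro h3
        have h4 := (add_eq_zero.1 h3).2
        rw [← card_filterMap_eq_countP] at h2
        change 0 < Multiset.card (origs (inbox v)) at h2
        rw [h4] at h2
        simp at h2
      · rw [Finset.disjoint_left]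
        intro v hv hv'
        exact (Finset.mem_compl.1 (Finset.mem_filter.1 hv').1) hv
    unfold pullPot
    rw [ENNReal.ofReal_div_of_pos (by positivity), ENNReal.ofReal_natCast]
    refine ENNReal.div_le_div (Nat.cast_le.2 (Finset.card_le_card hs.pullers_subset)) ?_
    have : (((suppliers e.config).card : ℝ) + N) = (((suppliers e.config).card + N : ℕ) : ℝ) := by
      push_cast; ring
    rw [this, ENNReal.ofReal_natCast]
    exact_mod_cast h1
  have hsq := sq_le_four_mul_one_add_inv_pow hpos (∑ v, Multiset.card (origs (a v).pushes))
  have hA0 : (0 : ℝ) < (suppliers e.config).card := by exact_mod_cast hpos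
  have hU0 : (0 : ℝ) ≤ (pullers e.config).card := by positivity
  rw [hNsum]
  refine (add_le_add_left hrec _).trans ?_
  generalize (∑ v, Multiset.card (origs (a v).pushes)) = S at *
  generalize ((suppliers e.config).card : ℝ) = A at *
  generalize ((pullers e.config).card : ℝ) = U at *
  rw [← ENNReal.ofReal_natCast N, ← ENNReal.ofReal_mul (by positivity),
    ← ENNReal.ofReal_pow (by positivity), ← ENNReal.ofReal_mul (by positivity),
    ← ENNReal.ofReal_add (by positivity) (by positivity),
    ← ENNReal.ofReal_add (by positivity) (by positivity)]
  refine ENNReal.ofReal_le_ofReal ?_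
  have hNS' : (N : ℝ) ≤ S := by exact_mod_cast hNS
  have hy0 : 0 ≤ (N : ℝ) / A := by positivity
  have hy2 : ((N : ℝ) / A) ^ 2 ≤ 4 * (1 + 1 / A) ^ S := by
    refine le_trans (pow_le_pow_left₀ hy0 ?_ 2) hsq
    exact div_le_div_of_nonneg_right hNS' hA0.le
  have h5 : U / (A + N) = U / A * (1 / (1 + N / A)) := by
    rw [div_mul_div_comm, mul_one, mul_add, mul_one, mul_div_cancel₀ _ hA0.ne']
  have h6 : U / A * (1 / (40 * A)) * N = U / A * ((N / A) / 40) := by ring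
  have h8 := mul_le_mul_of_nonneg_left (one_div_one_add_add_le hy0 hy2)
    (show 0 ≤ U / A by positivity)
  rw [h5, h6, ← mul_add]
  refine h8.trans (le_of_eq ?_)
  ring

theorem expect_add_const_mul_sum_hit {x : Fin n → NodeState H} (c : ℝ≥0∞) (s : Finset (Fin n)) :
    expect (indep n fun v => act f P t x (x v)) (fun a =>
        expect (scatter (∑ v, (a v).pushes).toList) fun inbox =>
          expect (indep n fun v => receive f P t (a v).state (inbox v)) pullPot) +
      c * ∑ v ∈ s, expect (indep n fun v => act f P t x (x v)) (fun a =>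
        expect (scatter (∑ v, (a v).pushes).toList) fun inbox => hit inbox v) =
    expect (indep n fun v => act f P t x (x v)) (fun a =>
      expect (scatter (∑ v, (a v).pushes).toList) fun inbox =>
        (expect (indep n fun v => receive f P t (a v).state (inbox v)) pullPot +
          c * ∑ v ∈ s, hit inbox v)) := by
  simp only [expect_add, expect_const_mul, expect_sum]

/-- While there are few suppliers but many nodes in the pull phase, the number of suppliers grows
geometrically: its inverse drops by a constant factor in expectation. -/
theorem expect_step_pullPot_le_of_few {e : Execution n H}
    (hx : ∀ v, (e.config v).output = none) (hM : ∀ v, Multiset.card (e.config v).known ≤ M)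
    (hinv : EntryInv f P t e.config) (hpos : 0 < (suppliers e.config).card)
    (hsup : 64 * (suppliers e.config).card ≤ n) (hpull : n ≤ 2 * (pullers e.config).card) :
    expect (step f P t e) (fun e' => pullPot e'.config) ≤
      ENNReal.ofReal (399 / 400) * pullPot e.config := by
  have hn : (0 : ℝ) < n := by exact_mod_cast Nat.pos_of_ne_zero (NeZero.ne n)
  have hA0 : (0 : ℝ) < (suppliers e.config).card := by exact_mod_cast hpos
  have hAn : 64 * ((suppliers e.config).card : ℝ) ≤ n := by exact_mod_cast hsup
  have hpt := fun a ha inbox hi => expect_pullPot_add_hit_le (a := a) (inbox := inbox) hx hM hinv hpos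
    ha hi
  have hhitE := le_expect_hit hx hM hinv hpos hsup hpull
  have hgen := expect_one_add_inv_pow_sum_origs_le hx hM hinv hpos
  rw [expect_step e pullPot]
  have hpot : pullPot e.config =
      ENNReal.ofReal ((pullers e.config).card / (suppliers e.config).card) := by
    rw [pullPot, ENNReal.ofReal_div_of_pos hA0, ENNReal.ofReal_natCast, ENNReal.ofReal_natCast]
  have hU0 : (0 : ℝ) ≤ (pullers e.config).card := by positivity
  have hcompl : (((suppliers e.config)ᶜ.card : ℕ) : ℝ≥0∞) =
      ENNReal.ofReal (n - (suppliers e.config).card) := by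
    rw [Finset.card_compl, Fintype.card_fin, ← ENNReal.ofReal_natCast,
      Nat.cast_sub (card_suppliers_le e.config)]
  rw [hpot]
  generalize hs : (suppliers e.config)ᶜ = s at *
  generalize ((suppliers e.config).card : ℝ) = A at *
  generalize ((pullers e.config).card : ℝ) = U at *
  have hUA : 0 ≤ U / A := by positivity
  have hlow : ENNReal.ofReal (U / A * (63 / 6400)) ≤
      ENNReal.ofReal (U / A * (1 / (40 * A))) * ∑ v ∈ s,
          expect (indep n fun v => act f P t e.config (e.config v)) fun a =>
            expect (scatter (∑ v, (a v).pushes).toList) fun inbox => hit inbox v := by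
    refine le_trans ?_ (mul_le_mul_right (Finset.sum_le_sum fun v _ => hhitE v) _)
    rw [Finset.sum_const, nsmul_eq_mul, hcompl, ← ENNReal.ofReal_mul (by linarith),
      ← ENNReal.ofReal_mul (by positivity)]
    refine ENNReal.ofReal_le_ofReal ?_
    rw [mul_assoc]
    refine mul_le_mul_of_nonneg_left ?_ hUA
    have : 1 / (40 * A) * ((n - A) * (2 / 5 * (A / n))) = (n - A) / (100 * n) := by
      field_simp; ring
    rw [this, div_le_div_iff₀ (by norm_num) (by positivity)]
    nlinarith
  have hsum := (add_le_add_right hlow _).trans ((expect_add_const_mul_sum_hit (f := f) (P := P)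
    (t := t) (x := e.config) (ENNReal.ofReal (U / A * (1 / (40 * A)))) s).le.trans
      (expect_mono_support fun a ha => expect_le_of_le fun inbox hi => hpt a ha inbox hi))
  rw [expect_add, expect_const, expect_const_mul] at hsum
  rw [← ENNReal.ofReal_mul (by norm_num)]
  refine (ENNReal.add_le_add_iff_right (a := ENNReal.ofReal (U / A * (63 / 6400)))
    ENNReal.ofReal_ne_top).1 (hsum.trans ((add_le_add_right (mul_le_mul_right hgen _) _).trans ?_))
  rw [← ENNReal.ofReal_mul (by positivity),
    ← ENNReal.ofReal_add (by positivity) (by positivity),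
    ← ENNReal.ofReal_add (by positivity) (by positivity)]
  refine ENNReal.ofReal_le_ofReal ?_
  nlinarith

/-- In the pull phase the ratio of nodes without and with original elements drops by a constant
factor in expectation. -/
theorem expect_step_pullPot_le {e : Execution n H}
    (hx : ∀ v, (e.config v).output = none) (hM : ∀ v, Multiset.card (e.config v).known ≤ M)
    (hinv : EntryInv f P t e.config) (hpos : 0 < (suppliers e.config).card)
    (hsup : n ≤ 2 * ∑ v, Multiset.card (e.config v).orig → n ≤ 64 * (suppliers e.config).card)
    (hpull : n ≤ (∑ v, Multiset.card (e.config v).orig) + (pullers e.config).card) :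
    expect (step f P t e) (fun e' => pullPot e'.config) ≤
      ENNReal.ofReal (399 / 400) * pullPot e.config := by
  by_cases h : n ≤ 64 * (suppliers e.config).card
  · have hA : ((suppliers e.config).card : ℝ≥0∞) ≠ 0 := by exact_mod_cast hpos.ne'
    calc _ ≤ expect (step f P t e) (fun e' => ((pullers e'.config).card : ℝ≥0∞) *
          ((suppliers e.config).card : ℝ≥0∞)⁻¹) := by
          refine expect_mono_support fun e' he' => ?_
          obtain ⟨a, ha, inbox, hi, hc, -⟩ := mem_support_step he'
          have hs := stepData hx hM hinv.iter_lt ha hi hc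
          rw [pullPot, div_eq_mul_inv]
          refine mul_le_mul_right (ENNReal.inv_le_inv.2 ?_) _
          exact_mod_cast Finset.card_le_card hs.suppliers_subset
      _ ≤ ENNReal.ofReal (63 / 64) * (pullers e.config).card *
          ((suppliers e.config).card : ℝ≥0∞)⁻¹ := by
          rw [expect_mul_const]
          exact mul_le_mul_left (expect_step_card_pullers hx hM hinv h) _
      _ ≤ _ := by
          rw [mul_assoc, pullPot, div_eq_mul_inv]
          exact mul_le_mul_left (ENNReal.ofReal_le_ofReal (by norm_num)) _
  · refine expect_step_pullPot_le_of_few hx hM hinv hpos (by omega) ?_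
    have : ¬ n ≤ 2 * ∑ v, Multiset.card (e.config v).orig := fun h' => h (hsup h')
    omega

end pullPhase

/-! ### The growth of the number of copies of an optimal basis -/

section growth

variable {n : ℕ} [NeZero n] {H : Type u} {T : Type v} [Fintype H] [LinearOrder H] [LinearOrder T]
  {f : Finset H → T} {P : Params} {t M : ℕ}

/-- The number of copies of `h` in all nodes. -/
def total (x : Fin n → NodeState H) (h : H) : ℕ := ∑ v, (x v).known.count h

/-- Some node has a triple with an optimal basis, or has stopped. The second alternative is
needed because a node that stops deletes the triple that it outputs. -/
def Found (f : Finset H → T) (x : Fin n → NodeState H) : Prop :=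
  ∃ v, (x v).output ≠ none ∨ ∃ e ∈ (x v).entries, f e.basis = f Finset.univ

/-- An optimal triple survives an iteration unless it makes its node stop. -/
theorem StepData.exists_optimal (hf : IsLPType f) {x x' : Fin n → NodeState H}
    {a : Fin n → Action H} {inbox : Fin n → Multiset (Msg H)} (hinv : EntryInv f P t x)
    (hs : StepData f P t M x a inbox x') {v : Fin n} {e : Entry H}
    (he : e ∈ (a v).state.entries) (hopt : f e.basis = f Finset.univ) :
    (x' v).output ≠ none ∨
      ∃ e' ∈ (x' v).entries, e'.iter = e.iter ∧ f e'.basis = f Finset.univ := by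
  have hbest : ∀ {m : Entry H}, basisKey f e ≤ basisKey f m → f m.basis = f Finset.univ :=
    fun h => le_antisymm (hf.monotone _ _ (Finset.subset_univ _))
      (hopt ▸ value_le_of_basisKey_le h)
  by_cases hi : t + 1 ≤ e.iter + P.ct * P.L
  · obtain ⟨e', he', hi', hk, _⟩ := hs.exists_target (Or.inl he) hi
    exact Or.inr ⟨e', he', hi', hbest hk⟩
  · left
    obtain ⟨cp, _, h⟩ := hs.receive v
    have hmem : e ∈ (a v).state.entries ∪ (triples (inbox v)).toFinset :=
      Finset.mem_union_left _ he
    obtain ⟨m, hm, hmi, hmk⟩ := exists_mem_mergeEntries (f := f) hmem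
    have hmo := hbest (basisKey_le_of_key_le hmk)
    have hu : ∃ u, m ∈ (a u).state.entries := by
      rcases Finset.mem_union.1 (Finset.mem_filter.1 hm).1 with h1 | h1
      · exact ⟨v, h1⟩
      · exact hs.exists_mem_of_mem_triples (Multiset.mem_toFinset.1 h1)
    obtain ⟨u, hu⟩ := hu
    have hval : ∀ K : Finset H, (m.check f K).valid = true := fun K =>
      check_valid.2 ⟨(hinv.action hf hs u m hu).2.2 hmo,
        not_lt.2 (hmo ▸ hf.monotone _ _ (Finset.subset_univ _))⟩
    obtain ⟨B, hB⟩ := terminate_output_isSome (P := P) (t := t + 1)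
      (σ := { (a v).state with orig := (a v).state.orig + origs (inbox v), copies := cp })
      hm (by omega) (hval _)
    rw [h, hB]
    simp

theorem StepData.found (hf : IsLPType f) {x x' : Fin n → NodeState H}
    {a : Fin n → Action H} {inbox : Fin n → Multiset (Msg H)} (hinv : EntryInv f P t x)
    (hs : StepData f P t M x a inbox x') {v : Fin n} {e : Entry H}
    (he : e ∈ (a v).state.entries) (hopt : f e.basis = f Finset.univ) : Found f x' :=
  ⟨v, (hs.exists_optimal hf hinv he hopt).imp_right fun ⟨e', he', _, h⟩ => ⟨e', he', h⟩⟩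

/-- The geometric mean of `1 / √X`, where `X` ranges over the numbers of copies of the elements
of `B`. -/
def meanPot (B : Finset H) (x : Fin n → NodeState H) : ℝ :=
  ∏ h ∈ B, √(1 / (total x h)) ^ (1 / (B.card : ℝ))

open Classical in
/-- The geometric mean of `1 / √X`, where `X` ranges over the numbers of copies of the elements
of `B`, as long as no optimal triple exists. -/
def growthPot (f : Finset H → T) (B : Finset H) (x : Fin n → NodeState H) : ℝ≥0∞ :=
  if Found f x then 0 else ENNReal.ofReal (meanPot B x)

theorem meanPot_le_one {B : Finset H} {x : Fin n → NodeState H} : meanPot B x ≤ 1 := by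
  refine Finset.prod_le_one (fun h _ => by positivity) fun h _ => ?_
  refine Real.rpow_le_one (Real.sqrt_nonneg _) ?_ (by positivity)
  refine Real.sqrt_le_one.2 ?_
  rcases Nat.eq_zero_or_pos (total x h) with h0 | h0
  · simp [h0]
  · rw [div_le_one (by exact_mod_cast h0)]
    exact_mod_cast h0

theorem total_le {x : Fin n → NodeState H} (hM : ∀ v, Multiset.card (x v).known ≤ M) (h : H) :
    total x h ≤ n * M := by
  refine (Finset.sum_le_sum fun v _ => (Multiset.count_le_card h _).trans (hM v)).trans ?_
  simp

theorem inv_le_meanPot {B : Finset H} (hB : B.Nonempty) {x : Fin n → NodeState H}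
    (hM : ∀ v, Multiset.card (x v).known ≤ M) (hMn : M ≤ n) (hX : ∀ h ∈ B, 1 ≤ total x h) :
    1 / (n : ℝ) ≤ meanPot B x := by
  have hn : (0 : ℝ) < n := by exact_mod_cast Nat.pos_of_ne_zero (NeZero.ne n)
  have hB0 : (B.card : ℝ) ≠ 0 := by exact_mod_cast hB.card_pos.ne'
  have h1 : ∀ h ∈ B, (1 / (n : ℝ)) ^ (1 / (B.card : ℝ)) ≤
      √(1 / (total x h)) ^ (1 / (B.card : ℝ)) := by
    intro h hh
    refine Real.rpow_le_rpow (by positivity) ?_ (by positivity)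
    refine Real.le_sqrt_of_sq_le ?_
    have h2 : (total x h : ℝ) ≤ n ^ 2 := by
      have := (total_le hM h).trans (Nat.mul_le_mul_left n hMn)
      rw [sq]
      exact_mod_cast this
    have h3 : (0 : ℝ) < total x h := by exact_mod_cast hX h hh
    rw [div_pow, one_pow]
    exact one_div_le_one_div_of_le h3 h2
  refine le_trans ?_ (Finset.prod_le_prod (fun _ _ => by positivity) h1)
  rw [Finset.prod_const, ← Real.rpow_natCast, ← Real.rpow_mul (by positivity),
    one_div_mul_cancel hB0, Real.rpow_one]

/-- The arithmetic-geometric mean inequality for the change of the potential. -/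
theorem meanPot_le {B : Finset H} (hB : B.Nonempty) {x x' : Fin n → NodeState H}
    (hX : ∀ h ∈ B, 1 ≤ total x h) :
    meanPot B x' ≤ meanPot B x * (1 / B.card * ∑ h ∈ B, √(total x h / total x' h)) := by
  have hB0 : (B.card : ℝ) ≠ 0 := by exact_mod_cast hB.card_pos.ne'
  have h1 : meanPot B x' = meanPot B x * ∏ h ∈ B, √(total x h / total x' h) ^ (1 / (B.card : ℝ)) := by
    unfold meanPot
    rw [← Finset.prod_mul_distrib]
    refine Finset.prod_congr rfl fun h hh => ?_
    have h3 : (total x h : ℝ) ≠ 0 := by exact_mod_cast (Nat.one_le_iff_ne_zero.1 (hX h hh))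
    rw [← Real.mul_rpow (Real.sqrt_nonneg _) (Real.sqrt_nonneg _),
      ← Real.sqrt_mul (by positivity)]
    congr 2
    field_simp
  rw [h1]
  refine mul_le_mul_of_nonneg_left ?_ (Finset.prod_nonneg fun _ _ => by positivity)
  refine (Real.geom_mean_le_arith_mean_weighted B (fun _ => 1 / (B.card : ℝ))
    (fun h => √(total x h / total x' h)) (fun _ _ => by positivity) ?_
    fun _ _ => Real.sqrt_nonneg _).trans (le_of_eq ?_)
  · rw [Finset.sum_const, nsmul_eq_mul, mul_one_div_cancel hB0]
  · rw [Finset.mul_sum]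

theorem expect_receive_count {σ : NodeState H} (hσ : σ.output = none) (m : Multiset (Msg H))
    (h : H) (g : ℕ → ℝ≥0∞) :
    expect (receive f P t σ m) (fun σ' => g (σ'.copies.count h)) =
      binom (keepProb P.d) ((σ.copies + elems m).count h) g := by
  rw [receive_of_output_eq_none hσ, expect_map]
  have := expect_thin_count P.d h (σ.copies + elems m).toList g
  rw [Multiset.coe_toList] at this
  exact this

/-- Given the pushed messages, the inverse of the number of copies of `h` after the filtering. -/
theorem expect_receive_inv_total_le {x : Fin n → NodeState H} (hx : ∀ v, (x v).output = none)
    (hM : ∀ v, Multiset.card (x v).known ≤ M) (hinv : EntryInv f P t x) (hd : 1 ≤ P.d)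
    {h : H} (ho : ∃ v, h ∈ (x v).orig) {a : Fin n → Action H}
    (ha : a ∈ (indep n fun v => act f P t x (x v)).support)
    {inbox : Fin n → Multiset (Msg H)} (hi : inbox ∈ (scatter (∑ v, (a v).pushes).toList).support) :
    expect (indep n fun v => receive f P t (a v).state (inbox v))
        (fun x' => ((total x' h : ℕ) : ℝ≥0∞)⁻¹) ≤
      ((keepProb P.d : ℝ≥0∞) * ((total x h + ∑ v, (elems (a v).pushes).count h : ℕ) : ℝ≥0∞))⁻¹ := by
  have hact : ∀ v, ActionSpec f P t n M (x v) (a v) := fun v =>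
    actionSpec hx (hx v) hM (hinv.iter_lt v) (mem_support_indep ha v)
  have hκ : (keepProb P.d : ℝ≥0∞) ≤ 1 := by exact_mod_cast keepProb_le_one P.d
  have hκ0 : (keepProb P.d : ℝ≥0∞) ≠ 0 := by
    have h1 := coe_keepProb hd
    have h2 : (0 : ℝ) < P.d := by exact_mod_cast hd
    have h3 : (0 : ℝ) < keepProb P.d := by rw [h1]; positivity
    exact_mod_cast h3.ne'
  have hU : ∑ v, (elems (inbox v)).count h = ∑ v, (elems (a v).pushes).count h := by
    have h1 : (elems (∑ v, inbox v)).count h = (elems (∑ v, (a v).pushes)).count h := by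
      rw [sum_of_mem_support_scatter hi, Multiset.coe_toList]
    have h2 : ∀ y : Fin n → Multiset (Msg H), (elems (∑ v, y v)).count h =
        ∑ v, (elems (y v)).count h := by
      intro y
      simp only [elems, count_filterMap_eq_countP]
      rw [← Multiset.coe_countPAddMonoidHom, map_sum]
    rwa [h2, h2] at h1
  obtain ⟨o, hodef⟩ : ∃ o, o = ∑ v, ((x v).orig + origs (inbox v)).count h := ⟨_, rfl⟩
  have ho1 : 1 ≤ o := by
    obtain ⟨v, hv⟩ := ho
    rw [hodef]
    refine le_trans ?_ (Finset.single_le_sum (fun _ _ => Nat.zero_le _) (Finset.mem_univ v))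
    rw [Multiset.count_add]
    exact le_add_right (Multiset.one_le_count_iff_mem.2 hv)
  have hE : expect (indep n fun v => receive f P t (a v).state (inbox v))
      (fun x' => ((total x' h : ℕ) : ℝ≥0∞)⁻¹) =
      binom (keepProb P.d) (∑ v, ((a v).state.copies + elems (inbox v)).count h)
        fun s => ((o + s : ℕ) : ℝ≥0∞)⁻¹ := by
    rw [← expect_indep_binom (fun σ : NodeState H => σ.copies.count h) n
      (fun v => receive f P t (a v).state (inbox v)) _
      (fun v g => expect_receive_count (hact v).output (inbox v) h g)]
    refine expect_congr_support fun x' hc => ?_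
    have hs := stepData hx hM hinv.iter_lt ha hi hc
    have : total x' h = o + ∑ v, (x' v).copies.count h := by
      rw [total, hodef, ← Finset.sum_add_distrib]
      refine Finset.sum_congr rfl fun v _ => ?_
      rw [NodeState.known, Multiset.count_add, hs.orig_eq]
    rw [this]
  rw [hE]
  refine (binom_inv_le hκ hκ0 o _ ho1).trans (ENNReal.inv_le_inv.2 (mul_le_mul_right ?_ _))
  refine Nat.cast_le.2 ?_
  rw [hodef, ← hU, total, ← Finset.sum_add_distrib, ← Finset.sum_add_distrib]
  refine Finset.sum_le_sum fun v _ => ?_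
  simp only [NodeState.known, Multiset.count_add, (hact v).copies]
  omega

/-- The decrease of `1 / √X` when `U ≤ X` copies are added and the filtering takes its share. On
`[0, 1]` one has `1 / √(1 + y) ≤ 1 - 29 / 100 * y`. -/
theorem sqrt_inv_keepProb_mul_le {d : ℕ} (hd : 1 ≤ d) {X U : ℝ} (hX : 0 < X) (hU : 0 ≤ U)
    (hUX : U ≤ X) :
    √(X / ((keepProb d : ℝ) * (X + U))) ≤ (1 + 1 / (4 * d)) * (1 - 29 / 100 * (U / X)) := by
  have hd' : (0 : ℝ) < d := by exact_mod_cast hd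
  have hy0 : 0 ≤ U / X := by positivity
  have hy1 : U / X ≤ 1 := by rwa [div_le_one hX]
  have h1 : X / ((keepProb d : ℝ) * (X + U)) = (1 + 1 / (2 * d)) * (1 / (1 + U / X)) := by
    rw [coe_keepProb hd]
    field_simp
  rw [h1]
  generalize U / X = y at *
  refine Real.sqrt_le_iff.2 ⟨mul_nonneg (by positivity) (by linarith), ?_⟩
  rw [mul_pow]
  refine mul_le_mul ?_ ?_ (by positivity) (by positivity)
  · have : (1 + 1 / (4 * (d : ℝ))) ^ 2 = 1 + 1 / (2 * d) + (1 / (4 * d)) ^ 2 := by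
      field_simp; ring
    rw [this]
    nlinarith [sq_nonneg (1 / (4 * (d : ℝ)))]
  · rw [div_le_iff₀ (by linarith)]
    have : 0 ≤ y * ((1 - y) * (41 / 100 - 8 / 100 * y) + 1 / 1000) :=
      mul_nonneg hy0 (add_nonneg (mul_nonneg (by linarith) (by linarith)) (by norm_num))
    nlinarith [mul_nonneg hy0 hy0, mul_nonneg hy0 (sub_nonneg.2 hy1),
      mul_nonneg (mul_nonneg hy0 hy0) (sub_nonneg.2 hy1)]

theorem total_pos {x : Fin n → NodeState H} {h : H} (ho : ∃ v, h ∈ (x v).orig) :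
    1 ≤ total x h := by
  obtain ⟨v, hv⟩ := ho
  refine le_trans ?_ (Finset.single_le_sum (f := fun v => (x v).known.count h)
    (fun _ _ => Nat.zero_le _) (Finset.mem_univ v))
  rw [NodeState.known, Multiset.count_add]
  exact le_add_right (Multiset.one_le_count_iff_mem.2 hv)

/-- The number of copies of `h` grows in proportion to the probability that `h` violates a
sample, up to the loss that is caused by the filtering. -/
theorem expect_step_sqrt_total_le {e : Execution n H}
    (hx : ∀ v, (e.config v).output = none) (hM : ∀ v, Multiset.card (e.config v).known ≤ M)
    (hinv : EntryInv f P t e.config) (hp : ∀ v, (e.config v).pulling = false) (hd : 1 ≤ P.d)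
    {h : H} (ho : ∃ v, h ∈ (e.config v).orig) :
    expect (step f P t e) (fun e' => ENNReal.ofReal √(total e.config h / total e'.config h)) +
      ENNReal.ofReal ((1 + 1 / (4 * P.d)) * (29 / 100)) *
        violProb f P (fun w => (e.config w).known) h ≤
      ENNReal.ofReal (1 + 1 / (4 * P.d)) := by
  have hX1 := total_pos ho
  obtain ⟨X, hX⟩ : ∃ X, X = total e.config h := ⟨_, rfl⟩
  rw [← hX] at hX1 ⊢
  have hX0 : (0 : ℝ) < X := by exact_mod_cast hX1
  obtain ⟨c, hc⟩ : ∃ c : ℝ, c = 1 + 1 / (4 * P.d) := ⟨_, rfl⟩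
  have hc0 : 0 < c := by rw [hc]; positivity
  rw [← hc]
  have hκ : (0 : ℝ) < keepProb P.d := by
    have h2 : (0 : ℝ) < P.d := by exact_mod_cast hd
    rw [coe_keepProb hd]; positivity
  have hpt : ∀ a ∈ (indep n fun v => act f P t e.config (e.config v)).support,
      expect (scatter (∑ v, (a v).pushes).toList) (fun inbox =>
        expect (indep n fun v => receive f P t (a v).state (inbox v))
          fun x' => ENNReal.ofReal √(X / total x' h)) +
        ENNReal.ofReal (c * (29 / 100) / X) * ∑ v, ((elems (a v).pushes).count h : ℝ≥0∞) ≤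
      ENNReal.ofReal c := by
    intro a ha
    obtain ⟨U, hU⟩ : ∃ U, U = ∑ v, (elems (a v).pushes).count h := ⟨_, rfl⟩
    have hUX : U ≤ X := by
      rw [hU, hX]
      refine Finset.sum_le_sum fun v _ => Multiset.count_le_of_le h ?_
      exact (actionSpec hx (hx v) hM (hinv.iter_lt v) (mem_support_indep ha v)).elems
    have hUX' : (U : ℝ) ≤ X := by exact_mod_cast hUX
    have h1 : expect (scatter (∑ v, (a v).pushes).toList) (fun inbox =>
        expect (indep n fun v => receive f P t (a v).state (inbox v))
          fun x' => ENNReal.ofReal √(X / total x' h)) ≤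
        ENNReal.ofReal (c * (1 - 29 / 100 * (U / X))) := by
      refine expect_le_of_le fun inbox hi => ?_
      refine le_trans ?_ (ENNReal.ofReal_le_ofReal
        (hc ▸ sqrt_inv_keepProb_mul_le hd hX0 (Nat.cast_nonneg U) hUX'))
      have hpos : 0 < (X : ℝ) / ((keepProb P.d : ℝ) * (X + U)) := by positivity
      refine expect_sqrt_le (Real.sqrt_pos.2 hpos) (fun _ => by positivity) ?_
      rw [Real.sq_sqrt hpos.le]
      have h2 := expect_receive_inv_total_le hx hM hinv hd ho ha hi
      have h3 : expect (indep n fun v => receive f P t (a v).state (inbox v))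
          (fun x' => ENNReal.ofReal (X / total x' h)) =
          expect (indep n fun v => receive f P t (a v).state (inbox v))
            (fun x' => (X : ℝ≥0∞) * ((total x' h : ℕ) : ℝ≥0∞)⁻¹) := by
        refine expect_congr_support fun x' hc => ?_
        have hs := stepData hx hM hinv.iter_lt ha hi hc
        have h4 : 1 ≤ total x' h := by
          obtain ⟨v, hv⟩ := ho
          refine total_pos ⟨v, ?_⟩
          rw [hs.orig_eq]
          exact Multiset.mem_add.2 (Or.inl hv)
        rw [ENNReal.ofReal_div_of_pos (by exact_mod_cast h4), ENNReal.ofReal_natCast,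
          ENNReal.ofReal_natCast, div_eq_mul_inv]
      rw [h3, expect_const_mul]
      refine (mul_le_mul_right h2 _).trans (le_of_eq ?_)
      rw [ENNReal.ofReal_div_of_pos (by positivity), ENNReal.ofReal_natCast, div_eq_mul_inv,
        ENNReal.ofReal_mul hκ.le, ENNReal.ofReal_coe_nnreal, ← hU, ← hX, ← Nat.cast_add,
        ENNReal.ofReal_natCast]
    refine (add_le_add_left h1 _).trans ?_
    rw [← Nat.cast_sum, ← hU, ← ENNReal.ofReal_natCast U, ← ENNReal.ofReal_mul (by positivity)]
    have hle : 0 ≤ 1 - 29 / 100 * ((U : ℝ) / X) := by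
      have : (U : ℝ) / X ≤ 1 := by rwa [div_le_one hX0]
      linarith
    rw [← ENNReal.ofReal_add (mul_nonneg hc0.le hle) (by positivity)]
    refine ENNReal.ofReal_le_ofReal (le_of_eq ?_)
    ring
  rw [expect_step e fun x' => ENNReal.ofReal √(X / total x' h)]
  have hEU : expect (indep n fun v => act f P t e.config (e.config v))
      (fun a => ∑ v, ((elems (a v).pushes).count h : ℝ≥0∞)) =
      X * violProb f P (fun w => (e.config w).known) h := by
    rw [expect_sum, hX, total, Nat.cast_sum, Finset.sum_mul]
    refine Finset.sum_congr rfl fun v _ => ?_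
    rw [expect_indep_single _ v fun a : Action H => ((elems a.pushes).count h : ℝ≥0∞)]
    exact expect_act_count_elems hx (hx v) (hp v) h
  have h5 : ENNReal.ofReal (c * (29 / 100)) * violProb f P (fun w => (e.config w).known) h =
      ENNReal.ofReal (c * (29 / 100) / X) *
        expect (indep n fun v => act f P t e.config (e.config v))
          (fun a => ∑ v, ((elems (a v).pushes).count h : ℝ≥0∞)) := by
    rw [hEU, ← mul_assoc, ← ENNReal.ofReal_natCast X, ← ENNReal.ofReal_mul (by positivity),
      div_mul_cancel₀ _ hX0.ne']
  rw [h5, ← expect_const_mul, ← expect_add]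
  exact expect_le_of_le hpt

/-- Either a sample is optimal with constant probability, or the copies of an optimal basis
become more. -/
theorem expect_step_growthPot_le (hf : IsLPType f) {e : Execution n H}
    (hx : ∀ v, (e.config v).output = none) (hM : ∀ v, Multiset.card (e.config v).known ≤ M)
    (hinv : EntryInv f P t e.config) (hp : ∀ v, (e.config v).pulling = false) (hd : 1 ≤ P.d)
    (ho : ∀ h, ∃ v, h ∈ (e.config v).orig) (hMn : M ≤ n)
    (hfail : expect (sample P fun w => (e.config w).known)
      (fun q => if q.2 = none then 1 else 0) ≤ ENNReal.ofReal (1 / 20))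
    (hnum : (n : ℝ) * (19 / 20) ^ n ≤ 99 / 100)
    {B : Finset H} (hB : B.Nonempty) (hBf : f B = f Finset.univ) (hBd : B.card ≤ P.d) :
    expect (step f P t e) (fun e' => growthPot f B e'.config) ≤
      ENNReal.ofReal (1 - 1 / (100 * P.d)) * growthPot f B e.config := by
  classical
  have hn0 : n ≠ 0 := NeZero.ne n
  have hn : (0 : ℝ) < n := by exact_mod_cast Nat.pos_of_ne_zero hn0
  have hd0 : (0 : ℝ) < P.d := by exact_mod_cast hd
  have hd1 : (1 : ℝ) ≤ P.d := by exact_mod_cast hd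
  have hX : ∀ h ∈ B, 1 ≤ total e.config h := fun h _ => total_pos (ho h)
  -- An optimal triple that exists already survives, and the potential stays `0`.
  by_cases hfound : Found f e.config
  · refine le_trans (le_of_eq ?_) zero_le
    refine expect_eq_zero fun e' he' => ?_
    obtain ⟨a, ha, inbox, hi, hc, -⟩ := mem_support_step he'
    have hs := stepData hx hM hinv.iter_lt ha hi hc
    obtain ⟨v, h | ⟨e₀, he₀, h⟩⟩ := hfound
    · exact absurd (hx v) h
    · rw [growthPot, if_pos (hs.found hf hinv (hs.entries_subset v he₀) h)]
  have hpot : growthPot f B e.config = ENNReal.ofReal (meanPot B e.config) := by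
    rw [growthPot, if_neg hfound]
  rw [hpot]
  have hΨ0 : 0 ≤ meanPot B e.config := Finset.prod_nonneg fun _ _ => by positivity
  have hd100 : 1 / (100 * (P.d : ℝ)) ≤ 1 / 100 := by
    rw [div_le_div_iff₀ (by positivity) (by norm_num)]; linarith
  -- If a sample is optimal with probability at least `1 / 20`, then with probability at least
  -- `1 - (19 / 20) ^ n` some node creates an optimal triple.
  by_cases hopt : ENNReal.ofReal (1 / 20) ≤ optProb f P fun w => (e.config w).known
  · rw [expect_step e (growthPot f B)]
    calc _ ≤ expect (indep n fun v => act f P t e.config (e.config v)) (fun a =>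
          ∏ v, if ∃ e ∈ (a v).state.entries, e.iter = t ∧ f e.basis = f Finset.univ
            then 0 else 1) := by
          refine expect_mono_support fun a ha => expect_le_of_le fun inbox hi =>
            expect_le_of_le fun x' hc => ?_
          have hs := stepData hx hM hinv.iter_lt ha hi hc
          by_cases h : ∃ v, ∃ e ∈ (a v).state.entries, e.iter = t ∧ f e.basis = f Finset.univ
          · obtain ⟨v, e₀, he₀, -, h₀⟩ := h
            rw [growthPot, if_pos (hs.found hf hinv he₀ h₀)]
            exact zero_le
          · rw [not_exists] at h
            rw [Finset.prod_eq_one fun v _ => if_neg (h v), growthPot]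
            split_ifs
            · exact zero_le
            · exact ENNReal.ofReal_le_one.2 meanPot_le_one
      _ ≤ ∏ _v : Fin n, ENNReal.ofReal (19 / 20) := by
          rw [expect_indep_prod n _ fun _ (a : Action H) =>
            if ∃ e ∈ a.state.entries, e.iter = t ∧ f e.basis = f Finset.univ then 0 else 1]
          refine Finset.prod_le_prod' fun v _ => ?_
          refine (ENNReal.add_le_add_iff_right (a := ENNReal.ofReal (1 / 20))
            ENNReal.ofReal_ne_top).1 ((add_le_add_right hopt _).trans ?_)
          refine (expect_act_no_optimal_add_optProb_le hf hx (hx v) (hp v)).trans (le_of_eq ?_)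
          rw [← ENNReal.ofReal_add (by norm_num) (by norm_num)]
          norm_num
      _ ≤ _ := by
          rw [Finset.prod_const, Finset.card_univ, Fintype.card_fin,
            ← ENNReal.ofReal_pow (by norm_num), ← ENNReal.ofReal_mul (by linarith)]
          refine ENNReal.ofReal_le_ofReal ?_
          have h1 := inv_le_meanPot hB hM hMn hX
          have h2 : ((19 : ℝ) / 20) ^ n ≤ 99 / 100 * (1 / n) := by
            rw [mul_one_div, le_div_iff₀ hn, mul_comm]
            exact hnum
          refine h2.trans (mul_le_mul (by linarith) h1 (by positivity) (by linarith))
  -- Otherwise a sample is violated by an element of `B` with probability at least `9 / 10`. The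
  -- gain `0.29 * 0.9 / d` from the new copies exceeds the loss `1 / (4 d)` from the filtering.
  · rw [not_le] at hopt
    have hm0 : (0 : ℝ) < B.card := by exact_mod_cast hB.card_pos
    have hviol : ENNReal.ofReal (9 / 10) ≤
        ∑ h ∈ B, violProb f P (fun w => (e.config w).known) h := by
      have h1 := one_le_fail_add_optProb_add hf P (fun w => (e.config w).known) hBf
      refine (ENNReal.add_le_add_iff_left (a := ENNReal.ofReal (1 / 20) + ENNReal.ofReal (1 / 20))
        (by finiteness)).1 (le_trans (le_of_eq ?_)
          (h1.trans (add_le_add_left (add_le_add hfail hopt.le) _)))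
      rw [← ENNReal.ofReal_add (by norm_num) (by norm_num),
        ← ENNReal.ofReal_add (by norm_num) (by norm_num)]
      norm_num
    obtain ⟨c, hc⟩ : ∃ c : ℝ, c = 1 + 1 / (4 * P.d) := ⟨_, rfl⟩
    have hc0 : 0 < c := by rw [hc]; positivity
    have hsum : ∑ h ∈ B, expect (step f P t e)
        (fun e' => ENNReal.ofReal √(total e.config h / total e'.config h)) ≤
        ENNReal.ofReal (B.card * c - c * (29 / 100) * (9 / 10)) := by
      have h1 := Finset.sum_le_sum fun h (_ : h ∈ B) =>
        expect_step_sqrt_total_le hx hM hinv hp hd (ho h)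
      rw [← hc, Finset.sum_add_distrib, ← Finset.mul_sum, Finset.sum_const, nsmul_eq_mul] at h1
      have h2 := (add_le_add_right (mul_le_mul_right hviol _) _).trans h1
      rw [← ENNReal.ofReal_mul (by positivity), ← ENNReal.ofReal_natCast,
        ← ENNReal.ofReal_mul (by positivity)] at h2
      have hm1 : (1 : ℝ) ≤ B.card := by exact_mod_cast hB.card_pos
      refine (ENNReal.add_le_add_iff_right (a := ENNReal.ofReal (c * (29 / 100) * (9 / 10)))
        ENNReal.ofReal_ne_top).1 (h2.trans ?_)
      rw [← ENNReal.ofReal_add (by nlinarith) (by positivity)]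
      refine ENNReal.ofReal_le_ofReal (le_of_eq (by ring))
    calc _ ≤ expect (step f P t e) (fun e' => ENNReal.ofReal (meanPot B e.config * (1 / B.card)) *
          ∑ h ∈ B, ENNReal.ofReal √(total e.config h / total e'.config h)) := by
          refine expect_mono fun e' => ?_
          rw [growthPot]
          split_ifs
          · exact zero_le
          · rw [← ENNReal.ofReal_sum_of_nonneg fun _ _ => Real.sqrt_nonneg _,
              ← ENNReal.ofReal_mul (by positivity), mul_assoc]
            exact ENNReal.ofReal_le_ofReal (meanPot_le hB hX)
      _ ≤ ENNReal.ofReal (meanPot B e.config * (1 / B.card)) *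
          ENNReal.ofReal (B.card * c - c * (29 / 100) * (9 / 10)) := by
          rw [expect_const_mul, expect_sum]
          exact mul_le_mul_right hsum _
      _ ≤ _ := by
          rw [← ENNReal.ofReal_mul (by positivity), ← ENNReal.ofReal_mul (by linarith)]
          refine ENNReal.ofReal_le_ofReal ?_
          have hmd : (B.card : ℝ) ≤ P.d := by exact_mod_cast hBd
          have h1 : 1 / (P.d : ℝ) ≤ 1 / B.card := one_div_le_one_div_of_le hm0 hmd
          have h2 : 1 / (B.card : ℝ) * (B.card * c - c * (29 / 100) * (9 / 10)) =
              c * (1 - 261 / 1000 * (1 / B.card)) := by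
            field_simp
            ring
          rw [mul_assoc, h2, mul_comm (1 - _ : ℝ)]
          refine mul_le_mul_of_nonneg_left ?_ hΨ0
          have h3 : c * (1 - 261 / 1000 * (1 / B.card)) ≤ c * (1 - 261 / 1000 * (1 / P.d)) :=
            mul_le_mul_of_nonneg_left (by linarith) hc0.le
          refine h3.trans ?_
          have h4 : c = 1 + 1 / 4 * (1 / P.d) := by rw [hc]; field_simp
          have h5 : 1 / (100 * (P.d : ℝ)) = 1 / 100 * (1 / P.d) := by field_simp
          rw [h4, h5]
          have h6 : 0 < 1 / (P.d : ℝ) := by positivity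
          nlinarith

end growth

/-! ### Killed Markov chains -/

section killed

variable {E : Type*} {p : PMF E} {s : ℕ → E → PMF E} {R : ℕ → E → Prop}

open Classical in
/-- The indicator of a proposition. -/
def indic (Q : Prop) : ℝ≥0∞ := if Q then 1 else 0

theorem indic_of_true {Q : Prop} (h : Q) : indic Q = 1 := if_pos h

theorem indic_of_false {Q : Prop} (h : ¬ Q) : indic Q = 0 := if_neg h

theorem indic_le_one (Q : Prop) : indic Q ≤ 1 := by
  unfold indic
  split_ifs <;> simp

theorem indic_le {Q : Prop} {c : ℝ≥0∞} (h : Q → 1 ≤ c) : indic Q ≤ c := by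
  unfold indic
  split_ifs with hQ
  · exact h hQ
  · exact zero_le

open Classical in
/-- The expectation of `g` at time `k` for the Markov chain with initial law `p` and transitions
`s`, restricted to the event that `R t` has held at all times `t < k`. -/
def killed (p : PMF E) (s : ℕ → E → PMF E) (R : ℕ → E → Prop) : ℕ → (E → ℝ≥0∞) → ℝ≥0∞
  | 0, g => expect p g
  | k + 1, g => killed p s R k fun e => if R k e then expect (s k e) g else 0

theorem killed_mono {g g' : E → ℝ≥0∞} (h : ∀ e, g e ≤ g' e) (k : ℕ) :
    killed p s R k g ≤ killed p s R k g' := by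
  classical
  induction k generalizing g g' with
  | zero => exact expect_mono h
  | succ k ih =>
    refine ih fun e => ?_
    split_ifs
    · exact expect_mono h
    · exact le_rfl

theorem killed_succ_mono {g g' : E → ℝ≥0∞} {k : ℕ}
    (h : ∀ e, R k e → ∀ e' ∈ (s k e).support, g e' ≤ g' e') :
    killed p s R (k + 1) g ≤ killed p s R (k + 1) g' := by
  classical
  refine killed_mono (fun e => ?_) k
  split_ifs with hR
  · exact expect_mono_support (h e hR)
  · exact le_rfl

theorem killed_add (g g' : E → ℝ≥0∞) (k : ℕ) :
    killed p s R k (fun e => g e + g' e) = killed p s R k g + killed p s R k g' := by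
  classical
  induction k generalizing g g' with
  | zero => exact expect_add p g g'
  | succ k ih =>
    simp only [killed]
    rw [← ih]
    congr 1
    funext e
    split_ifs
    · exact expect_add _ g g'
    · simp

theorem killed_const_mul (c : ℝ≥0∞) (g : E → ℝ≥0∞) (k : ℕ) :
    killed p s R k (fun e => c * g e) = c * killed p s R k g := by
  classical
  induction k generalizing g with
  | zero => exact expect_const_mul p c g
  | succ k ih =>
    simp only [killed]
    rw [← ih]
    congr 1
    funext e
    split_ifs
    · exact expect_const_mul _ c g
    · simp

theorem killed_sum {ι : Type*} (σ : Finset ι) (g : ι → E → ℝ≥0∞) (k : ℕ) :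
    killed p s R k (fun e => ∑ i ∈ σ, g i e) = ∑ i ∈ σ, killed p s R k (g i) := by
  classical
  induction σ using Finset.induction_on with
  | empty => simpa using killed_const_mul (p := p) (s := s) (R := R) 0 (fun _ => 0) k
  | insert i σ hi ih =>
    simp only [Finset.sum_insert hi]
    rw [killed_add, ih]

theorem killed_const_le (c : ℝ≥0∞) (k : ℕ) : killed p s R k (fun _ => c) ≤ c := by
  classical
  induction k with
  | zero => exact (expect_const p c).le
  | succ k ih =>
    refine (killed_mono (fun e => ?_) k).trans ih
    split_ifs
    · exact (expect_const _ c).le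
    · exact zero_le

/-- A potential that contracts in expectation while the chain is alive decays geometrically. -/
theorem killed_le_pow_mul {Φ : E → ℝ≥0∞} {c : ℝ≥0∞} {a : ℕ} (j : ℕ)
    (h : ∀ t, a ≤ t → t < a + j → ∀ e, R t e → expect (s t e) Φ ≤ c * Φ e) :
    killed p s R (a + j) Φ ≤ c ^ j * killed p s R a Φ := by
  classical
  induction j with
  | zero => simp
  | succ j ih =>
    have h1 : killed p s R (a + (j + 1)) Φ ≤ killed p s R (a + j) fun e => c * Φ e := by
      refine killed_mono (fun e => ?_) (a + j)
      split_ifs with hR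
      · exact h (a + j) (by omega) (by omega) e hR
      · exact zero_le
    refine h1.trans ?_
    rw [killed_const_mul, pow_succ', mul_assoc]
    exact mul_le_mul_right (ih fun t ht ht' => h t ht (by omega)) c

/-- A potential whose expectation grows by at most `c` per step while the chain is alive. -/
theorem killed_le_add_mul {Φ : E → ℝ≥0∞} {c : ℝ≥0∞}
    (h : ∀ t e, R t e → expect (s t e) Φ ≤ Φ e + c) (k : ℕ) :
    killed p s R k Φ ≤ expect p Φ + k * c := by
  classical
  induction k with
  | zero => simp [killed]
  | succ k ih =>
    have h1 : killed p s R (k + 1) Φ ≤ killed p s R k fun e => Φ e + c := by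
      refine killed_mono (fun e => ?_) k
      split_ifs with hR
      · exact h _ e hR
      · exact zero_le
    refine h1.trans ?_
    rw [killed_add]
    refine (add_le_add ih (killed_const_le c k)).trans (le_of_eq ?_)
    push_cast
    ring

/-- The expectation of an indicator is at most that of a potential which is at least `1 / c` on the
event. -/
theorem killed_indic_le {Q : E → Prop} {Φ : E → ℝ≥0∞} {c b δ : ℝ≥0∞} {k : ℕ}
    (h : killed p s R k Φ ≤ b) (hQ : ∀ e, Q e → 1 ≤ c * Φ e) (hb : c * b ≤ δ) :
    killed p s R k (fun e => indic (Q e)) ≤ δ := by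
  refine le_trans ?_ ((mul_le_mul_right h c).trans hb)
  rw [← killed_const_mul]
  exact killed_mono (fun e => indic_le (hQ e)) k

/-- Decomposition by the first time at which `R` fails, for an absorbing set `D`. -/
theorem expect_not_le_sum_killed {q : ℕ → PMF E} (hq : ∀ k, q (k + 1) = (q k).bind (s k))
    {D : E → Prop} (hD : ∀ t e, D e → ∀ e' ∈ (s t e).support, D e') (k : ℕ) :
    expect (q k) (fun e => indic (¬ D e)) ≤
      ∑ t ∈ Finset.range (k + 1), killed (q 0) s R t (fun e => indic (¬ R t e ∧ ¬ D e)) +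
        killed (q 0) s R k fun e => indic (R k e) := by
  classical
  -- For the induction, the indicator of the complement of `D` is replaced by a function `g` that
  -- vanishes on `D`, a property that is inherited by the conditional expectation of `g`.
  have key : ∀ (k : ℕ) (g : E → ℝ≥0∞), (∀ e, g e ≤ 1) → (∀ e, D e → g e = 0) →
      expect (q k) g ≤ ∑ t ∈ Finset.range k,
        killed (q 0) s R t (fun e => indic (¬ R t e ∧ ¬ D e)) + killed (q 0) s R k g := by
    intro k
    induction k with
    | zero => intro g _ _; simp [killed]
    | succ k ih =>
      intro g hg1 hg0
      rw [hq, expect_bind]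
      refine (ih (fun e => expect (s k e) g) (fun e => expect_le_of_le fun e' _ => hg1 e')
        fun e he => expect_eq_zero fun e' he' => hg0 e' (hD k e he e' he')).trans ?_
      rw [Finset.sum_range_succ, add_assoc]
      refine add_le_add_right ?_ _
      rw [killed, ← killed_add]
      refine killed_mono (fun e => ?_) k
      by_cases hR : R k e
      · simp [hR]
      · by_cases hDe : D e
        · have : expect (s k e) g = 0 := expect_eq_zero fun e' he' => hg0 e' (hD k e hDe e' he')
          simp [this]
        · rw [indic_of_true ⟨hR, hDe⟩, if_neg hR, add_zero]
          exact expect_le_of_le fun e' _ => hg1 e'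
  refine (key k _ (fun e => indic_le_one _) fun e he => indic_of_false (not_not.2 he)).trans ?_
  · rw [Finset.sum_range_succ, add_assoc]
    refine add_le_add_right ?_ _
    rw [← killed_add]
    refine killed_mono (fun e => ?_) k
    by_cases hDe : D e <;> by_cases hR : R k e <;> simp [indic, hDe, hR]

end killed

/-! ### Running and terminated executions -/

/-- The numbers in terms of which the analysis is phrased: the ends of the pull phase and of the
search for an optimal basis, the time that a rumour needs, bounds on the number of original elements
and of copies at a node, and the total number of iterations. -/
structure Schedule where
  pullTime : ℕ
  growTime : ℕ
  spreadTime : ℕ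
  origLoad : ℕ
  copyLoad : ℕ
  horizon : ℕ

section running

variable {n : ℕ} [NeZero n] {H : Type u} {T : Type v} [Fintype H] [LinearOrder H] [LinearOrder T]
  {f : Finset H → T} {P : Params} {q : Schedule} {t M : ℕ}

/-- The number of original elements of all nodes, with multiplicities. -/
def origCount (x : Fin n → NodeState H) : ℕ := ∑ v, Multiset.card (x v).orig

/-- Bounds on the work and on the message lengths. -/
structure Economical (P : Params) (q : Schedule) (e : Execution n H) : Prop where
  work : e.maxWork ≤ P.cs * (6 * P.d ^ 2 + P.L) + (q.origLoad + q.copyLoad) + P.ct * P.L + 2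
  elemBits : e.maxElemBits ≤ 2 + Nat.clog 2 n + Nat.clog 2 (Fintype.card H) +
    Nat.size (q.origLoad + q.copyLoad)
  entryBits : e.maxEntryBits ≤ 2 + Nat.size q.horizon +
    P.d * (1 + Nat.clog 2 (Fintype.card H)) + 1

/-- The properties of an execution at the beginning of iteration `t` that cannot get lost as long as
no node stops and the properties `Good` persist. -/
structure Regular (f : Finset H → T) (P : Params) (q : Schedule) (t : ℕ)
    (e : Execution n H) : Prop where
  running : ∀ v, (e.config v).output = none
  entryInv : EntryInv f P t e.config
  exists_orig : ∀ h, ∃ v, h ∈ (e.config v).orig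
  le_count : n ≤ origCount e.config + (pullers e.config).card
  count_le : origCount e.config + (pullers e.config).card ≤ Fintype.card H + n
  economical : Economical P q e
  found : q.pullTime + q.growTime < t → ∃ v, ∃ e' ∈ (e.config v).entries,
    e'.iter < q.pullTime + q.growTime ∧ f e'.basis = f Finset.univ

/-- The properties of an execution at the beginning of iteration `t` that fail with a small
probability only. -/
structure Good (f : Finset H → T) (q : Schedule) (t : ℕ) (e : Execution n H) : Prop where
  orig_le : ∀ v, Multiset.card (e.config v).orig ≤ q.origLoad
  copies_le : ∀ v, Multiset.card (e.config v).copies ≤ q.copyLoad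
  suppliers : n ≤ 2 * origCount e.config → n ≤ 64 * (suppliers e.config).card
  not_pulling : q.pullTime ≤ t → ∀ v, (e.config v).pulling = false
  found : t = q.pullTime + q.growTime → Found f e.config
  spread : ∀ τ, τ + 1 + q.spreadTime ≤ t →
    holders f false e.config τ = ∅ ∨ holders f false e.config τ = Finset.univ
  exposed : ∀ τ, τ + 1 + 2 * q.spreadTime ≤ t →
    holders f true e.config τ = ∅ ∨ holders f true e.config τ = Finset.univ

/-- All nodes have stopped with an optimal basis. -/
def Done (f : Finset H → T) (P : Params) (q : Schedule) (e : Execution n H) : Prop :=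
  (∀ v, ∃ B, (e.config v).output = some B ∧ IsOptimalBasis f Finset.univ B) ∧ Economical P q e

theorem Good.card_known_le {e : Execution n H} (hg : Good f q t e) (v : Fin n) :
    Multiset.card (e.config v).known ≤ q.origLoad + q.copyLoad := by
  rw [NodeState.known, Multiset.card_add]
  exact add_le_add (hg.orig_le v) (hg.copies_le v)

/-- Nodes that have stopped do nothing. -/
theorem Done.step {e : Execution n H} (hD : Done f P q e) {e' : Execution n H}
    (he' : e' ∈ (step f P t e).support) : Done f P q e' := by
  have hout : ∀ v, (e.config v).output.isSome = true := fun v => by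
    obtain ⟨B, hB, _⟩ := hD.1 v
    rw [hB]; rfl
  obtain ⟨a, ha, inbox, hi, hc, hw, hb, hb'⟩ := mem_support_step he'
  have hact : ∀ v, a v = ⟨e.config v, 0, 0, 0⟩ := by
    intro v
    have := mem_support_indep ha v
    unfold act at this
    rw [if_pos (hout v)] at this
    simpa using this
  have hrec : ∀ v, e'.config v = e.config v := by
    intro v
    have := mem_support_indep hc v
    rw [hact v] at this
    unfold receive at this
    rw [if_pos (hout v)] at this
    simpa using this
  refine ⟨fun v => by rw [hrec v]; exact hD.1 v, ?_, ?_, ?_⟩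
  · rw [hw, max_le_iff]
    refine ⟨hD.2.work, Finset.sup_le fun v _ => ?_⟩
    simp [hact v]
  · rw [hb, max_le_iff]
    refine ⟨hD.2.elemBits, Finset.sup_le fun v _ => ?_⟩
    simp [hact v]
  · rw [hb', max_le_iff]
    refine ⟨hD.2.entryBits, Finset.sup_le fun v _ => ?_⟩
    simp [hact v]

/-- If all nodes hold the best triple of an iteration and none of them has found a violation, then
the triple is optimal. -/
theorem optimal_of_holders (hf : IsLPType f) {e : Execution n H} {τ : ℕ}
    (hinv : EntryInv f P t e.config) (ho : ∀ h, ∃ v, h ∈ (e.config v).orig)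
    (hA : holders f false e.config τ = ∅ ∨ holders f false e.config τ = Finset.univ)
    (hB : holders f true e.config τ = ∅) :
    ∀ v, ∀ e' ∈ (e.config v).entries, e'.iter = τ → f e'.basis = f Finset.univ := by
  intro v m hm hmi
  have hne : holders f false e.config τ ≠ ∅ := by
    have := holders_nonempty (f := f) hm hmi
    exact Finset.nonempty_iff_ne_empty.1 this
  have huniv := hA.resolve_left hne
  have htop : ∀ u, ∃ e' ∈ (e.config u).entries, IsTop f e.config τ e' ∧ e'.valid = true := by
    intro u
    have hu : u ∈ holders f false e.config τ := by rw [huniv]; exact Finset.mem_univ u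
    obtain ⟨e', he', ht, -⟩ := mem_holders.1 hu
    refine ⟨e', he', ht, ?_⟩
    by_contra hv
    have : u ∈ holders f true e.config τ :=
      mem_holders.2 ⟨e', he', ht, fun _ => by simpa using hv⟩
    rw [hB] at this
    exact absurd this (Finset.notMem_empty u)
  obtain ⟨m', hm', htm, _⟩ := htop v
  have hmm : m = m' := hinv.unique v m hm m' hm' (hmi.trans htm.1.symm)
  rw [← hmm] at htm
  by_contra hopt
  have hlt : f m.basis < f (m.basis ∪ Finset.univ) := by
    rw [Finset.union_eq_right.2 (Finset.subset_univ _)]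
    exact lt_of_le_of_ne (hf.monotone _ _ (Finset.subset_univ _)) hopt
  -- The node `u` with a violating original element `g` has compared its triple with `g`.
  obtain ⟨g, -, hg⟩ := exists_violator hf hlt
  obtain ⟨u, hu⟩ := ho g
  obtain ⟨e', he', ht, hv⟩ := htop u
  have hb : e'.basis = m.basis := basisKey_injective (f := f)
    (le_antisymm (htm.2 u e' he' ht.1) (ht.2 v m hm hmi))
  refine hinv.checked u e' he' hv (hb ▸ lt_of_lt_of_le hg (hf.monotone _ _ ?_))
  intro y hy
  rcases Finset.mem_insert.1 hy with rfl | hy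
  · refine Finset.mem_union_right _ (Multiset.mem_toFinset.2 ?_)
    exact Multiset.mem_add.2 (Or.inl hu)
  · exact Finset.mem_union_left _ hy

/-- The mature triples are optimal, or known to be invalid everywhere. So a node that stops has an
optimal basis, and then all nodes stop. -/
theorem outputs_of_output (hf : IsLPType f) {e : Execution n H} (hr : Regular f P q t e)
    (hg : Good f q t e) (hsp : 2 * q.spreadTime + 1 ≤ P.ct * P.L) {a : Fin n → Action H}
    {inbox : Fin n → Multiset (Msg H)} {x' : Fin n → NodeState H}
    (hs : StepData f P t M e.config a inbox x') {v : Fin n} (hv : (x' v).output ≠ none) :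
    ∀ w, ∃ B, (x' w).output = some B ∧ IsOptimalBasis f Finset.univ B := by
  have hinv := hr.entryInv
  have key : ∀ w B, (x' w).output = some B → IsOptimalBasis f Finset.univ B ∧
      ∃ τ, τ + P.ct * P.L ≤ t ∧ ∀ y, ∃ e' ∈ (e.config y).entries, e'.iter = τ ∧
        f e'.basis = f Finset.univ := by
    intro w B hB
    obtain ⟨cp, _, h⟩ := hs.receive w
    rw [h] at hB
    obtain ⟨m, hm, hmi, hmv, hmB⟩ := terminate_output_eq_some hB
    have hu : ∃ u, m ∈ (a u).state.entries := by
      rcases Finset.mem_union.1 (Finset.mem_filter.1 hm).1 with h1 | h1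
      · exact ⟨w, h1⟩
      · exact hs.exists_mem_of_mem_triples (Multiset.mem_toFinset.1 h1)
    obtain ⟨u, hu⟩ := hu
    -- The mature triple `m` is old enough for its validity to be known to all nodes.
    have hmx := hs.mem_entries_of_iter_lt hu (by omega)
    have hval := (check_valid.1 hmv).1
    have hA := hg.spread m.iter (by omega)
    have huniv := hA.resolve_left
      (Finset.nonempty_iff_ne_empty.1 (holders_nonempty (f := f) hmx rfl))
    have hZ : holders f true e.config m.iter = ∅ := by
      refine (hg.exposed m.iter (by omega)).resolve_right fun hZ => ?_
      have : u ∈ holders f true e.config m.iter := by rw [hZ]; exact Finset.mem_univ u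
      obtain ⟨m', hm', htop, hv'⟩ := mem_holders.1 this
      rw [hinv.unique u m' hm' m hmx htop.1] at hv'
      rw [hv' rfl] at hval
      exact absurd hval (by simp)
    have hopt := optimal_of_holders hf hinv hr.exists_orig hA hZ
    refine ⟨⟨Finset.subset_univ _, ?_, ?_⟩, m.iter, by omega, fun y => ?_⟩
    · exact hmB ▸ hinv.basis u m hmx
    · exact hmB ▸ hopt u m hmx rfl
    · have : y ∈ holders f false e.config m.iter := by rw [huniv]; exact Finset.mem_univ y
      obtain ⟨m', hm', htop, -⟩ := mem_holders.1 this
      exact ⟨m', hm', htop.1, hopt y m' hm' htop.1⟩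
  -- All nodes hold an optimal triple of the same iteration, so all of them output in this iteration.
  obtain ⟨B, hB⟩ := Option.ne_none_iff_exists'.1 hv
  obtain ⟨-, τ, hτ, hall⟩ := key v B hB
  intro w
  obtain ⟨m, hm, hmi, hmo⟩ := hall w
  rcases hs.exists_optimal hf hinv (hs.entries_subset w hm) hmo with h | ⟨e', he', hi', -⟩
  · obtain ⟨B', hB'⟩ := Option.ne_none_iff_exists'.1 h
    exact ⟨B', hB', (key w B' hB').1⟩
  · have := (hinv.step hf hs).le_iter w e' he'
    omega

theorem Regular.economical_step (hf : IsLPType f) {e e' : Execution n H} (hr : Regular f P q t e)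
    (hg : Good f q t e) (hdim : dim f ≤ P.d) (ht : t ≤ q.horizon)
    (he' : e' ∈ (step f P t e).support) : Economical P q e' := by
  obtain ⟨a, ha, inbox, hi, hc, hw, hb, hb'⟩ := mem_support_step he'
  have hs := stepData hr.running hg.card_known_le hr.entryInv.iter_lt ha hi hc
  refine ⟨?_, ?_, ?_⟩
  · rw [hw, max_le_iff]
    refine ⟨hr.economical.work, Finset.sup_le fun v _ => ?_⟩
    have h1 := (hs.act v).pulls
    have h2 := (hs.act v).card
    have h3 := hr.entryInv.card_entries_le v
    have h4 := hg.card_known_le v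
    omega
  · rw [hb, max_le_iff]
    refine ⟨hr.economical.elemBits, Finset.sup_le fun v _ => max_le ?_ (Finset.sup_le ?_)⟩
    · have := (hs.act v).bits
      omega
    · intro b hb
      obtain ⟨m, _, rfl⟩ := Multiset.mem_map.1 (Multiset.mem_toFinset.1 hb)
      rcases m with h | h | e <;> simp only [Msg.elemBits, id] <;> omega
  · rw [hb', max_le_iff]
    refine ⟨hr.economical.entryBits, Finset.sup_le fun v _ => Finset.sup_le ?_⟩
    intro b hb
    obtain ⟨m, hm, rfl⟩ := Multiset.mem_map.1 (Multiset.mem_toFinset.1 hb)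
    rcases m with h | h | m
    · simp [Msg.entryBits]
    · simp [Msg.entryBits]
    · have h1 : m ∈ (a v).state.entries := by
        rw [← Finset.mem_val, ← (hs.act v).triples]
        exact (Multiset.mem_filterMap _ _).2 ⟨_, hm, rfl⟩
      obtain ⟨h2, h3, -⟩ := hr.entryInv.action hf hs v m h1
      have h4 := Nat.size_le_size (h3.trans ht)
      have h5 := Nat.mul_le_mul_right (1 + Nat.clog 2 (Fintype.card H))
        (h2.card_le_dim.trans hdim)
      simp only [Msg.entryBits, id]
      omega

/-- A node that leaves the pull phase pushes exactly one original element, which is never lost. -/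
theorem StepData.origCount_add_card_pullers {x x' : Fin n → NodeState H} {a : Fin n → Action H}
    {inbox : Fin n → Multiset (Msg H)} (hs : StepData f P t M x a inbox x') :
    origCount x' + (pullers x').card = origCount x + (pullers x).card := by
  have h1 : ∀ y : Fin n → NodeState H,
      (pullers y).card = ∑ v, if (y v).pulling = true then 1 else 0 := by
    intro y
    rw [pullers, Finset.card_filter]
  have h2 : ∑ v, Multiset.card (origs (inbox v)) = ∑ v, Multiset.card (origs (a v).pushes) := by
    have h3 : ∀ y : Fin n → Multiset (Msg H), ∑ v, Multiset.card (origs (y v)) =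
        Multiset.card (origs (∑ v, y v)) := by
      intro y
      simp only [origs, card_filterMap_eq_countP]
      rw [← Multiset.coe_countPAddMonoidHom, map_sum]
    rw [h3, h3, hs.sum]
  have h4 : origCount x' = origCount x + ∑ v, Multiset.card (origs (inbox v)) := by
    rw [origCount, origCount, ← Finset.sum_add_distrib]
    refine Finset.sum_congr rfl fun v _ => ?_
    rw [hs.orig_eq, Multiset.card_add]
  rw [h4, h2, h1, h1, add_assoc, ← Finset.sum_add_distrib]
  congr 1
  refine Finset.sum_congr rfl fun v _ => ?_
  rw [hs.pulling_eq]
  exact (hs.act v).origs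

/-- An iteration leads to a regular configuration again unless it makes all nodes stop. -/
theorem Regular.step (hf : IsLPType f) {e e' : Execution n H} (hr : Regular f P q t e)
    (hg : Good f q t e) (hsp : 2 * q.spreadTime + 1 ≤ P.ct * P.L) (hdim : dim f ≤ P.d)
    (ht : t ≤ q.horizon) (he' : e' ∈ (step f P t e).support) :
    Regular f P q (t + 1) e' ∨ Done f P q e' := by
  have hec := hr.economical_step hf hg hdim ht he'
  obtain ⟨a, ha, inbox, hi, hc, -⟩ := mem_support_step he'
  have hs := stepData hr.running hg.card_known_le hr.entryInv.iter_lt ha hi hc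
  by_cases hout : ∀ v, (e'.config v).output = none
  swap
  · rw [not_forall] at hout
    obtain ⟨v, hv⟩ := hout
    exact Or.inr ⟨outputs_of_output hf hr hg hsp hs hv, hec⟩
  left
  refine ⟨hout, hr.entryInv.step hf hs, fun h => ?_, ?_, ?_, hec, fun hlt => ?_⟩
  · obtain ⟨v, hv⟩ := hr.exists_orig h
    refine ⟨v, ?_⟩
    rw [hs.orig_eq]
    exact Multiset.mem_add.2 (Or.inl hv)
  · rw [hs.origCount_add_card_pullers]
    exact hr.le_count
  · rw [hs.origCount_add_card_pullers]
    exact hr.count_le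
  · have hex : ∃ v, ∃ m ∈ (e.config v).entries, m.iter < q.pullTime + q.growTime ∧
        f m.basis = f Finset.univ := by
      rcases Nat.lt_or_ge (q.pullTime + q.growTime) t with h | h
      · exact hr.found h
      · have hteq : t = q.pullTime + q.growTime := by omega
        obtain ⟨v, h1 | ⟨m, hm, hmo⟩⟩ := hg.found hteq
        · exact absurd (hr.running v) h1
        · exact ⟨v, m, hm, hteq ▸ hr.entryInv.iter_lt v m hm, hmo⟩
    obtain ⟨v, m, hm, hmi, hmo⟩ := hex
    rcases hs.exists_optimal hf hr.entryInv (hs.entries_subset v hm) hmo with h | ⟨m', hm', hi', ho'⟩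
    · exact absurd (hout v) h
    · exact ⟨v, m', hm', hi' ▸ hmi, ho'⟩

/-- An optimal triple is kept until it is `c_t L` iterations old, and then it makes its node stop. So
there are no regular configurations after that time. -/
theorem Regular.lt_of_lt {e : Execution n H} (hr : Regular f P q t e)
    (ht : q.pullTime + q.growTime < t) : t < q.pullTime + q.growTime + P.ct * P.L := by
  obtain ⟨v, m, hm, hmi, -⟩ := hr.found ht
  have := hr.entryInv.le_iter v m hm
  omega

/-- The initial configuration is regular. -/
theorem regular_of_mem_support_run (ext : Bool) (hext : ext = false → n ≤ Fintype.card H)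
    {e : Execution n H} (he : e ∈ (run n f P ext 0).support) : Regular f P q 0 e := by
  simp only [run, PMF.mem_support_map_iff] at he
  obtain ⟨place, -, rfl⟩ := he
  have hcount : origCount (initial (n := n) ext place) = Fintype.card H := by
    simp only [origCount, initial]
    have h1 : ∀ v : Fin n, Multiset.card ((Finset.univ : Finset H).val.filter fun h => place h = v) =
        (Finset.univ.filter fun h => place h = v).card := fun v => rfl
    simp only [h1]
    rw [← Finset.card_eq_sum_card_fiberwise (f := place) (t := Finset.univ) (fun _ _ => by simp)]
    exact Finset.card_univ
  refine ⟨fun v => rfl, ⟨?_, ?_, ?_, ?_, ?_, ?_⟩, fun h => ⟨place h, ?_⟩, ?_, ?_,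
    ⟨Nat.zero_le _, Nat.zero_le _, Nat.zero_le _⟩, fun h => absurd h (Nat.not_lt_zero _)⟩
  · simp [initial]
  · simp [initial]
  · simp [initial]
  · simp [initial]
  · simp [initial]
  · simp [initial]
  · simp [initial]
  · cases ext with
    | false =>
      rw [hcount]
      exact (hext rfl).trans (Nat.le_add_right _ _)
    | true =>
      have h1 : ∀ v : Fin n, 1 ≤ Multiset.card (initial (H := H) true place v).orig +
          if (initial (H := H) true place v).pulling = true then 1 else 0 := by
        intro v
        simp only [initial, Bool.true_and, decide_eq_true_eq]
        split_ifs <;> omega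
      have h2 := Finset.sum_le_sum fun v (_ : v ∈ (Finset.univ : Finset (Fin n))) => h1 v
      rw [Finset.sum_add_distrib] at h2
      simp only [Finset.sum_const, Finset.card_univ, Fintype.card_fin, smul_eq_mul, mul_one] at h2
      rw [origCount, pullers, Finset.card_filter]
      exact h2
  · rw [hcount]
    exact Nat.add_le_add_left (card_pullers_le _) _

end running

/-! ### The probability of leaving the good configurations -/

section failure

variable {n : ℕ} [NeZero n] {H : Type u} {T : Type v} [Fintype H] [LinearOrder H] [LinearOrder T]
  {f : Finset H → T} {P : Params} {q : Schedule} {t M : ℕ} {ext : Bool}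

/-- Regular and good at time `t`. -/
def Alive (f : Finset H → T) (P : Params) (q : Schedule) (t : ℕ) (e : Execution n H) : Prop :=
  Regular f P q t e ∧ Good f q t e

/-- The inequalities between the parameters that make every single bad event have a probability of
at most `δ`; `N` is the number of elements of `H`. -/
structure Admissible (n N : ℕ) (P : Params) (q : Schedule) (δ : ℝ) : Prop where
  one_le_dim : 1 ≤ P.d
  spread_le : 2 * q.spreadTime + 1 ≤ P.ct * P.L
  load_le : q.origLoad + q.copyLoad ≤ n
  drift : (1 + ((q.origLoad + q.copyLoad : ℕ) : ℝ) / n) * (P.d / (6 * P.d ^ 2 + 1 : ℕ) +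
      (P.cs * (6 * P.d ^ 2 + P.L) : ℕ) / n) ≤ 1 / (5 * P.d)
  copyLoad_eq : q.copyLoad = 9 * q.origLoad
  samples_le : 128 * (P.cs * (6 * P.d ^ 2 + P.L)) ≤ n
  fail_le : (2 : ℝ) ^ (6 * P.d ^ 2) * (255 / 256) ^ (P.cs * (6 * P.d ^ 2 + P.L)) ≤ 1 / 20
  optimal_le : (n : ℝ) * (19 / 20) ^ n ≤ 99 / 100
  pos : 0 < δ
  orig : Real.exp (((N + n : ℕ) : ℝ) / n) ≤ δ * 2 ^ q.origLoad
  copies : 1 + q.horizon * (2 : ℝ) ^ (8 * q.origLoad) ≤ δ * 2 ^ q.copyLoad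
  suppliers : 1 ≤ δ * 4 ^ n
  pull : (n : ℝ) ^ 2 * (399 / 400) ^ q.pullTime ≤ δ
  grow : (n : ℝ) * (1 - 1 / (100 * P.d)) ^ q.growTime ≤ δ
  spread : (n : ℝ) ^ 2 * (5 / 6) ^ q.spreadTime ≤ δ

theorem expect_initial_prod_orig_le (f : Finset H → T) (P : Params) (ext : Bool)
    {wt : Fin n → ℝ≥0∞} (hwt : ∑ v, wt v ≤ n) :
    expect (run n f P ext 0) (fun e => ∏ v, wt v ^ Multiset.card (e.config v).orig) ≤ 1 := by
  classical
  have hn : (n : ℝ≥0∞) ≠ 0 := by simpa using NeZero.ne n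
  rw [run, expect_map, expect_uniformOfFintype]
  have h1 : ∀ place : H → Fin n, ∏ v, wt v ^ Multiset.card (initial (n := n) ext place v).orig =
      ∏ h, wt (place h) := by
    intro place
    rw [← Finset.prod_fiberwise_of_maps_to (s := Finset.univ) (t := Finset.univ) (g := place)
      fun _ _ => Finset.mem_univ _]
    refine Finset.prod_congr rfl fun v _ => ?_
    rw [Finset.prod_congr rfl fun h hh => by rw [(Finset.mem_filter.1 hh).2], Finset.prod_const]
    rfl
  simp only [h1]
  rw [← Fintype.piFinset_univ, ← Finset.prod_univ_sum, Finset.prod_const, Finset.card_univ,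
    Fintype.card_fun, Fintype.card_fin, Nat.cast_pow, div_eq_mul_inv, ENNReal.inv_pow, ← mul_pow]
  refine pow_le_one' ?_ _
  rw [← div_eq_mul_inv]
  exact ENNReal.div_le_of_le_mul (by rwa [one_mul])

theorem killed_prod_orig_le {wt : Fin n → ℝ≥0∞} (hwt : ∑ v, wt v ≤ n) (t : ℕ) :
    killed (run n f P ext 0) (step f P) (Alive f P q) t
      (fun e => ∏ v, wt v ^ Multiset.card (e.config v).orig) ≤ 1 := by
  have h := killed_le_pow_mul (p := run n f P ext 0) (s := step f P) (R := Alive f P q)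
    (Φ := fun e => ∏ v, wt v ^ Multiset.card (e.config v).orig) (c := 1) (a := 0) t
    fun t _ _ e he => by
      rw [one_mul]
      exact expect_step_prod_orig_le he.1.running he.2.card_known_le he.1.entryInv hwt
  rw [zero_add, one_pow, one_mul] at h
  exact h.trans (expect_initial_prod_orig_le f P ext hwt)

/-- No node has many original elements. The weights are `2 c` at `v` and `c` elsewhere, where
`c = n / (n + 1)` makes their average `1`; as there are never more than `|H| + n` original elements,
the powers of `c` cost a factor of at most `exp ((|H| + n) / n)`. -/
theorem killed_orig_le {δ : ℝ} (hq : Admissible n (Fintype.card H) P q δ) (t : ℕ) (v : Fin n) :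
    killed (run n f P ext 0) (step f P) (Alive f P q) t (fun e =>
      indic (Regular f P q t e ∧ q.origLoad < Multiset.card (e.config v).orig)) ≤
      ENNReal.ofReal δ := by
  have hn : (0 : ℝ) < n := by exact_mod_cast Nat.pos_of_ne_zero (NeZero.ne n)
  obtain ⟨c, hc⟩ : ∃ c : ℝ, c = n / (n + 1) := ⟨_, rfl⟩
  have hc0 : 0 < c := by rw [hc]; positivity
  have hc1 : c ≤ 1 := by rw [hc, div_le_one (by positivity)]; linarith
  obtain ⟨wt, hwdef⟩ : ∃ wt : Fin n → ℝ≥0∞, wt =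
      fun w => ENNReal.ofReal c * if w = v then 2 else 1 := ⟨_, rfl⟩
  have hwt : ∑ w, wt w ≤ n := by
    rw [hwdef, ← Finset.mul_sum, ← Finset.add_sum_erase _ _ (Finset.mem_univ v), if_pos rfl,
      Finset.sum_congr rfl fun w hw => if_neg (Finset.ne_of_mem_erase hw), Finset.sum_const,
      Finset.card_erase_of_mem (Finset.mem_univ v), Finset.card_univ, Fintype.card_fin,
      nsmul_eq_mul, mul_one]
    have h1 : (2 : ℝ≥0∞) + ((n - 1 : ℕ) : ℝ≥0∞) = ENNReal.ofReal (n + 1) := by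
      have : 2 + (n - 1) = n + 1 := by have := Nat.pos_of_ne_zero (NeZero.ne n); omega
      rw [← Nat.cast_two, ← Nat.cast_add, this, ← ENNReal.ofReal_natCast]
      push_cast; rfl
    rw [h1, ← ENNReal.ofReal_mul hc0.le, hc, div_mul_cancel₀ _ (by positivity),
      ENNReal.ofReal_natCast]
  refine killed_indic_le (c := ENNReal.ofReal δ) (killed_prod_orig_le hwt t) (fun e he => ?_)
    (mul_one _).le
  obtain ⟨hr, hlt⟩ := he
  have h1 : ∏ w, wt w ^ Multiset.card (e.config w).orig =
      ENNReal.ofReal c ^ origCount e.config * 2 ^ Multiset.card (e.config v).orig := by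
    rw [hwdef]
    simp only [mul_pow]
    rw [Finset.prod_mul_distrib, Finset.prod_pow_eq_pow_sum, ← origCount,
      Finset.prod_eq_single v (fun w _ hw => by rw [if_neg hw, one_pow]) (by simp), if_pos rfl]
  rw [h1]
  have h2 : origCount e.config ≤ Fintype.card H + n := (Nat.le_add_right _ _).trans hr.count_le
  have h3 : (1 / c) ^ (Fintype.card H + n) ≤ δ * 2 ^ q.origLoad := by
    refine le_trans ?_ hq.orig
    have h4 : 1 / c ≤ Real.exp (1 / n) := by
      have h5 : 1 / c = 1 / n + 1 := by
        rw [hc, one_div_div]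
        field_simp
        ring
      rw [h5]
      exact Real.add_one_le_exp _
    refine (pow_le_pow_left₀ (by positivity) h4 _).trans (le_of_eq ?_)
    rw [← Real.exp_nat_mul, mul_one_div]
  have h4 : (1 : ℝ) ≤ δ * (c ^ origCount e.config * 2 ^ Multiset.card (e.config v).orig) := by
    have h5 : c ^ (Fintype.card H + n) ≤ c ^ origCount e.config :=
      pow_le_pow_of_le_one hc0.le hc1 h2
    have h6 : (2 : ℝ) ^ q.origLoad ≤ 2 ^ Multiset.card (e.config v).orig :=
      pow_le_pow_right₀ (by norm_num) hlt.le
    have h7 : (1 : ℝ) ≤ c ^ (Fintype.card H + n) * (δ * 2 ^ q.origLoad) := by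
      refine le_trans (le_of_eq ?_) (mul_le_mul_of_nonneg_left h3 (by positivity))
      rw [← mul_pow, mul_one_div_cancel hc0.ne', one_pow]
    calc (1 : ℝ) ≤ δ * (c ^ (Fintype.card H + n) * 2 ^ q.origLoad) := by
          rw [mul_left_comm]; exact h7
      _ ≤ _ := mul_le_mul_of_nonneg_left (mul_le_mul h5 h6 (by positivity) (by positivity))
          hq.pos.le
  have h5 := ENNReal.ofReal_le_ofReal h4
  rw [ENNReal.ofReal_one, ENNReal.ofReal_mul hq.pos.le, ENNReal.ofReal_mul (by positivity),
    ENNReal.ofReal_pow hc0.le, ENNReal.ofReal_pow (by norm_num), ENNReal.ofReal_ofNat] at h5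
  exact h5

/-- No node has many copies, by Markov's inequality for `2 ^ (number of copies)`. -/
theorem killed_copies_le (hf : IsLPType f) (hdim : dim f = P.d) {δ : ℝ}
    (hq : Admissible n (Fintype.card H) P q δ) (ht : t ≤ q.horizon) (v : Fin n) :
    killed (run n f P ext 0) (step f P) (Alive f P q) t (fun e =>
      indic (q.copyLoad < Multiset.card (e.config v).copies)) ≤
      ENNReal.ofReal δ := by
  have h := killed_le_add_mul (p := run n f P ext 0) (s := step f P) (R := Alive f P q)
    (Φ := fun e => 2 ^ Multiset.card (e.config v).copies) (c := 2 ^ (8 * q.origLoad))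
    (fun t e he => expect_step_two_pow_copies_le hf he.1.running he.2.card_known_le he.1.entryInv
      hq.one_le_dim hdim hq.load_le hq.drift (by have := hq.copyLoad_eq; omega) v) t
  have h0 : expect (run n f P ext 0) (fun e => (2 : ℝ≥0∞) ^ Multiset.card (e.config v).copies) =
      1 := by
    rw [run, expect_map]
    simp [initial, expect_const]
  rw [h0] at h
  refine killed_indic_le (c := (2 ^ q.copyLoad)⁻¹) h (fun e he => ?_) ?_
  · rw [mul_comm, ← div_eq_mul_inv,
      ENNReal.le_div_iff_mul_le (Or.inl (by simp)) (Or.inl (by finiteness)), one_mul]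
    exact pow_le_pow_right₀ (by norm_num) he.le
  · rw [mul_comm, ← div_eq_mul_inv]
    refine ENNReal.div_le_of_le_mul ?_
    have h1 := ENNReal.ofReal_le_ofReal hq.copies
    rw [ENNReal.ofReal_mul hq.pos.le, ENNReal.ofReal_add zero_le_one (by positivity),
      ENNReal.ofReal_one, ENNReal.ofReal_mul (by positivity), ENNReal.ofReal_natCast,
      ENNReal.ofReal_pow (by norm_num), ENNReal.ofReal_pow (by norm_num),
      ENNReal.ofReal_ofNat] at h1
    refine le_trans (add_le_add_right (mul_le_mul_left ?_ _) _) h1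
    exact_mod_cast ht

/-- It is unlikely that half as many elements as there are nodes are in few nodes: sum over the
small sets `A` of nodes the probability that all elements are in `A`. -/
theorem killed_suppliers_le {δ : ℝ} (hq : Admissible n (Fintype.card H) P q δ) (t : ℕ) :
    killed (run n f P ext 0) (step f P) (Alive f P q) t (fun e =>
      indic (n ≤ 2 * origCount e.config ∧ 64 * (suppliers e.config).card < n)) ≤
      ENNReal.ofReal δ := by
  obtain ⟨F, hF⟩ : ∃ F : Finset (Finset (Fin n)), F =
    Finset.univ.filter fun A => 64 * A.card ≤ n := ⟨_, rfl⟩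
  have hbound : killed (run n f P ext 0) (step f P) (Alive f P q) t (fun e =>
      ∑ A ∈ F, ∏ v, (if v ∈ A then (64 : ℝ≥0∞) else 0) ^ Multiset.card (e.config v).orig) ≤
      2 ^ n := by
    rw [killed_sum]
    calc _ ≤ ∑ A ∈ F, (1 : ℝ≥0∞) := by
          refine Finset.sum_le_sum fun A hA => killed_prod_orig_le ?_ t
          rw [Finset.sum_ite_mem, Finset.univ_inter, Finset.sum_const, nsmul_eq_mul, mul_comm]
          rw [hF, Finset.mem_filter] at hA
          exact_mod_cast hA.2
      _ ≤ _ := by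
          rw [Finset.sum_const, nsmul_eq_mul, mul_one]
          have h1 : F.card ≤ 2 ^ n := by
            rw [hF]
            refine (Finset.card_filter_le _ _).trans (le_of_eq ?_)
            rw [Finset.card_univ, Fintype.card_finset, Fintype.card_fin]
          exact_mod_cast h1
  refine killed_indic_le (c := (8 ^ n)⁻¹) hbound (fun e he => ?_) ?_
  · rw [mul_comm, ← div_eq_mul_inv,
      ENNReal.le_div_iff_mul_le (Or.inl (by simp)) (Or.inl (by finiteness)), one_mul]
    have hmem : suppliers e.config ∈ F := by
      rw [hF, Finset.mem_filter]
      exact ⟨Finset.mem_univ _, he.2.le⟩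
    refine le_trans ?_ (Finset.single_le_sum (fun _ _ => zero_le) hmem)
    have h1 : ∏ v, (if v ∈ suppliers e.config then (64 : ℝ≥0∞) else 0) ^
        Multiset.card (e.config v).orig = 64 ^ origCount e.config := by
      rw [origCount, ← Finset.prod_pow_eq_pow_sum]
      refine Finset.prod_congr rfl fun v _ => ?_
      by_cases hv : (e.config v).orig = 0
      · rw [hv, Multiset.card_zero, pow_zero, pow_zero]
      · rw [if_pos]
        exact Finset.mem_filter.2 ⟨Finset.mem_univ v, hv⟩
    rw [h1, show (64 : ℝ≥0∞) = 8 ^ 2 by norm_num, ← pow_mul]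
    exact pow_le_pow_right₀ (by norm_num) he.1
  · rw [mul_comm, ← div_eq_mul_inv]
    refine ENNReal.div_le_of_le_mul ?_
    have h1 := ENNReal.ofReal_le_ofReal hq.suppliers
    rw [ENNReal.ofReal_mul hq.pos.le, ENNReal.ofReal_one, ENNReal.ofReal_pow (by norm_num),
      ENNReal.ofReal_ofNat] at h1
    calc (2 : ℝ≥0∞) ^ n = 1 * 2 ^ n := (one_mul _).symm
      _ ≤ ENNReal.ofReal δ * 4 ^ n * 2 ^ n := mul_le_mul_left h1 _
      _ = _ := by rw [mul_assoc, ← mul_pow]; norm_num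

theorem Regular.card_suppliers_pos [Nonempty H] {e : Execution n H} (hr : Regular f P q t e) :
    0 < (LowLoad.suppliers e.config).card := by
  obtain ⟨v, hv⟩ := hr.exists_orig (Classical.arbitrary H)
  refine Finset.card_pos.2 ⟨v, Finset.mem_filter.2 ⟨Finset.mem_univ v, fun h => ?_⟩⟩
  rw [h] at hv
  exact absurd hv (Multiset.notMem_zero _)

/-- The pull phase ends in time: the potential is at least `1 / n` while a node is pulling. -/
theorem killed_pulling_le [Nonempty H] (hext : ext = false → n ≤ Fintype.card H) {δ : ℝ}
    (hq : Admissible n (Fintype.card H) P q δ) (ht : q.pullTime ≤ t) :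
    killed (run n f P ext 0) (step f P) (Alive f P q) t (fun e =>
      indic (∃ v, (e.config v).pulling = true)) ≤ ENNReal.ofReal δ := by
  have hn : (n : ℝ≥0∞) ≠ 0 := by simpa using NeZero.ne n
  have h := killed_le_pow_mul (p := run n f P ext 0) (s := step f P) (R := Alive f P q)
    (Φ := fun e => pullPot e.config) (c := ENNReal.ofReal (399 / 400)) (a := 0) t
    fun t _ _ e he => expect_step_pullPot_le he.1.running he.2.card_known_le he.1.entryInv
      he.1.card_suppliers_pos he.2.suppliers he.1.le_count
  have h0 : killed (run n f P ext 0) (step f P) (Alive f P q) 0 (fun e => pullPot e.config) ≤ n := by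
    refine expect_le_of_le fun e he => ?_
    have hr := regular_of_mem_support_run (q := q) ext hext he
    refine ENNReal.div_le_of_le_mul ?_
    have h1 : (pullers e.config).card ≤ n * (suppliers e.config).card :=
      (card_pullers_le _).trans (Nat.le_mul_of_pos_right _ hr.card_suppliers_pos)
    exact_mod_cast h1
  rw [zero_add] at h
  refine killed_indic_le (c := n) (h.trans (mul_le_mul_right h0 _)) (fun e he => ?_) ?_
  · obtain ⟨v, hv⟩ := he
    have h1 : 1 ≤ (pullers e.config).card :=
      Finset.card_pos.2 ⟨v, Finset.mem_filter.2 ⟨Finset.mem_univ v, hv⟩⟩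
    have h2 : (n : ℝ≥0∞)⁻¹ ≤ pullPot e.config := by
      rw [pullPot, div_eq_mul_inv]
      refine le_trans (ENNReal.inv_le_inv.2 ?_) (le_mul_of_one_le_left' (by exact_mod_cast h1))
      exact_mod_cast card_suppliers_le _
    refine le_trans (le_of_eq ?_) (mul_le_mul_right h2 _)
    rw [ENNReal.mul_inv_cancel hn (ENNReal.natCast_ne_top n)]
  · refine le_trans (le_of_eq ?_) (ENNReal.ofReal_le_ofReal (le_trans
      (mul_le_mul_of_nonneg_left (pow_le_pow_of_le_one (by norm_num) (by norm_num) ht)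
        (by positivity)) hq.pull))
    rw [ENNReal.ofReal_mul (by positivity), ENNReal.ofReal_pow (by norm_num),
      ENNReal.ofReal_pow (by positivity), ENNReal.ofReal_natCast]
    ring

theorem expect_sample_eq_none_le_of_suppliers {δ : ℝ} {N : ℕ} (hq : Admissible n N P q δ)
    {x : Fin n → NodeState H} (hsup : n ≤ 64 * (suppliers x).card) :
    expect (sample P fun w => (x w).known) (fun q => if q.2 = none then 1 else 0) ≤
      ENNReal.ofReal (1 / 20) := by
  refine (expect_sample_eq_none_le P (fun w => (x w).known) (β := ENNReal.ofReal (1 / 128))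
    (ρ := ENNReal.ofReal (255 / 256)) ?_ ?_).trans ?_
  · have h1 : (suppliers x).card ≤ (Finset.univ.filter fun v => (x v).known ≠ 0).card := by
      refine Finset.card_le_card fun v hv => ?_
      refine Finset.mem_filter.2 ⟨Finset.mem_univ v, fun h => ?_⟩
      exact (Finset.mem_filter.1 hv).2 (add_eq_zero.1 h).1
    refine le_trans ?_ (Nat.cast_le.2 h1)
    rw [← ENNReal.ofReal_natCast n, ← ENNReal.ofReal_natCast (P.cs * _), ← ENNReal.ofReal_natCast,
      ← ENNReal.ofReal_mul (by norm_num), ← ENNReal.ofReal_add (by positivity) (by positivity)]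
    refine ENNReal.ofReal_le_ofReal ?_
    have h2 : (128 : ℝ) * (P.cs * (6 * P.d ^ 2 + P.L) : ℕ) ≤ n := by exact_mod_cast hq.samples_le
    have h3 : (n : ℝ) ≤ 64 * (suppliers x).card := by exact_mod_cast hsup
    linarith
  · have : (2⁻¹ : ℝ≥0∞) = ENNReal.ofReal (1 / 2) := by
      rw [one_div, ENNReal.ofReal_inv_of_pos (by norm_num), ENNReal.ofReal_ofNat]
    rw [this, ← ENNReal.ofReal_mul (by norm_num), ← ENNReal.ofReal_add (by norm_num) (by norm_num)]
    norm_num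
  · rw [← ENNReal.ofReal_pow (by norm_num), ← ENNReal.ofReal_ofNat, ← ENNReal.ofReal_pow (by norm_num),
      ← ENNReal.ofReal_mul (by positivity)]
    exact ENNReal.ofReal_le_ofReal hq.fail_le

/-- If the empty set were optimal, no nonempty set would be a basis, and the dimension would be
`0`. -/
theorem exists_nonempty_optimal (hf : IsLPType f) (hd : 1 ≤ dim f) :
    ∃ B : Finset H, B.Nonempty ∧ f B = f Finset.univ ∧ B.card ≤ dim f := by
  classical
  obtain ⟨-, hb, hB⟩ := basisOf_spec hf (Finset.univ : Finset H)
  refine ⟨_, ?_, hB, hb.card_le_dim⟩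
  by_contra hne
  rw [Finset.not_nonempty_iff_eq_empty] at hne
  rw [hne] at hB
  have : dim f ≤ 0 := by
    refine Finset.sup_le fun B' hB' => ?_
    rw [Nat.le_zero, Finset.card_eq_zero]
    by_contra h
    have h1 := (Finset.mem_filter.1 hB').2 ∅
      (Finset.ssubset_iff_subset_ne.2 ⟨Finset.empty_subset _, Ne.symm h⟩)
    rw [hB] at h1
    exact absurd (hf.monotone _ _ (Finset.subset_univ B')) (not_le.2 h1)
  omega

/-- An optimal triple is found in time: as long as there is none, the growth potential is at least
`1 / n`, since an element has at most `n * n` copies. -/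
theorem killed_not_found_le (hf : IsLPType f) (hdim : dim f = P.d) {δ : ℝ}
    (hq : Admissible n (Fintype.card H) P q δ) (ht : t = q.pullTime + q.growTime) :
    killed (run n f P ext 0) (step f P) (Alive f P q) t (fun e =>
      indic (Regular f P q t e ∧
        (∀ v, Multiset.card (e.config v).known ≤ q.origLoad + q.copyLoad) ∧ ¬ Found f e.config)) ≤ ENNReal.ofReal δ := by
  have hn : (0 : ℝ) < n := by exact_mod_cast Nat.pos_of_ne_zero (NeZero.ne n)
  have hd1 : (1 : ℝ) ≤ P.d := by exact_mod_cast hq.one_le_dim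
  have hd100 : 1 / (100 * (P.d : ℝ)) ≤ 1 := by
    rw [div_le_one (by positivity)]; linarith
  obtain ⟨B, hB, hBf, hBd⟩ := exists_nonempty_optimal hf (hdim ▸ hq.one_le_dim)
  rw [hdim] at hBd
  have h := killed_le_pow_mul (p := run n f P ext 0) (s := step f P) (R := Alive f P q)
    (Φ := fun e => growthPot f B e.config) (c := ENNReal.ofReal (1 - 1 / (100 * P.d)))
    (a := q.pullTime) q.growTime fun t ht _ e he => by
      have hp := he.2.not_pulling ht
      have hp0 : (pullers e.config).card = 0 := by
        rw [Finset.card_eq_zero, pullers, Finset.filter_eq_empty_iff]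
        intro v _
        simp [hp v]
      have hsup := he.2.suppliers (by have := he.1.le_count; omega)
      exact expect_step_growthPot_le hf he.1.running he.2.card_known_le he.1.entryInv hp
        hq.one_le_dim he.1.exists_orig hq.load_le (expect_sample_eq_none_le_of_suppliers hq hsup)
        hq.optimal_le hB hBf hBd
  have h0 : killed (run n f P ext 0) (step f P) (Alive f P q) q.pullTime
      (fun e => growthPot f B e.config) ≤ 1 := by
    refine (killed_mono (fun e => ?_) _).trans (killed_const_le 1 _)
    rw [growthPot]
    split_ifs
    · exact zero_le
    · exact ENNReal.ofReal_le_one.2 meanPot_le_one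
  rw [← ht] at h
  refine killed_indic_le (c := n) (h.trans (mul_le_mul_right h0 _)) (fun e he => ?_) ?_
  · obtain ⟨hr, hM, hF⟩ := he
    rw [growthPot, if_neg hF, ← ENNReal.ofReal_natCast, ← ENNReal.ofReal_mul hn.le,
      ENNReal.one_le_ofReal]
    have h1 := inv_le_meanPot hB hM hq.load_le fun h _ => total_pos (hr.exists_orig h)
    refine le_trans (le_of_eq ?_) (mul_le_mul_of_nonneg_left h1 hn.le)
    rw [mul_one_div_cancel hn.ne']
  · rw [mul_one, ← ENNReal.ofReal_natCast, ← ENNReal.ofReal_pow (by linarith),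
      ← ENNReal.ofReal_mul hn.le]
    exact ENNReal.ofReal_le_ofReal hq.grow

/-- For `b = false` the rumour is the best triple of iteration `τ`, for `b = true` it is the
information that this triple is invalid. -/
theorem killed_holders_le (hf : IsLPType f) {δ : ℝ} (hq : Admissible n (Fintype.card H) P q δ)
    (b : Bool) {τ : ℕ} (ht : τ + 1 + (if b then 2 else 1) * q.spreadTime ≤ t) :
    killed (run n f P ext 0) (step f P) (Alive f P q) t (fun e =>
      indic (¬ (holders f b e.config τ = ∅ ∨ holders f b e.config τ = Finset.univ))) ≤ ENNReal.ofReal δ := by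
  have hn0 : n ≠ 0 := NeZero.ne n
  have hn : (n : ℝ≥0∞) ≠ 0 := by simpa using hn0
  obtain ⟨a, ha⟩ : ∃ a, a = τ + 1 + if b then q.spreadTime else 0 := ⟨_, rfl⟩
  obtain ⟨j, rfl⟩ : ∃ j, t = a + j := Nat.exists_eq_add_of_le (by
    rw [ha]; cases b <;> simp at ht ⊢ <;> omega)
  have hj : q.spreadTime ≤ j := by cases b <;> simp at ha ht <;> omega
  have h := killed_le_pow_mul (p := run n f P ext 0) (s := step f P) (R := Alive f P q)
    (Φ := fun e => spreadPot n (holders f b e.config τ).card) (c := ENNReal.ofReal (5 / 6))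
    (a := a) j fun t ht _ e he => by
      refine expect_step_spreadPot_le hf b he.1.running he.2.card_known_le he.1.entryInv
        (by omega) fun hb hempty => ?_
      subst hb
      exact optimal_of_holders hf he.1.entryInv he.1.exists_orig
        (he.2.spread τ (by simp at ha; omega)) hempty
  have h0 : killed (run n f P ext 0) (step f P) (Alive f P q) a
      (fun e => spreadPot n (holders f b e.config τ).card) ≤ n :=
    (killed_mono (fun e => spreadPot_le n _) _).trans (killed_const_le _ _)
  refine killed_indic_le (c := n) (h.trans (mul_le_mul_right h0 _)) (fun e he => ?_) ?_
  · rw [not_or] at he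
    have h1 : 0 < (holders f b e.config τ).card :=
      Finset.card_pos.2 (Finset.nonempty_iff_ne_empty.2 he.1)
    have h2 : (holders f b e.config τ).card < n := by
      have := (Finset.card_lt_iff_ne_univ _).2 he.2
      rwa [Fintype.card_fin] at this
    refine le_trans (le_of_eq ?_) (mul_le_mul_right (inv_le_spreadPot h1 h2) _)
    rw [ENNReal.mul_inv_cancel hn (ENNReal.natCast_ne_top n)]
  · refine le_trans (le_of_eq ?_) (ENNReal.ofReal_le_ofReal (le_trans
      (mul_le_mul_of_nonneg_left (pow_le_pow_of_le_one (by norm_num) (by norm_num) hj)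
        (by positivity)) hq.spread))
    rw [ENNReal.ofReal_mul (by positivity), ENNReal.ofReal_pow (by norm_num),
      ENNReal.ofReal_pow (by positivity), ENNReal.ofReal_natCast]
    ring

theorem killed_indic_and_le {E : Type*} {p : PMF E} {s : ℕ → E → PMF E} {R : ℕ → E → Prop}
    {A : Prop} {Q : E → Prop} {δ : ℝ≥0∞} {k : ℕ}
    (h : A → killed p s R k (fun e => indic (Q e)) ≤ δ) :
    killed p s R k (fun e => indic (A ∧ Q e)) ≤ δ := by
  by_cases hA : A
  · simpa [hA] using h hA
  · refine le_trans ((killed_mono (fun e => ?_) k).trans (killed_const_le 0 k)) zero_le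
    rw [indic_of_false fun h => hA h.1]

/-- The union bound over all bad events at time `t`. -/
theorem indic_not_good_le {e : Execution n H} :
    indic (Regular f P q t e ∧ ¬ Good f q t e) ≤
      ∑ v, indic (Regular f P q t e ∧ q.origLoad < Multiset.card (e.config v).orig) +
      ∑ v, indic (q.copyLoad < Multiset.card (e.config v).copies) +
      indic (n ≤ 2 * origCount e.config ∧ 64 * (suppliers e.config).card < n) +
      indic (q.pullTime ≤ t ∧ ∃ v, (e.config v).pulling = true) +
      indic (t = q.pullTime + q.growTime ∧ Regular f P q t e ∧
        (∀ v, Multiset.card (e.config v).known ≤ q.origLoad + q.copyLoad) ∧ ¬ Found f e.config) +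
      ∑ b : Bool, ∑ τ ∈ Finset.range t,
        indic (τ + 1 + (if b then 2 else 1) * q.spreadTime ≤ t ∧
          ¬ (holders f b e.config τ = ∅ ∨ holders f b e.config τ = Finset.univ)) := by
  refine indic_le fun ⟨hr, hg⟩ => ?_
  by_cases h1 : ∀ v, Multiset.card (e.config v).orig ≤ q.origLoad
  swap
  · obtain ⟨v, hv⟩ := not_forall.1 h1
    have := Finset.single_le_sum (f := fun v => indic (Regular f P q t e ∧
      q.origLoad < Multiset.card (e.config v).orig)) (fun _ _ => zero_le) (Finset.mem_univ v)
    rw [indic_of_true ⟨hr, not_le.1 hv⟩] at this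
    simp only [add_assoc]
    exact this.trans le_self_add
  by_cases h2 : ∀ v, Multiset.card (e.config v).copies ≤ q.copyLoad
  swap
  · obtain ⟨v, hv⟩ := not_forall.1 h2
    have := Finset.single_le_sum (f := fun v => indic
      (q.copyLoad < Multiset.card (e.config v).copies)) (fun _ _ => zero_le) (Finset.mem_univ v)
    rw [indic_of_true (not_le.1 hv)] at this
    refine this.trans ?_
    rw [add_assoc, add_assoc, add_assoc, add_assoc, add_left_comm]
    exact le_self_add
  by_cases h3 : n ≤ 2 * origCount e.config → n ≤ 64 * (suppliers e.config).card
  swap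
  · rw [Classical.not_imp, not_le] at h3
    rw [indic_of_true h3]
    exact le_add_right (le_add_right (le_add_right le_add_self))
  by_cases h4 : q.pullTime ≤ t → ∀ v, (e.config v).pulling = false
  swap
  · have h4' : q.pullTime ≤ t ∧ ∃ v, (e.config v).pulling = true := by simpa using h4
    rw [indic_of_true h4']
    exact le_add_right (le_add_right le_add_self)
  by_cases h5 : t = q.pullTime + q.growTime → Found f e.config
  swap
  · rw [Classical.not_imp] at h5
    have h6 : ∀ v, Multiset.card (e.config v).known ≤ q.origLoad + q.copyLoad := fun v => by
      rw [NodeState.known, Multiset.card_add]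
      exact add_le_add (h1 v) (h2 v)
    have h7 : t = q.pullTime + q.growTime ∧ Regular f P q t e ∧
        (∀ v, Multiset.card (e.config v).known ≤ q.origLoad + q.copyLoad) ∧ ¬ Found f e.config :=
      ⟨h5.1, hr, h6, h5.2⟩
    rw [indic_of_true h7]
    exact le_add_right le_add_self
  have h6 : ∃ b : Bool, ∃ τ, τ + 1 + (if b then 2 else 1) * q.spreadTime ≤ t ∧
      ¬ (holders f b e.config τ = ∅ ∨ holders f b e.config τ = Finset.univ) := by
    by_contra hno
    push Not at hno
    refine hg ⟨h1, h2, h3, h4, h5, fun τ hτ => ?_, fun τ hτ => ?_⟩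
    · have := hno false τ (by simpa using hτ)
      by_contra hcon
      exact hcon this
    · have := hno true τ (by simpa using hτ)
      by_contra hcon
      exact hcon this
  obtain ⟨b, τ, hτ, hb⟩ := h6
  refine le_trans ?_ le_add_self
  refine le_trans ?_ (Finset.single_le_sum (fun _ _ => zero_le) (Finset.mem_univ b))
  refine le_trans ?_ (Finset.single_le_sum (fun _ _ => zero_le)
    (Finset.mem_range.2 (by omega : τ < t)))
  rw [indic_of_true ⟨hτ, hb⟩]

theorem killed_not_good_le [Nonempty H] (hf : IsLPType f) (hdim : dim f = P.d)
    (hext : ext = false → n ≤ Fintype.card H) {δ : ℝ}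
    (hq : Admissible n (Fintype.card H) P q δ) (ht : t ≤ q.horizon) :
    killed (run n f P ext 0) (step f P) (Alive f P q) t
      (fun e => indic (Regular f P q t e ∧ ¬ Good f q t e)) ≤
      (2 * n + 3 + 2 * q.horizon : ℕ) * ENNReal.ofReal δ := by
  refine (killed_mono (fun e => indic_not_good_le) t).trans ?_
  simp only [killed_add, killed_sum]
  have h1 := Finset.sum_le_sum fun v (_ : v ∈ (Finset.univ : Finset (Fin n))) =>
    killed_orig_le (f := f) (ext := ext) hq t v
  have h2 := Finset.sum_le_sum fun v (_ : v ∈ (Finset.univ : Finset (Fin n))) =>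
    killed_copies_le (ext := ext) hf hdim hq ht v
  have h3 := killed_suppliers_le (f := f) (ext := ext) hq t
  have h4 := killed_indic_and_le (A := q.pullTime ≤ t) fun h =>
    killed_pulling_le (f := f) (t := t) hext hq h
  have h5 := killed_indic_and_le (A := t = q.pullTime + q.growTime) fun h =>
    killed_not_found_le (ext := ext) hf hdim hq h
  have h6 := Finset.sum_le_sum fun b (_ : b ∈ (Finset.univ : Finset Bool)) =>
    Finset.sum_le_sum fun τ (_ : τ ∈ Finset.range t) => killed_indic_and_le
      (A := τ + 1 + (if b then 2 else 1) * q.spreadTime ≤ t) fun h =>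
        killed_holders_le (ext := ext) hf hq b h
  refine (add_le_add (add_le_add (add_le_add (add_le_add (add_le_add h1 h2) h3) h4) h5) h6).trans ?_
  simp only [Finset.sum_const, Finset.card_univ, Fintype.card_fin, Finset.card_range,
    nsmul_eq_mul, Fintype.card_bool]
  calc _ = ((2 * n + 3 + 2 * t : ℕ) : ℝ≥0∞) * ENNReal.ofReal δ := by push_cast; ring
    _ ≤ _ := mul_le_mul_left (Nat.cast_le.2 (by omega)) _

/-- With high probability all nodes have stopped with an optimal basis at the horizon. -/
theorem expect_not_done_le [Nonempty H] (hf : IsLPType f) (hdim : dim f = P.d)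
    (hext : ext = false → n ≤ Fintype.card H) {δ : ℝ}
    (hq : Admissible n (Fintype.card H) P q δ)
    (hhor : q.horizon = q.pullTime + q.growTime + P.ct * P.L + 1) :
    expect (run n f P ext q.horizon) (fun e => indic (¬ Done f P q e)) ≤
      ((q.horizon + 1) * (2 * n + 3 + 2 * q.horizon) : ℕ) * ENNReal.ofReal δ := by
  have h := expect_not_le_sum_killed (q := fun k => run n f P ext k) (s := step f P)
    (R := Alive f P q) (fun k => rfl) (D := Done f P q) (fun t e hD e' he' => hD.step he') q.horizon
  have h0 : killed (run n f P ext 0) (step f P) (Alive f P q) q.horizon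
      (fun e => indic (Alive f P q q.horizon e)) ≤ 0 := by
    refine (killed_mono (fun e => ?_) _).trans (killed_const_le 0 _)
    rw [indic_of_false]
    intro ha
    have := ha.1.lt_of_lt (by omega)
    omega
  refine h.trans ((add_le_add_right h0 _).trans ?_)
  rw [add_zero]
  have h1 : ∀ t ∈ Finset.range (q.horizon + 1),
      killed (run n f P ext 0) (step f P) (Alive f P q) t
        (fun e => indic (¬ Alive f P q t e ∧ ¬ Done f P q e)) ≤
      (2 * n + 3 + 2 * q.horizon : ℕ) * ENNReal.ofReal δ := by
    intro t ht
    have ht' : t ≤ q.horizon := Nat.lt_succ_iff.1 (Finset.mem_range.1 ht)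
    refine le_trans ?_ (killed_not_good_le (ext := ext) hf hdim hext hq ht')
    cases t with
    | zero =>
      refine expect_mono_support fun e he => indic_le fun h => ?_
      have hr := regular_of_mem_support_run (q := q) ext hext he
      rw [indic_of_true ⟨hr, fun hg => h.1 ⟨hr, hg⟩⟩]
    | succ t =>
      refine killed_succ_mono fun e he e' he' => indic_le fun h => ?_
      have hr := (he.1.step hf he.2 hq.spread_le hdim.le (by omega) he').resolve_right h.2
      rw [indic_of_true ⟨hr, fun hg => h.1 ⟨hr, hg⟩⟩]
  refine (Finset.sum_le_sum h1).trans (le_of_eq ?_)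
  rw [Finset.sum_const, Finset.card_range, nsmul_eq_mul]
  push_cast
  ring

end failure

/-! ### The choice of the parameters -/

section numerics

theorem le_two_pow_ceil {m : ℝ} (hm : 0 < m) : m ≤ 2 ^ ⌈2 * Real.log m⌉₊ := by
  have h1 : Real.log m ≤ ⌈2 * Real.log m⌉₊ * Real.log 2 := by
    have h2 := Nat.le_ceil (2 * Real.log m)
    have h3 := Real.log_two_gt_d9
    have h4 : (0 : ℝ) ≤ ⌈2 * Real.log m⌉₊ := Nat.cast_nonneg _
    nlinarith
  calc m = Real.exp (Real.log m) := (Real.exp_log hm).symm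
    _ ≤ Real.exp (⌈2 * Real.log m⌉₊ * Real.log 2) := Real.exp_le_exp.2 h1
    _ = _ := by rw [Real.exp_nat_mul, Real.exp_log (by norm_num)]

theorem clog_le {m : ℕ} (hm : 1 ≤ m) : (Nat.clog 2 m : ℝ) ≤ 2 * Real.log m + 1 := by
  have hm' : (0 : ℝ) < m := by exact_mod_cast hm
  have h0 : 0 ≤ Real.log m := Real.log_nonneg (by exact_mod_cast hm)
  have h1 : Nat.clog 2 m ≤ ⌈2 * Real.log m⌉₊ :=
    Nat.clog_le_of_le_pow (by exact_mod_cast le_two_pow_ceil hm')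
  have h2 : (Nat.clog 2 m : ℝ) ≤ ⌈2 * Real.log m⌉₊ := by exact_mod_cast h1
  exact h2.trans (Nat.ceil_lt_add_one (by linarith)).le

theorem size_le {k m : ℕ} (hk : k < m) : (Nat.size k : ℝ) ≤ 2 * Real.log m + 1 := by
  have hm : 1 ≤ m := by omega
  have hm' : (0 : ℝ) < m := by exact_mod_cast hm
  have h0 : 0 ≤ Real.log m := Real.log_nonneg (by exact_mod_cast hm)
  have h1 : Nat.size k ≤ ⌈2 * Real.log m⌉₊ :=
    Nat.size_le.2 (lt_of_lt_of_le hk (by exact_mod_cast le_two_pow_ceil hm'))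
  have h2 : (Nat.size k : ℝ) ≤ ⌈2 * Real.log m⌉₊ := by exact_mod_cast h1
  exact h2.trans (Nat.ceil_lt_add_one (by linarith)).le

theorem one_sub_pow_le_exp {z : ℝ} (hz : z ≤ 1) (k : ℕ) : (1 - z) ^ k ≤ Real.exp (-(k * z)) := by
  rw [← mul_neg, Real.exp_nat_mul]
  refine pow_le_pow_left₀ (by linarith) ?_ k
  have := Real.add_one_le_exp (-z)
  linarith

theorem exp_half_le_two_pow (k : ℕ) : Real.exp (k / 2) ≤ 2 ^ k := by
  have h3 := Real.log_two_gt_d9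
  calc Real.exp (k / 2) ≤ Real.exp (k * Real.log 2) :=
        Real.exp_le_exp.2 (by have : (0 : ℝ) ≤ k := Nat.cast_nonneg k; nlinarith)
    _ = 2 ^ k := by rw [Real.exp_nat_mul, Real.exp_log (by norm_num)]

theorem pow_mul_one_sub_pow_le {x ℓ g z : ℝ} {j k : ℕ} (hx : x = Real.exp ℓ) (hz : z ≤ 1)
    (h : (g + j) * ℓ ≤ k * z) : x ^ j * (1 - z) ^ k ≤ Real.exp (-(g * ℓ)) := by
  rw [hx, ← Real.exp_nat_mul]
  refine (mul_le_mul_of_nonneg_left (one_sub_pow_le_exp hz k) (Real.exp_pos _).le).trans ?_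
  rw [← Real.exp_add]
  exact Real.exp_le_exp.2 (by linarith)

/-- The probability that a sample fails, for `c_s ≥ 1024`: one has `(255 / 256) ^ 1024 ≤ 1 / 40`. -/
theorem two_pow_mul_pow_le {d L cs : ℕ} (hd : 1 ≤ d) (hcs : 1024 ≤ cs) :
    (2 : ℝ) ^ (6 * d ^ 2) * (255 / 256) ^ (cs * (6 * d ^ 2 + L)) ≤ 1 / 20 := by
  have h1 : 1024 * (6 * d ^ 2) ≤ cs * (6 * d ^ 2 + L) :=
    Nat.mul_le_mul hcs (Nat.le_add_right _ _)
  have h2 : ((255 : ℝ) / 256) ^ 1024 ≤ 1 / 40 := by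
    have h3 : ((255 : ℝ) / 256) ^ 256 ≤ 3 / 8 := by norm_num
    rw [show 1024 = 256 * 4 by norm_num, pow_mul]
    exact (pow_le_pow_left₀ (by positivity) h3 4).trans (by norm_num)
  calc (2 : ℝ) ^ (6 * d ^ 2) * (255 / 256) ^ (cs * (6 * d ^ 2 + L))
      ≤ 2 ^ (6 * d ^ 2) * (255 / 256) ^ (1024 * (6 * d ^ 2)) :=
        mul_le_mul_of_nonneg_left (pow_le_pow_of_le_one (by norm_num) (by norm_num) h1)
          (by positivity)
    _ ≤ 2 ^ (6 * d ^ 2) * (1 / 40) ^ (6 * d ^ 2) := by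
        rw [pow_mul (255 / 256 : ℝ)]
        exact mul_le_mul_of_nonneg_left (pow_le_pow_left₀ (by positivity) h2 _) (by positivity)
    _ = (1 / 20) ^ (6 * d ^ 2) := by rw [← mul_pow]; norm_num
    _ ≤ 1 / 20 := pow_le_of_le_one (by norm_num) (by norm_num)
        (by positivity)

/-- The schedule of the analysis; `g` is the exponent of the failure probability of a single bad
event, and the horizon is chosen such that an optimal triple that exists at the end of the search
has matured. -/
def schedule (K g : ℝ) (n : ℕ) (P : Params) : Schedule where
  pullTime := ⌈400 * (g + 2) * Real.log n⌉₊
  growTime := ⌈100 * (g + 1) * (P.d * Real.log n)⌉₊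
  spreadTime := (P.ct * P.L - 1) / 2
  origLoad := ⌈2 * (K + g + 5) * Real.log n⌉₊
  copyLoad := 9 * ⌈2 * (K + g + 5) * Real.log n⌉₊
  horizon := ⌈400 * (g + 2) * Real.log n⌉₊ + ⌈100 * (g + 1) * (P.d * Real.log n)⌉₊ +
    P.ct * P.L + 1

/-- What has to be known about the order of magnitude of the parameters, in terms of
`y = n ^ (1 / 10)`. The last three requirements say that `y` exceeds the constants in the bounds on
the number of pull operations, on the load, and on the number of iterations, so that these numbers
are at most small powers of `y`, and in particular at most `n`. -/
structure Scale (K g β : ℝ) (n : ℕ) (P : Params) (y : ℝ) : Prop where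
  one_le_y : 1 ≤ y
  pow_y : y ^ 10 = n
  one_le_log : 1 ≤ Real.log n
  log_le : Real.log n ≤ 10 * y
  one_le_dim : 1 ≤ P.d
  dim_le : (P.d : ℝ) ≤ y
  L_le : (P.L : ℝ) ≤ β * Real.log n
  K_pos : 0 < K
  g_pos : 0 < g
  β_pos : 0 < β
  samples : 128 * (P.cs * (6 + 10 * β)) ≤ y
  load : 110 * (20 * (K + g + 5) + 1) ≤ y
  time : 4000 * (g + 2) + 1000 * (g + 1) + 10 * (P.ct * β) + 40 ≤ y

variable {K g β y : ℝ} {n : ℕ} {P : Params}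

theorem Scale.ct_mul_L_le (h : Scale K g β n P y) :
    ((P.ct * P.L : ℕ) : ℝ) ≤ P.ct * β * Real.log n := by
  push_cast
  rw [mul_assoc]
  exact mul_le_mul_of_nonneg_left h.L_le (Nat.cast_nonneg _)

theorem Scale.samples_le (h : Scale K g β n P y) :
    128 * (P.d * ((P.cs * (6 * P.d ^ 2 + P.L) : ℕ) : ℝ)) ≤ n := by
  obtain ⟨hy, hyn, -, hlog, hd, hdy, hL, -, -, hβ, hs, -, -⟩ := h
  have h1 : (P.L : ℝ) ≤ 10 * β * y ^ 2 := by
    refine hL.trans ?_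
    have h2 : y ≤ y ^ 2 := by nlinarith
    nlinarith
  have h2 : ((P.d : ℝ)) ^ 2 ≤ y ^ 2 := pow_le_pow_left₀ (Nat.cast_nonneg _) hdy 2
  have h3 : (6 * (P.d : ℝ) ^ 2 + P.L) ≤ (6 + 10 * β) * y ^ 2 := by linarith
  push_cast
  have hcs : (0 : ℝ) ≤ P.cs := Nat.cast_nonneg _
  calc 128 * ((P.d : ℝ) * (P.cs * (6 * (P.d : ℝ) ^ 2 + P.L)))
      ≤ 128 * (y * (P.cs * ((6 + 10 * β) * y ^ 2))) := by gcongr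
    _ = 128 * (P.cs * (6 + 10 * β)) * y ^ 3 := by ring
    _ ≤ y * y ^ 3 := by gcongr
    _ = y ^ 4 := by ring
    _ ≤ y ^ 10 := pow_le_pow_right₀ hy (by norm_num)
    _ = n := hyn

theorem Scale.load_le (h : Scale K g β n P y) :
    110 * ((schedule K g n P).origLoad : ℝ) ≤ n := by
  obtain ⟨hy, hyn, hlog1, hlog, -, -, -, hK, hg, -, -, hl, -⟩ := h
  have h1 : ((schedule K g n P).origLoad : ℝ) ≤ 2 * (K + g + 5) * Real.log n + 1 :=
    (Nat.ceil_lt_add_one (by positivity)).le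
  have h2 : 2 * (K + g + 5) * Real.log n ≤ 2 * (K + g + 5) * (10 * y) := by gcongr
  calc 110 * ((schedule K g n P).origLoad : ℝ) ≤ 110 * (20 * (K + g + 5) + 1) * y := by nlinarith
    _ ≤ y * y := by gcongr
    _ = y ^ 2 := by ring
    _ ≤ y ^ 10 := pow_le_pow_right₀ hy (by norm_num)
    _ = n := hyn

theorem Scale.horizon_le (h : Scale K g β n P y) :
    ((schedule K g n P).horizon : ℝ) ≤
      (400 * (g + 2) + 100 * (g + 1) + P.ct * β + 3) * (P.d * Real.log n) := by
  have hc := h.ct_mul_L_le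
  obtain ⟨hy, hyn, hlog1, hlog, hd, hdy, -, hK, hg, hβ, -, -, -⟩ := h
  have hd1 : (1 : ℝ) ≤ P.d := by exact_mod_cast hd
  have h1 : (⌈400 * (g + 2) * Real.log n⌉₊ : ℝ) ≤ 400 * (g + 2) * Real.log n + 1 :=
    (Nat.ceil_lt_add_one (by positivity)).le
  have h2 : (⌈100 * (g + 1) * (P.d * Real.log n)⌉₊ : ℝ) ≤ 100 * (g + 1) * (P.d * Real.log n) + 1 :=
    (Nat.ceil_lt_add_one (by positivity)).le
  have h3 : Real.log n ≤ P.d * Real.log n := le_mul_of_one_le_left (by linarith) hd1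
  have h4 : 400 * (g + 2) * Real.log n ≤ 400 * (g + 2) * (P.d * Real.log n) := by gcongr
  have h5 : (P.ct : ℝ) * β * Real.log n ≤ P.ct * β * (P.d * Real.log n) := by gcongr
  simp only [schedule]
  rw [Nat.cast_add, Nat.cast_add, Nat.cast_add, Nat.cast_one]
  linarith

theorem Scale.horizon_lt (h : Scale K g β n P y) : (schedule K g n P).horizon + 1 ≤ n := by
  have h1 := h.horizon_le
  obtain ⟨hy, hyn, hlog1, hlog, hd, hdy, -, hK, hg, hβ, -, -, ht⟩ := h
  have h2 : (P.d : ℝ) * Real.log n ≤ y * (10 * y) := by gcongr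
  have h3 : ((schedule K g n P).horizon : ℝ) + 1 ≤ n := by
    calc ((schedule K g n P).horizon : ℝ) + 1
        ≤ (400 * (g + 2) + 100 * (g + 1) + P.ct * β + 3) * (y * (10 * y)) + 1 :=
          add_le_add_left (h1.trans (by gcongr)) 1
      _ ≤ (4000 * (g + 2) + 1000 * (g + 1) + 10 * (P.ct * β) + 40) * y ^ 2 := by nlinarith
      _ ≤ y * y ^ 2 := by gcongr
      _ = y ^ 3 := by ring
      _ ≤ y ^ 10 := pow_le_pow_right₀ hy (by norm_num)
      _ = n := hyn
  exact_mod_cast h3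

theorem Scale.n_pos (h : Scale K g β n P y) : (0 : ℝ) < n := by
  rw [← h.pow_y]
  have := h.one_le_y
  positivity

theorem Scale.mul_log_le (h : Scale K g β n P y) {c : ℝ} (hc0 : 0 ≤ c) (hc : 10 * c ≤ y) :
    c * Real.log n ≤ n := by
  have hy := h.one_le_y
  calc c * Real.log n ≤ c * (10 * y) := by gcongr; exact h.log_le
    _ = (10 * c) * y := by ring
    _ ≤ y * y := by gcongr
    _ = y ^ 2 := by ring
    _ ≤ y ^ 10 := pow_le_pow_right₀ hy (by norm_num)
    _ = n := h.pow_y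

theorem exp_mul_log_le_mul_two_pow (K g : ℝ) (n : ℕ) (P : Params) :
    Real.exp ((K + 5) * Real.log n) ≤ Real.exp (-(g * Real.log n)) * 2 ^ (schedule K g n P).origLoad := by
  have hM0 : 2 * (K + g + 5) * Real.log n ≤ (schedule K g n P).origLoad := Nat.le_ceil _
  refine le_trans ?_ (mul_le_mul_of_nonneg_left (exp_half_le_two_pow _) (Real.exp_pos _).le)
  rw [← Real.exp_add]
  refine Real.exp_le_exp.2 ?_
  linarith

theorem Scale.drift (h : Scale K g β n P y) :
    (1 + (((schedule K g n P).origLoad + (schedule K g n P).copyLoad : ℕ) : ℝ) / n) *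
      (P.d / (6 * P.d ^ 2 + 1 : ℕ) + (P.cs * (6 * P.d ^ 2 + P.L) : ℕ) / n) ≤ 1 / (5 * P.d) := by
  have hn0 := h.n_pos
  have hsamples := h.samples_le
  have hd0 : (0 : ℝ) < P.d := by exact_mod_cast h.one_le_dim
  have h1 : (((schedule K g n P).origLoad + (schedule K g n P).copyLoad : ℕ) : ℝ) / n ≤ 1 / 11 := by
    have h2 : (schedule K g n P).copyLoad = 9 * (schedule K g n P).origLoad := rfl
    have h3 := h.load_le
    rw [h2, div_le_div_iff₀ hn0 (by norm_num)]
    push_cast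
    linarith
  have h2 : (P.d : ℝ) / (6 * P.d ^ 2 + 1 : ℕ) ≤ 1 / (6 * P.d) := by
    rw [div_le_div_iff₀ (by positivity) (by positivity)]
    push_cast
    nlinarith
  have h3 : ((P.cs * (6 * P.d ^ 2 + P.L) : ℕ) : ℝ) / n ≤ 1 / (60 * P.d) := by
    rw [div_le_div_iff₀ hn0 (by positivity)]
    have : (0 : ℝ) ≤ P.d * (P.cs * (6 * P.d ^ 2 + P.L) : ℕ) := by positivity
    linarith
  calc _ ≤ (1 + 1 / 11) * (1 / (6 * (P.d : ℝ)) + 1 / (60 * P.d)) := by gcongr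
    _ = 1 / (5 * P.d) := by field_simp; norm_num

theorem Scale.optimal_le (h : Scale K g β n P y) : (n : ℝ) * (19 / 20) ^ n ≤ 99 / 100 := by
  have hlog := h.mul_log_le (c := 40) (by norm_num)
    (by have := h.time; have := h.g_pos; have := mul_nonneg (Nat.cast_nonneg (α := ℝ) P.ct) h.β_pos.le; linarith)
  have h1 := pow_mul_one_sub_pow_le (x := n) (g := 1) (z := 1 / 20) (j := 1) (k := n)
    (Real.exp_log h.n_pos).symm (by norm_num) (by push_cast; linarith)
  have h2 : (1 : ℝ) - 1 / 20 = 19 / 20 := by norm_num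
  rw [pow_one, h2] at h1
  refine h1.trans ((Real.exp_le_exp.2 (by have := h.one_le_log; linarith : _ ≤ (-1 : ℝ))).trans ?_)
  rw [Real.exp_neg]
  refine inv_le_of_inv_le₀ (by norm_num) ?_
  have := Real.exp_one_gt_d9
  norm_num
  linarith

theorem Scale.copies_le (h : Scale K g β n P y) :
    1 + (schedule K g n P).horizon * (2 : ℝ) ^ (8 * (schedule K g n P).origLoad) ≤
      Real.exp (-(g * Real.log n)) * 2 ^ (schedule K g n P).copyLoad := by
  have h1 : (1 + (schedule K g n P).horizon : ℝ) ≤ n := by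
    have : (((schedule K g n P).horizon + 1 : ℕ) : ℝ) ≤ n := by exact_mod_cast h.horizon_lt
    push_cast at this
    linarith
  have h2 : (n : ℝ) ≤ Real.exp (-(g * Real.log n)) * 2 ^ (schedule K g n P).origLoad := by
    refine le_trans ?_ (exp_mul_log_le_mul_two_pow K g n P)
    conv_lhs => rw [← Real.exp_log h.n_pos]
    refine Real.exp_le_exp.2 ?_
    have := h.K_pos
    have := h.one_le_log
    nlinarith
  have h3 : (schedule K g n P).copyLoad =
      (schedule K g n P).origLoad + 8 * (schedule K g n P).origLoad := by
    simp only [schedule]; ring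
  have h12 := h1.trans h2
  rw [h3]
  generalize Real.exp (-(g * Real.log n)) = δ at *
  generalize (schedule K g n P).origLoad = M at *
  generalize (schedule K g n P).horizon = k at *
  rw [pow_add, ← mul_assoc]
  have h4 : (1 : ℝ) ≤ 2 ^ (8 * M) := one_le_pow₀ (by norm_num)
  refine le_trans ?_ (mul_le_mul_of_nonneg_right h12 (by positivity))
  rw [add_mul, one_mul]
  linarith

theorem Scale.admissible (h : Scale K g β n P y) {α : ℝ} (hcs : 1024 ≤ P.cs)
    (hct : 12 * (g + 2) + 2 ≤ P.ct * α) (hL : α * Real.log n ≤ P.L) {N : ℕ}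
    (hN : (N : ℝ) ≤ K * (n * Real.log n)) :
    Admissible n N P (schedule K g n P) (Real.exp (-(g * Real.log n))) := by
  have hn0 := h.n_pos
  have hlog1 := h.one_le_log
  have hg := h.g_pos
  have hd1 : (1 : ℝ) ≤ P.d := by exact_mod_cast h.one_le_dim
  have hnexp : (n : ℝ) = Real.exp (Real.log n) := (Real.exp_log hn0).symm
  have hctL : (12 * (g + 2) + 2) * Real.log n ≤ (P.ct * P.L : ℕ) := by
    push_cast
    calc _ ≤ (P.ct * α) * Real.log n := by gcongr
      _ = P.ct * (α * Real.log n) := by ring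
      _ ≤ _ := by gcongr
  have hctL1 : 1 ≤ P.ct * P.L := by
    have : (1 : ℝ) ≤ (P.ct * P.L : ℕ) := by nlinarith
    exact_mod_cast this
  have hload : (schedule K g n P).origLoad + (schedule K g n P).copyLoad ≤ n := by
    have h1 := h.load_le
    have h2 : (schedule K g n P).copyLoad = 9 * (schedule K g n P).origLoad := rfl
    have h3 : 110 * (schedule K g n P).origLoad ≤ n := by exact_mod_cast h1
    omega
  have hsamples : 128 * (P.cs * (6 * P.d ^ 2 + P.L)) ≤ n := by
    have h1 : (128 : ℝ) * (P.cs * (6 * P.d ^ 2 + P.L) : ℕ) ≤ n := by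
      refine le_trans ?_ h.samples_le
      gcongr
      exact le_mul_of_one_le_left (Nat.cast_nonneg _) hd1
    exact_mod_cast h1
  have horig : Real.exp (((N + n : ℕ) : ℝ) / n) ≤
      Real.exp (-(g * Real.log n)) * 2 ^ (schedule K g n P).origLoad := by
    refine le_trans (Real.exp_le_exp.2 ?_) (exp_mul_log_le_mul_two_pow K g n P)
    rw [div_le_iff₀ hn0]
    push_cast
    have : (n : ℝ) ≤ Real.log n * n := le_mul_of_one_le_left hn0.le hlog1
    linarith
  have hsuppliers : 1 ≤ Real.exp (-(g * Real.log n)) * 4 ^ n := by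
    have h1 : Real.exp (n : ℝ) ≤ 4 ^ n := by
      rw [show (4 : ℝ) = 2 ^ 2 by norm_num, ← pow_mul]
      refine le_trans (le_of_eq ?_) (exp_half_le_two_pow (2 * n))
      push_cast
      ring_nf
    refine le_trans ?_ (mul_le_mul_of_nonneg_left h1 (Real.exp_pos _).le)
    rw [← Real.exp_add]
    refine Real.one_le_exp ?_
    have := h.mul_log_le hg.le (by
      have := h.time
      have := mul_nonneg (Nat.cast_nonneg (α := ℝ) P.ct) h.β_pos.le
      linarith)
    linarith
  have hpull : (n : ℝ) ^ 2 * (399 / 400) ^ (schedule K g n P).pullTime ≤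
      Real.exp (-(g * Real.log n)) := by
    have hT : 400 * (g + 2) * Real.log n ≤ (schedule K g n P).pullTime := Nat.le_ceil _
    rw [show (399 : ℝ) / 400 = 1 - 1 / 400 by norm_num]
    exact pow_mul_one_sub_pow_le hnexp (by norm_num) (by push_cast; linarith)
  have hgrow : (n : ℝ) * (1 - 1 / (100 * P.d)) ^ (schedule K g n P).growTime ≤
      Real.exp (-(g * Real.log n)) := by
    have hT : 100 * (g + 1) * (P.d * Real.log n) ≤ (schedule K g n P).growTime := Nat.le_ceil _
    have := pow_mul_one_sub_pow_le (g := g) (z := 1 / (100 * (P.d : ℝ))) (j := 1)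
      (k := (schedule K g n P).growTime) hnexp
      (by rw [div_le_one (by positivity)]; linarith)
      (by rw [mul_one_div, le_div_iff₀ (by positivity)]; push_cast; linarith)
    rwa [pow_one] at this
  have hspread : (n : ℝ) ^ 2 * (5 / 6) ^ (schedule K g n P).spreadTime ≤
      Real.exp (-(g * Real.log n)) := by
    have hT : 6 * (g + 2) * Real.log n ≤ (schedule K g n P).spreadTime := by
      have h1 : P.ct * P.L ≤ 2 * (schedule K g n P).spreadTime + 2 := by
        simp only [schedule]; omega
      have h2 : ((P.ct * P.L : ℕ) : ℝ) ≤ 2 * (schedule K g n P).spreadTime + 2 := by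
        exact_mod_cast h1
      linarith
    rw [show (5 : ℝ) / 6 = 1 - 1 / 6 by norm_num]
    exact pow_mul_one_sub_pow_le hnexp (by norm_num) (by push_cast; linarith)
  exact ⟨h.one_le_dim, by simp only [schedule]; omega, hload, h.drift, rfl, hsamples,
    two_pow_mul_pow_le h.one_le_dim hcs, h.optimal_le, Real.exp_pos _, horig, h.copies_le,
    hsuppliers, hpull, hgrow, hspread⟩

theorem Scale.clog_card_le (h : Scale K g β n P y) {N : ℕ} (hN1 : 1 ≤ N)
    (hN : (N : ℝ) ≤ K * (n * Real.log n)) :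
    (Nat.clog 2 N : ℝ) ≤ (2 * K + 5) * Real.log n := by
  have hn0 := h.n_pos
  have hK := h.K_pos
  have hlog1 := h.one_le_log
  have hlogn : Real.log n ≤ n := (Real.log_le_sub_one_of_pos hn0).trans (by linarith)
  have h1 : (N : ℝ) ≤ K * (n * n) := hN.trans (by gcongr)
  have h2 : Real.log N ≤ K + 2 * Real.log n := by
    refine (Real.log_le_log (by exact_mod_cast hN1) h1).trans ?_
    rw [Real.log_mul hK.ne' (by positivity), Real.log_mul hn0.ne' hn0.ne']
    have := Real.log_le_sub_one_of_pos hK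
    linarith
  have h3 := clog_le hN1
  nlinarith

/-- The constant in the bounds on the running time, the work, and the message lengths. -/
def costBound (K g β : ℝ) (cs ct : ℕ) : ℝ :=
  3 * (400 * (g + 2) + 100 * (g + 1) + ct * β + 3) + cs * (6 + β) +
    (10 * (2 * (K + g + 5) + 1) + ct * β + 2) + (13 + 2 * K)

theorem Scale.rounds_le (h : Scale K g β n P y) :
    ((3 * (schedule K g n P).horizon : ℕ) : ℝ) ≤
      costBound K g β P.cs P.ct * (P.d * Real.log n) := by
  have h1 := h.horizon_le
  have hK := h.K_pos
  have hg := h.g_pos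
  have hβ := h.β_pos
  have h2 := h.one_le_log
  have h3 : 0 ≤ (P.d : ℝ) * Real.log n := mul_nonneg (Nat.cast_nonneg _) (by linarith)
  have h4 : 0 ≤ P.cs * (6 + β) + (10 * (2 * (K + g + 5) + 1) + P.ct * β + 2) + (13 + 2 * K) := by
    positivity
  have h5 := mul_nonneg h4 h3
  push_cast
  unfold costBound
  linarith

theorem Scale.work_le (h : Scale K g β n P y) :
    ((P.cs * (6 * P.d ^ 2 + P.L) + ((schedule K g n P).origLoad + (schedule K g n P).copyLoad) +
      P.ct * P.L + 2 : ℕ) : ℝ) ≤ costBound K g β P.cs P.ct * ((P.d : ℝ) ^ 2 + Real.log n) := by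
  have hK := h.K_pos
  have hg := h.g_pos
  have hβ := h.β_pos
  have hlog := h.one_le_log
  have hct := h.ct_mul_L_le
  have hM : ((schedule K g n P).origLoad : ℝ) ≤ (2 * (K + g + 5) + 1) * Real.log n := by
    have : ((schedule K g n P).origLoad : ℝ) ≤ 2 * (K + g + 5) * Real.log n + 1 :=
      (Nat.ceil_lt_add_one (by positivity)).le
    linarith
  have h2 : ((schedule K g n P).copyLoad : ℝ) = 9 * (schedule K g n P).origLoad := by
    simp only [schedule]; push_cast; ring
  have hs : (P.cs : ℝ) * (6 * (P.d : ℝ) ^ 2 + P.L) ≤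
      P.cs * (6 + β) * ((P.d : ℝ) ^ 2 + Real.log n) := by
    rw [mul_assoc]
    refine mul_le_mul_of_nonneg_left ?_ (Nat.cast_nonneg _)
    have := h.L_le
    nlinarith [mul_nonneg hβ.le (sq_nonneg (P.d : ℝ))]
  have h3 : Real.log n ≤ (P.d : ℝ) ^ 2 + Real.log n := by
    have := sq_nonneg (P.d : ℝ)
    linarith
  have h4 : (10 * (2 * (K + g + 5) + 1) + P.ct * β + 2) * Real.log n ≤
      (10 * (2 * (K + g + 5) + 1) + P.ct * β + 2) * ((P.d : ℝ) ^ 2 + Real.log n) := by gcongr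
  have h5 : 0 ≤ (3 * (400 * (g + 2) + 100 * (g + 1) + P.ct * β + 3) + (13 + 2 * K)) *
      ((P.d : ℝ) ^ 2 + Real.log n) := by positivity
  push_cast at hct ⊢
  unfold costBound
  linarith

theorem Scale.elemBits_le (h : Scale K g β n P y) {N : ℕ} (hN1 : 1 ≤ N)
    (hN : (N : ℝ) ≤ K * (n * Real.log n)) :
    ((2 + Nat.clog 2 n + Nat.clog 2 N +
      Nat.size ((schedule K g n P).origLoad + (schedule K g n P).copyLoad) : ℕ) : ℝ) ≤
      costBound K g β P.cs P.ct * Real.log n := by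
  have hK := h.K_pos
  have hg := h.g_pos
  have hβ := h.β_pos
  have hlog := h.one_le_log
  have hn : 1 ≤ n := by exact_mod_cast h.n_pos
  have h1 := clog_le hn
  have h2 := h.clog_card_le hN1 hN
  have h3 : (schedule K g n P).origLoad + (schedule K g n P).copyLoad < n := by
    have h3 := h.load_le
    have h4 : (schedule K g n P).copyLoad = 9 * (schedule K g n P).origLoad := rfl
    have h5 : 110 * (schedule K g n P).origLoad ≤ n := by exact_mod_cast h3
    omega
  have h4 := size_le h3
  have h5 : 0 ≤ (3 * (400 * (g + 2) + 100 * (g + 1) + P.ct * β + 3) + P.cs * (6 + β) +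
    (10 * (2 * (K + g + 5) + 1) + P.ct * β + 2)) * Real.log n := by positivity
  push_cast
  unfold costBound
  linarith

theorem Scale.entryBits_le (h : Scale K g β n P y) {N : ℕ} (hN1 : 1 ≤ N)
    (hN : (N : ℝ) ≤ K * (n * Real.log n)) :
    ((2 + Nat.size (schedule K g n P).horizon + P.d * (1 + Nat.clog 2 N) + 1 : ℕ) : ℝ) ≤
      costBound K g β P.cs P.ct * (P.d * Real.log n) := by
  have hK := h.K_pos
  have hg := h.g_pos
  have hβ := h.β_pos
  have hlog := h.one_le_log
  have hd1 : (1 : ℝ) ≤ P.d := by exact_mod_cast h.one_le_dim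
  have h1 := h.clog_card_le hN1 hN
  have h2 := size_le (Nat.lt_of_succ_le h.horizon_lt)
  have h3 : Real.log n ≤ P.d * Real.log n := le_mul_of_one_le_left (by linarith) hd1
  have h4 : (P.d : ℝ) * (1 + Nat.clog 2 N) ≤ P.d * ((2 * K + 6) * Real.log n) := by
    refine mul_le_mul_of_nonneg_left ?_ (by linarith)
    linarith
  have h5 : 0 ≤ (3 * (400 * (g + 2) + 100 * (g + 1) + P.ct * β + 3) + P.cs * (6 + β) +
    (10 * (2 * (K + g + 5) + 1) + P.ct * β + 2)) * (P.d * Real.log n) := by positivity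
  push_cast
  unfold costBound
  linarith

theorem Scale.failure_le {γ : ℝ} (h : Scale K (γ + 3) β n P y) :
    (((schedule K (γ + 3) n P).horizon + 1) * (2 * n + 3 + 2 * (schedule K (γ + 3) n P).horizon) : ℕ) *
      Real.exp (-((γ + 3) * Real.log n)) ≤ 1 / (n : ℝ) ^ γ := by
  have hn0 := h.n_pos
  have h1 := h.horizon_lt
  have hn5 : (5 : ℝ) ≤ n := by
    have := h.mul_log_le (c := 4) (by norm_num) (by
      have := h.time
      have := h.g_pos
      have := mul_nonneg (Nat.cast_nonneg (α := ℝ) P.ct) h.β_pos.le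
      linarith)
    have h2 : 5 * 1 ≤ 5 * Real.log n := by have := h.one_le_log; linarith
    have h3 := h.mul_log_le (c := 5) (by norm_num) (by
      have := h.time
      have := h.g_pos
      have := mul_nonneg (Nat.cast_nonneg (α := ℝ) P.ct) h.β_pos.le
      linarith)
    linarith
  have hn5' : 5 ≤ n := by exact_mod_cast hn5
  have h2 : ((schedule K (γ + 3) n P).horizon + 1) *
      (2 * n + 3 + 2 * (schedule K (γ + 3) n P).horizon) ≤ n ^ 3 := by
    calc _ ≤ n * (n * n) := Nat.mul_le_mul h1 (by nlinarith)
      _ = n ^ 3 := by ring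
  have h3 : ((((schedule K (γ + 3) n P).horizon + 1) *
      (2 * n + 3 + 2 * (schedule K (γ + 3) n P).horizon) : ℕ) : ℝ) ≤ (n : ℝ) ^ 3 := by
    exact_mod_cast h2
  refine (mul_le_mul_of_nonneg_right h3 (Real.exp_pos _).le).trans (le_of_eq ?_)
  have h4 : (n : ℝ) ^ 3 = Real.exp (3 * Real.log n) := by
    rw [show (3 : ℝ) = (3 : ℕ) by norm_num, Real.exp_nat_mul, Real.exp_log hn0]
  rw [h4, ← Real.exp_add, Real.rpow_def_of_pos hn0, one_div, ← Real.exp_neg]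
  congr 1
  ring

/-- All requirements hold if `n` is large enough. -/
theorem exists_scale {K g β : ℝ} (hK : 0 < K) (hg : 0 < g) (hβ : 0 < β) (cs ct : ℕ) :
    ∃ n₀ : ℕ, ∀ n : ℕ, n₀ ≤ n → ∀ d L : ℕ, 1 ≤ d → (d : ℝ) ≤ (n : ℝ) ^ (1 / 10 : ℝ) →
      (L : ℝ) ≤ β * Real.log n → Scale K g β n ⟨d, L, cs, ct⟩ ((n : ℝ) ^ (1 / 10 : ℝ)) := by
  obtain ⟨Y, hY⟩ : ∃ Y, Y = 3 + 128 * (cs * (6 + 10 * β)) + 110 * (20 * (K + g + 5) + 1) +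
    (4000 * (g + 2) + 1000 * (g + 1) + 10 * (ct * β) + 40) := ⟨_, rfl⟩
  have h1 : 0 ≤ 128 * (cs * (6 + 10 * β)) := by positivity
  have h2 : 0 ≤ 110 * (20 * (K + g + 5) + 1) := by positivity
  have h3 : 0 ≤ 4000 * (g + 2) + 1000 * (g + 1) + 10 * (ct * β) + 40 := by positivity
  have hY3 : 3 ≤ Y := by linarith
  refine ⟨⌈Y ^ 10⌉₊, fun n hn d L hd hdn hL => ?_⟩
  have hnY : Y ^ 10 ≤ n := (Nat.le_ceil _).trans (by exact_mod_cast hn)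
  have hn0 : (0 : ℝ) ≤ n := Nat.cast_nonneg n
  have hn3 : (3 : ℝ) ≤ n := by
    refine le_trans ?_ hnY
    calc (3 : ℝ) ≤ Y := hY3
      _ = Y ^ 1 := (pow_one Y).symm
      _ ≤ Y ^ 10 := pow_le_pow_right₀ (by linarith) (by norm_num)
  have hy10 : ((n : ℝ) ^ (1 / 10 : ℝ)) ^ 10 = n := by
    rw [← Real.rpow_natCast, ← Real.rpow_mul hn0]
    norm_num
  have hy0 : 0 ≤ (n : ℝ) ^ (1 / 10 : ℝ) := Real.rpow_nonneg hn0 _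
  have hYy : Y ≤ (n : ℝ) ^ (1 / 10 : ℝ) := by
    refine (pow_le_pow_iff_left₀ (by linarith) hy0 (n := 10) (by norm_num)).1 ?_
    rw [hy10]
    exact hnY
  have hlog1 : 1 ≤ Real.log n := by
    rw [Real.le_log_iff_exp_le (by linarith)]
    have := Real.exp_one_lt_d9
    linarith
  have hlog : Real.log n ≤ 10 * (n : ℝ) ^ (1 / 10 : ℝ) := by
    refine (Real.log_le_rpow_div hn0 (by norm_num : (0 : ℝ) < 1 / 10)).trans (le_of_eq ?_)
    ring
  exact ⟨by linarith, hy10, hlog1, hlog, hd, hdn, hL, hK, hg, hβ, by dsimp only; linarith,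
    by linarith, by dsimp only; linarith⟩

end numerics

end

end LowLoad

theorem theorem1 :
    ∃ ε : ℝ, 0 < ε ∧
    ∀ K γ α β : ℝ, 0 < K → 0 < γ → 0 < α → 0 < β →
    ∃ c₀ : ℕ, ∀ cs ct : ℕ, c₀ ≤ cs → c₀ ≤ ct →
    ∃ (C : ℝ) (n₀ : ℕ),
    ∀ (n : ℕ) [NeZero n], n₀ ≤ n →
    ∀ (H : Type u) [Fintype H] [LinearOrder H] [Nonempty H] (T : Type v) [LinearOrder T]
      (f : Finset H → T),
      LowLoad.IsLPType f →
      1 ≤ LowLoad.dim f → (LowLoad.dim f : ℝ) ≤ (n : ℝ) ^ ε →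
      (Fintype.card H : ℝ) ≤ K * (n * Real.log n) →
    ∀ L : ℕ, α * Real.log n ≤ L → (L : ℝ) ≤ β * Real.log n →
    ∀ ext : Bool, (ext = false → n ≤ Fintype.card H) →
    ∃ k : ℕ,
      ((LowLoad.roundsPerIteration * k : ℕ) : ℝ) ≤ C * (LowLoad.dim f * Real.log n) ∧
      1 - 1 / (n : ℝ) ^ γ ≤
        ((LowLoad.run n f ⟨LowLoad.dim f, L, cs, ct⟩ ext k).toOuterMeasure
          {e | (∀ v : Fin n, ∃ B : Finset H,
                  (e.config v).output = some B ∧ LowLoad.IsOptimalBasis f Finset.univ B) ∧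
               (e.maxWork : ℝ) ≤ C * ((LowLoad.dim f : ℝ) ^ 2 + Real.log n) ∧
               (e.maxElemBits : ℝ) ≤ C * Real.log n ∧
               (e.maxEntryBits : ℝ) ≤ C * (LowLoad.dim f * Real.log n)}).toReal := by
  classical
  refine ⟨1 / 10, by norm_num, fun K γ α β hK hγ hα hβ => ?_⟩
  refine ⟨max 1024 ⌈(12 * ((γ + 3) + 2) + 2) / α⌉₊, fun cs ct hcs hct => ?_⟩
  obtain ⟨n₀, hn₀⟩ := LowLoad.exists_scale hK (by linarith : 0 < γ + 3) hβ cs ct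
  refine ⟨LowLoad.costBound K (γ + 3) β cs ct, n₀, ?_⟩
  intro n _ hn H _ _ _ T _ f hf hd hdn hN L hL hL' ext hext
  have hscale := hn₀ n hn (LowLoad.dim f) L hd hdn hL'
  have hct' : 12 * ((γ + 3) + 2) + 2 ≤ ct * α := by
    rw [← div_le_iff₀ hα]
    exact (Nat.le_ceil _).trans (by exact_mod_cast (le_max_right _ _).trans hct)
  have hadm := hscale.admissible ((le_max_left _ _).trans hcs) hct' hL hN
  have hN1 : 1 ≤ Fintype.card H := Fintype.card_pos
  refine ⟨_, hscale.rounds_le, ?_⟩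
  have hfail := LowLoad.expect_not_done_le (ext := ext) hf rfl hext hadm rfl
  have hle := hscale.failure_le
  rw [← ENNReal.ofReal_natCast, ← ENNReal.ofReal_mul (Nat.cast_nonneg _)] at hfail
  have hfail' := hfail.trans (ENNReal.ofReal_le_ofReal hle)
  rw [LowLoad.toOuterMeasure_eq_expect]
  refine (ENNReal.ofReal_le_iff_le_toReal ?_).1 ?_
  · refine ne_top_of_le_ne_top ENNReal.one_ne_top (LowLoad.expect_le_of_le fun e _ => ?_)
    split_ifs <;> simp
  · rw [ENNReal.ofReal_sub _ (by positivity), ENNReal.ofReal_one, tsub_le_iff_right]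
    refine le_trans ?_ (add_le_add_right hfail' _)
    rw [← LowLoad.expect_add]
    refine le_trans (LowLoad.expect_const _ 1).ge (LowLoad.expect_mono fun e => ?_)
    by_cases hD : LowLoad.Done f ⟨LowLoad.dim f, L, cs, ct⟩
        (LowLoad.schedule K (γ + 3) n ⟨LowLoad.dim f, L, cs, ct⟩) e
    · refine le_trans (le_of_eq ?_) le_self_add
      rw [if_pos]
      refine ⟨hD.1, ?_, ?_, ?_⟩
      · exact le_trans (by exact_mod_cast hD.2.work) hscale.work_le
      · exact le_trans (by exact_mod_cast hD.2.elemBits) (hscale.elemBits_le hN1 hN)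
      · exact le_trans (by exact_mod_cast hD.2.entryBits) (hscale.entryBits_le hN1 hN)
    · rw [LowLoad.indic_of_true hD]
      exact le_add_self
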